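/- **Theorem 1 (Learning Markov-like parameters).** Let $n,m\ge 0$ and $p,L\ge 1$ be integers. Consider the bilinear dynamical system with $x_0=0$ and, for $t\ge 0$, $$x_{t+1}=A_0x_t+\sum_{k=1}^p (u_t)_kA_kx_t+Bu_t+w_t,\qquad y_t=Cx_t+Du_t+z_t,$$ where $x_t,w_t\in\mathbb R^n$, $u_t\in\mathbb R^p$, $y_t,z_t\in\mathbb R^m$ and $A_0,\dots,A_p,B,C,D$ are real matrices of matching sizes. For $u\in\mathbb R^p$ write $u\circ A=A_0+\sum_{k=1}^p u_kA_k$, and let $\|\cdot\|_{op}$ be the spectral norm. *Stability.* Let $\kappa\ge1$, $0<\rho<1$ and $\mathcal M=\{u\circ A: \|u\|_2=\sqrt p\}$. Assume that the system is $(\sqrt p\,\mathcal S^{p-1},\kappa,\rho)$-uniformly stable: the joint spectral radius $\lim_{k\to\infty}\sup_{M_1,\dots,M_k\in\mathcal M}\|M_1\cdots M_k\|_{op}^{1/k}$ is smaller than $\rho$, and $\sup_{k\ge1,\,M_1,\dots,M_k\in\mathcal M}\|M_1\cdots M_k\|_{op}/\rho^k\le\kappa$. *Randomness.* The inputs $(u_t)_{t\ge0}$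 are i.i.d. uniform on the sphere of radius $\sqrt p$ in $\mathbb R^p$. Let $\sigma>0$. Each of $(w_t)_{t\ge0}$ and $(z_t)_{t\ge0}$ is a sequence of independent zero-mean $\sigma^2$-subgaussian random vectors, that is, $\mathbb E\,e^{\langle\theta,X\rangle}\le e^{\sigma^2\|\theta\|_2^2/2}$ for every vector $\theta$. The input process $(u_t)_t$ is independent of the noise process $(w_t,z_t)_t$. *Parameters and estimator.* With $\bar u_t=(1,u_t)\in\mathbb R^{p+1}$, let $\tilde u_t\in\mathbb R^{(p+1)^L+p-1}$ be the vector obtained by stacking $u_t,\ u_{t-1},\ \bar u_{t-1}\otimes u_{t-2},\ \dots,\ \bar u_{t-1}\otimes\cdots\otimes\bar u_{t-L+1}\otimes u_{t-L}$. Let $$G=[\,D\ \ G_1\ \cdots\ G_L\,],\qquad G_1=CB,\qquad G_\ell=\{CA_{i_1}\cdots A_{i_{\ell-1}}B\}_{i_1,\dots,i_{\ell-1}\in\{0,\dots,p\}}\quad(2\le\ell\le L),$$ with the columns in the matching order, and let $$\hat G=\Big(\sum_{t=L}^T y_t\tilde u_t^\top\Big)\Big(\sum_{t=L}^T\tilde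 u_t\tilde u_t^\top\Big)^\dagger$$ be the minimum-norm least-squares estimate of $G$, where $\dagger$ is the Moore–Penrose pseudo-inverse. *Claim.* There are an absolute constant $c>0$ and a polynomial $P$ in three variables with absolute coefficients, with $P(\sigma,b,g)>0$ for all $\sigma>0$ and $b,g\ge0$, such that the following holds for all such systems and processes. Let $\delta\in(0,1)$ and let $T\ge0$ be an integer with $$T-L\ \ge\ c\,L(L+1)\Big(\frac{3p}{p+2}\Big)^{L+1}\Big(\log\frac{L+1}{\delta}+(p+1)^{L+1}\log\frac{(p+1)^{L+1}}{\delta}\Big).$$ Then, with $\mathsf C=P(\sigma,\|B\|_{op},\|C\|_{op})$, with probability at least $1-\delta$, $$\|\hat G-G\|_{op}\ \le\ \frac{\mathsf C\,(\kappa^2\rho^L+\kappa)}{1-\rho}\sqrt{\frac{L\,p^2(p+1)^{L+1}\big(\log(eL/\delta)+m+nL+(p+1)^{L+1}\big)}{T-L}}.$$ -/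

import Mathlib

open MeasureTheory ProbabilityTheory Filter
open scoped Matrix ENNReal NNReal Matrix.Norms.L2Operator

/-- Parameters of a partially observed bilinear dynamical system with state dimension `n`, input
dimension `p` and output dimension `m`. The state matrices are `A 0, A 1, …, A p`. -/
structure BLDS (n p m : ℕ) where
  A : Fin (p + 1) → Matrix (Fin n) (Fin n) ℝ
  B : Matrix (Fin n) (Fin p) ℝ
  C : Matrix (Fin m) (Fin n) ℝ
  D : Matrix (Fin m) (Fin p) ℝ

namespace BLDS

variable {n p m : ℕ}

/-- The matrix `u ∘ A = A₀ + ∑ₖ uₖ Aₖ`. -/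
noncomputable def transMat (S : BLDS n p m) (u : EuclideanSpace ℝ (Fin p)) :
    Matrix (Fin n) (Fin n) ℝ :=
  S.A 0 + ∑ k : Fin p, u k • S.A k.succ

/-- The hidden state, started at `x₀ = 0`:
`x_{t+1} = A₀ x_t + ∑ₖ (u_t)ₖ Aₖ x_t + B u_t + w_t`. -/
noncomputable def state (S : BLDS n p m) (u : ℕ → EuclideanSpace ℝ (Fin p))
    (w : ℕ → EuclideanSpace ℝ (Fin n)) : ℕ → EuclideanSpace ℝ (Fin n)
  | 0 => 0
  | t + 1 => WithLp.toLp 2 (S.transMat (u t) *ᵥ (S.state u w t).ofLp + S.B *ᵥ (u t).ofLp) + w t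

/-- The output `y_t = C x_t + D u_t + z_t`. -/
noncomputable def output (S : BLDS n p m) (u : ℕ → EuclideanSpace ℝ (Fin p))
    (w : ℕ → EuclideanSpace ℝ (Fin n)) (z : ℕ → EuclideanSpace ℝ (Fin m)) (t : ℕ) :
    EuclideanSpace ℝ (Fin m) :=
  WithLp.toLp 2 (S.C *ᵥ (S.state u w t).ofLp + S.D *ᵥ (u t).ofLp) + z t

/-- Coordinates of the covariates: a first block of size `p` (the current input), and for
`ℓ = 0, …, L - 1` a block indexed by `(i₁, …, i_ℓ) ∈ {0, …, p}^ℓ` and `k ∈ {1, …, p}`.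
There are `(p + 1) ^ L + p - 1` of them, see `card_featIdx`. -/
abbrev FeatIdx (p L : ℕ) : Type :=
  Fin p ⊕ (Σ ℓ : Fin L, (Fin ℓ → Fin (p + 1)) × Fin p)

theorem card_featIdx (p L : ℕ) : Fintype.card (FeatIdx p L) + 1 = (p + 1) ^ L + p := by
  have h : ∀ L : ℕ, (∑ ℓ : Fin L, (p + 1) ^ (ℓ : ℕ) * p) + 1 = (p + 1) ^ L := by
    intro L
    induction L with
    | zero => simp
    | succ k ih => rw [Fin.sum_univ_castSucc]; simp only [Fin.val_castSucc, Fin.val_last]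
                   rw [pow_succ]; linarith
  have := h L
  simp [FeatIdx, Fintype.card_sum, Fintype.card_sigma, Fintype.card_prod] at *
  omega

/-- The augmented input `(1, u)`. -/
def aug (u : EuclideanSpace ℝ (Fin p)) : Fin (p + 1) → ℝ := Fin.cons 1 u.ofLp

/-- The covariate vector at time `t`: the stack of `u_t`, `u_{t-1}`, `ū_{t-1} ⊗ u_{t-2}`, …,
`ū_{t-1} ⊗ ⋯ ⊗ ū_{t-L+1} ⊗ u_{t-L}`, where `ū = (1, u)`; used for `t ≥ L` only. -/
def feature (L : ℕ) (u : ℕ → EuclideanSpace ℝ (Fin p)) (t : ℕ) : FeatIdx p L → ℝ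
  | .inl k => u t k
  | .inr ⟨ℓ, (i, k)⟩ => (∏ j : Fin ℓ, aug (u (t - (j + 1))) (i j)) * u (t - (ℓ + 1)) k

/-- The matrix of Markov-like parameters `[D, CB, {C A_{i₁} B}, …, {C A_{i₁} ⋯ A_{i_{L-1}} B}]`. -/
def markov (S : BLDS n p m) (L : ℕ) : Matrix (Fin m) (FeatIdx p L) ℝ :=
  Matrix.of fun r c => match c with
    | .inl k => S.D r k
    | .inr ⟨ℓ, (i, k)⟩ => (S.C * (List.ofFn fun j : Fin ℓ => S.A (i j)).prod * S.B) r k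

/-- The four Penrose conditions: `X` is the Moore–Penrose pseudo-inverse of `M`. -/
structure IsMoorePenrose {ι : Type*} [Fintype ι] (M X : Matrix ι ι ℝ) : Prop where
  mul_mul : M * X * M = M
  mul_mul' : X * M * X = X
  symm_left : (M * X)ᵀ = M * X
  symm_right : (X * M)ᵀ = X * M

theorem IsMoorePenrose.unique {ι : Type*} [Fintype ι] {M X Y : Matrix ι ι ℝ}
    (hX : IsMoorePenrose M X) (hY : IsMoorePenrose M Y) : X = Y := by
  have h1 : M * X = M * Y := by
    calc M * X = (M * Y * M) * X := by rw [hY.mul_mul]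
      _ = (M * Y)ᵀ * (M * X)ᵀ := by rw [hY.symm_left, hX.symm_left]; simp only [mul_assoc]
      _ = ((M * X * M) * Y)ᵀ := by rw [← Matrix.transpose_mul]; simp only [mul_assoc]
      _ = M * Y := by rw [hX.mul_mul, hY.symm_left]
  have h2 : X * M = Y * M := by
    calc X * M = X * (M * Y * M) := by rw [hY.mul_mul]
      _ = (X * M)ᵀ * (Y * M)ᵀ := by rw [hY.symm_right, hX.symm_right]; simp only [mul_assoc]
      _ = (Y * (M * X * M))ᵀ := by rw [← Matrix.transpose_mul]; simp only [mul_assoc]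
      _ = Y * M := by rw [hX.mul_mul, hY.symm_right]
  calc X = X * M * X := hX.mul_mul'.symm
    _ = Y * M * X := by rw [h2]
    _ = Y * (M * Y) := by rw [mul_assoc, h1]
    _ = Y := by rw [← mul_assoc, hY.mul_mul']

theorem exists_isMoorePenrose {ι : Type*} [Fintype ι] [DecidableEq ι] {M : Matrix ι ι ℝ}
    (hM : M.IsHermitian) : ∃ X, IsMoorePenrose M X := by
  set U : Matrix ι ι ℝ := (hM.eigenvectorUnitary : Matrix ι ι ℝ) with hU
  have h1 : Uᵀ * U = 1 := by
    have := Unitary.coe_star_mul_self hM.eigenvectorUnitary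
    simpa [Matrix.star_eq_conjTranspose] using this
  have hs : M = U * Matrix.diagonal hM.eigenvalues * Uᵀ := by
    have := hM.spectral_theorem
    simpa [Unitary.conjStarAlgAut_apply, Matrix.star_eq_conjTranspose, Function.comp_def]
      using this
  have key : ∀ a b : ι → ℝ, (U * Matrix.diagonal a * Uᵀ) * (U * Matrix.diagonal b * Uᵀ)
      = U * Matrix.diagonal (fun i => a i * b i) * Uᵀ := by
    intro a b
    calc _ = U * Matrix.diagonal a * (Uᵀ * U) * Matrix.diagonal b * Uᵀ := by
          simp only [mul_assoc]
      _ = _ := by rw [h1, mul_one, mul_assoc U, Matrix.diagonal_mul_diagonal]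
  have symm : ∀ a : ι → ℝ, (U * Matrix.diagonal a * Uᵀ)ᵀ = U * Matrix.diagonal a * Uᵀ := by
    intro a; simp [Matrix.transpose_mul, mul_assoc]
  clear_value U
  generalize hM.eigenvalues = a at hs
  subst hs
  refine ⟨U * Matrix.diagonal (fun i => (a i)⁻¹) * Uᵀ, ?_, ?_, ?_, ?_⟩
  · rw [key, key]; congr; funext i; exact mul_inv_mul_cancel _
  · rw [key, key]; congr; funext i; simpa using mul_inv_mul_cancel (a i)⁻¹
  · rw [key, symm]
  · rw [key, symm]

open Classical in
/-- The Moore–Penrose pseudo-inverse; used for symmetric matrices only. -/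
noncomputable def pinv {ι : Type*} [Fintype ι] (M : Matrix ι ι ℝ) : Matrix ι ι ℝ :=
  if h : ∃ X, IsMoorePenrose M X then h.choose else 0

theorem isMoorePenrose_pinv {ι : Type*} [Fintype ι] [DecidableEq ι] {M : Matrix ι ι ℝ}
    (hM : M.IsHermitian) : IsMoorePenrose M (pinv M) := by
  have h := exists_isMoorePenrose hM
  rw [pinv, dif_pos h]
  exact h.choose_spec

/-- The empirical second-moment matrix `∑_{t=L}^T ũ_t ũ_tᵀ` of the covariates. -/
def gram (L T : ℕ) (u : ℕ → EuclideanSpace ℝ (Fin p)) : Matrix (FeatIdx p L) (FeatIdx p L) ℝ :=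
  ∑ t ∈ Finset.Icc L T, Matrix.vecMulVec (feature L u t) (feature L u t)

theorem gram_isHermitian (L T : ℕ) (u : ℕ → EuclideanSpace ℝ (Fin p)) :
    (gram L T u).IsHermitian := by
  ext i j
  simp [gram, Matrix.sum_apply, Matrix.vecMulVec_apply, mul_comm]

/-- The minimum norm least-squares estimator `(∑ y_t ũ_tᵀ) (∑ ũ_t ũ_tᵀ)†`, both sums over
`t = L, …, T`, computed from inputs `u` and outputs `y`. -/
noncomputable def lse (L T : ℕ) (u : ℕ → EuclideanSpace ℝ (Fin p))
    (y : ℕ → EuclideanSpace ℝ (Fin m)) : Matrix (Fin m) (FeatIdx p L) ℝ :=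
  (∑ t ∈ Finset.Icc L T, Matrix.vecMulVec (y t).ofLp (feature L u t)) * pinv (gram L T u)

/-- The joint spectral radius `lim_k sup_{M₁, …, M_k ∈ 𝓜} ‖M₁ ⋯ M_k‖ ^ (1 / k)` as an extended
nonnegative real. For a nonempty bounded `𝓜` the limit exists by submultiplicativity; the `limsup`
is that limit. -/
noncomputable def jointSpectralRadius (𝓜 : Set (Matrix (Fin n) (Fin n) ℝ)) : ℝ≥0∞ :=
  limsup (fun k : ℕ => ⨆ (M : Fin k → Matrix (Fin n) (Fin n) ℝ) (_ : ∀ i, M i ∈ 𝓜),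
    ENNReal.ofReal (‖(List.ofFn M).prod‖ ^ (1 / (k : ℝ)))) atTop

/-- `φ(𝓜, ρ) = sup_{k ≥ 1, M₁, …, M_k ∈ 𝓜} ‖M₁ ⋯ M_k‖ / ρ ^ k`, possibly infinite. -/
noncomputable def transientGrowth (𝓜 : Set (Matrix (Fin n) (Fin n) ℝ)) (ρ : ℝ) : ℝ≥0∞ :=
  ⨆ (k : ℕ) (_ : 1 ≤ k) (M : Fin k → Matrix (Fin n) (Fin n) ℝ) (_ : ∀ i, M i ∈ 𝓜),
    ENNReal.ofReal (‖(List.ofFn M).prod‖ / ρ ^ k)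

/-- `(𝓤, κ, ρ)`-uniform stability. -/
structure UniformlyStable (S : BLDS n p m) (𝓤 : Set (EuclideanSpace ℝ (Fin p))) (κ ρ : ℝ) :
    Prop where
  one_le : 1 ≤ κ
  pos : 0 < ρ
  lt_one : ρ < 1
  jsr_lt : jointSpectralRadius (S.transMat '' 𝓤) < ENNReal.ofReal ρ
  growth_le : transientGrowth (S.transMat '' 𝓤) ρ ≤ ENNReal.ofReal κ

/-- The uniform distribution on the sphere of radius `√p` in `ℝ^p`: normalized surface measure of
the unit sphere, scaled by `√p`. -/
noncomputable def unifSphere (p : ℕ) : Measure (EuclideanSpace ℝ (Fin p)) :=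
  let s : Measure (Metric.sphere (0 : EuclideanSpace ℝ (Fin p)) 1) :=
    (volume : Measure (EuclideanSpace ℝ (Fin p))).toSphere
  ((s Set.univ)⁻¹ • s).map
    fun x : Metric.sphere (0 : EuclideanSpace ℝ (Fin p)) 1 =>
      Real.sqrt p • (x : EuclideanSpace ℝ (Fin p))

/-- A zero-mean, `σ²`-subgaussian random vector: `E exp(s ⟨θ, X⟩) ≤ exp(σ² s² / 2)` for all unit
vectors `θ` and all real `s`. -/
structure IsCenteredSubgaussian {Ω : Type*} [MeasurableSpace Ω] (μ : Measure Ω) (d : ℕ) (σ : ℝ)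
    (X : Ω → EuclideanSpace ℝ (Fin d)) : Prop where
  mean_zero : ∫ ω, X ω ∂μ = 0
  subgaussian : ∀ θ : EuclideanSpace ℝ (Fin d), ‖θ‖ = 1 →
    HasSubgaussianMGF (fun ω => inner ℝ θ (X ω)) (Real.toNNReal (σ ^ 2)) μ

end BLDS

/-! Unrolling the recursion gives `y_t = G ũ_t + e_t`, where `e_t` is the sum of the measurement
noise, the process noise filtered by the random transition matrices, and the inputs of age greater
than `L` filtered in the same way. When `S = ∑ ũ_t ũ_tᵀ` is invertible, the estimation error is `Q
S⁻¹` with `Q = ∑ e_t ũ_tᵀ`. So `S` has to be bounded below and `Q` above. Write `D = (p+1)^(L+1)`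
and `N = T - L + 1`.

Lower bound on `S`. The covariates are distinct coordinates of `ū_t ⊗ ⋯ ⊗ ū_{t-L}`. Hence they are
isotropic, have squared norm at most `D`, and are independent at times `L + 1` apart. For such a
covariate `x`, the contraction `1 - D⁻¹ x xᵀ` shrinks the mean squared length of a fixed vector by
the factor `1 - 1/D`. After about `D log D` independent steps the product of these contractions has
small mean Frobenius norm. A product can be small only if the covariates used see every direction
(`le_sum_inner_sq_of_kaczmarz`). A Markov inequality for a product over disjoint blocks shows that
at least half of the blocks have a small product, except with exponentially small probability
(`BLDS.measure_gram_lt_le`). Only second moments and boundedness enter.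

Upper bound on `Q`. For fixed `a` and `b`, `exp(a·Qb - K²/2 |a|² b·Sb)` has mean at most one,
separately for each of the three parts of the error. For the two noises one conditions on the
inputs; stability bounds the adjoint of the filter on `ℓ²`. The old inputs are not independent of
the covariates, but the coefficient of `u_s` involves inputs after time `s` only, so the
supermartingale argument runs backwards in time (`BLDS.lintegral_exp_sum_inner_future_le`). A union
bound over integer grids with Gaussian weights, followed by rounding that loses little in a concave
quadratic function, makes the bound uniform: `|Qb|² ≤ (13K)² τ (b·Sb + N|b|²)` for all `b`
(`measure_mulVec_sq_gt_le`). Taking `b = S⁻¹c` and inserting the lower bound on `S` finishes the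
proof. -/

/-! ### Resampling coordinates of an i.i.d. family. -/

section Resampling

variable {ι E : Type*}

open Classical in
/-- The sequence that agrees with `x` on `I` and with `y` off `I`. -/
noncomputable def splice (I : Set ι) (x y : ι → E) : ι → E := fun i => if i ∈ I then x i else y i

theorem splice_of_mem {I : Set ι} {i : ι} (h : i ∈ I) (x y : ι → E) : splice I x y i = x i :=
  if_pos h

theorem splice_of_notMem {I : Set ι} {i : ι} (h : i ∉ I) (x y : ι → E) :
    splice I x y i = y i := if_neg h

variable [MeasurableSpace E]

theorem measurable_splice (I : Set ι) :
    Measurable fun q : (ι → E) × (ι → E) => splice I q.1 q.2 := by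
  refine measurable_pi_lambda _ fun i => ?_
  by_cases h : i ∈ I
  · simp only [splice_of_mem h]; fun_prop
  · simp only [splice_of_notMem h]; fun_prop

variable (ν : Measure E) [IsProbabilityMeasure ν]

/-- Resampling some coordinates independently does not change the law of an i.i.d. family. -/
theorem map_splice_infinitePi (I : Set ι) :
    ((Measure.infinitePi fun _ : ι => ν).prod (Measure.infinitePi fun _ : ι => ν)).map
      (fun q => splice I q.1 q.2) = Measure.infinitePi fun _ : ι => ν := by
  classical
  refine Measure.eq_infinitePi _ fun s t ht => ?_
  rw [Measure.map_apply (measurable_splice I)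
    (MeasurableSet.pi s.countable_toSet fun i _ => ht i)]
  have : (fun q : (ι → E) × (ι → E) => splice I q.1 q.2) ⁻¹' (Set.pi s t)
      = (Set.pi (s.filter (· ∈ I)) t) ×ˢ (Set.pi (s.filter (· ∉ I)) t) := by
    ext ⟨x, y⟩
    simp only [Set.mem_preimage, Set.mem_pi, Set.mem_prod, Finset.mem_coe, Finset.mem_filter]
    constructor
    · intro h
      refine ⟨fun i hi => ?_, fun i hi => ?_⟩
      · simpa [splice_of_mem hi.2] using h i hi.1
      · simpa [splice_of_notMem hi.2] using h i hi.1
    · rintro ⟨h1, h2⟩ i hi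
      by_cases hI : i ∈ I
      · simpa [splice_of_mem hI] using h1 i ⟨hi, hI⟩
      · simpa [splice_of_notMem hI] using h2 i ⟨hi, hI⟩
  rw [this, Measure.prod_prod, Measure.infinitePi_pi _ (fun i _ => ht i),
    Measure.infinitePi_pi _ (fun i _ => ht i)]
  exact Finset.prod_filter_mul_prod_filter_not s (· ∈ I) _

/-- This plays the part of conditioning: the inner integral averages over fresh coordinates in `I`
while those outside `I` stay frozen. It replaces conditional expectations throughout. -/
theorem lintegral_infinitePi_splice (I : Set ι) {f : (ι → E) → ℝ≥0∞} (hf : Measurable f) :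
    ∫⁻ x, f x ∂(Measure.infinitePi fun _ : ι => ν) =
      ∫⁻ y, ∫⁻ x, f (splice I x y) ∂(Measure.infinitePi fun _ : ι => ν)
        ∂(Measure.infinitePi fun _ : ι => ν) := by
  conv_lhs => rw [← map_splice_infinitePi ν I]
  rw [lintegral_map hf (measurable_splice I), lintegral_prod_symm]
  exact (hf.comp (measurable_splice I)).aemeasurable

end Resampling

/-! ### Symmetry, moments and exponential moments of the uniform law on the sphere. -/

namespace BLDS

variable {p : ℕ}

instance isProbabilityMeasure_unifSphere [NeZero p] : IsProbabilityMeasure (unifSphere p) := by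
  have : Nonempty (Fin p) := ⟨0⟩
  have : Nontrivial (EuclideanSpace ℝ (Fin p)) := inferInstance
  have hne : (volume : Measure (EuclideanSpace ℝ (Fin p))).toSphere ≠ 0 :=
    Measure.toSphere_ne_zero _
  have : NeZero (volume : Measure (EuclideanSpace ℝ (Fin p))).toSphere := ⟨hne⟩
  unfold unifSphere
  exact Measure.isProbabilityMeasure_map (by fun_prop)

open scoped Pointwise in
theorem unifSphere_apply {s : Set (EuclideanSpace ℝ (Fin p))} (hs : MeasurableSet s) :
    unifSphere p s = ((volume : Measure (EuclideanSpace ℝ (Fin p))).toSphere Set.univ)⁻¹ *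
      (Module.finrank ℝ (EuclideanSpace ℝ (Fin p)) *
        volume (Set.Ioo (0 : ℝ) 1 • {y : EuclideanSpace ℝ (Fin p) | ‖y‖ = 1 ∧
          Real.sqrt p • y ∈ s})) := by
  have hm : Measurable fun x : Metric.sphere (0 : EuclideanSpace ℝ (Fin p)) 1 =>
      Real.sqrt p • (x : EuclideanSpace ℝ (Fin p)) := by fun_prop
  unfold unifSphere
  rw [Measure.map_apply hm hs, Measure.smul_apply, smul_eq_mul,
    Measure.toSphere_apply' _ (hm hs)]
  congr 4
  ext y
  simp [and_comm]

open scoped Pointwise in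
-- Surface measure is a multiple of the volume of the cone over a set. A linear isometry carries
-- cones to cones and preserves volume.
theorem map_unifSphere (e : EuclideanSpace ℝ (Fin p) ≃ₗᵢ[ℝ] EuclideanSpace ℝ (Fin p)) :
    (unifSphere p).map e = unifSphere p := by
  ext s hs
  have he : Measurable e := e.continuous.measurable
  rw [Measure.map_apply he hs, unifSphere_apply (he hs), unifSphere_apply hs]
  congr 2
  rw [← (show MeasurePreserving e.toHomeomorph.toMeasurableEquiv volume volume from
    e.measurePreserving).measure_preimage_equiv
    (Set.Ioo (0 : ℝ) 1 • {y | ‖y‖ = 1 ∧ Real.sqrt p • y ∈ s})]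
  congr 1
  ext x
  simp only [Set.mem_smul, Set.mem_ofPred_eq, Set.mem_preimage]
  constructor
  · rintro ⟨r, hr, y, ⟨hy, hy'⟩, rfl⟩
    exact ⟨r, hr, e y, ⟨by simpa using hy, by simpa using hy'⟩, by
      simp⟩
  · rintro ⟨r, hr, y, ⟨hy, hy'⟩, hx⟩
    refine ⟨r, hr, e.symm y, ⟨by simpa using hy, by simpa using hy'⟩, ?_⟩
    apply e.injective
    rw [map_smul, e.apply_symm_apply]
    exact hx

theorem norm_ae_unifSphere : ∀ᵐ u ∂(unifSphere p), ‖u‖ = Real.sqrt p := by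
  unfold unifSphere
  rw [ae_map_iff (by fun_prop) (measurableSet_eq_fun (by fun_prop) (by fun_prop))]
  refine Eventually.of_forall fun x => ?_
  have : ‖(x : EuclideanSpace ℝ (Fin p))‖ = 1 := by simp
  rw [norm_smul, this, mul_one, Real.norm_of_nonneg (Real.sqrt_nonneg _)]

/-- Reflection of the coordinate `i`. -/
noncomputable def flipCoord (i : Fin p) :
    EuclideanSpace ℝ (Fin p) ≃ₗᵢ[ℝ] EuclideanSpace ℝ (Fin p) :=
  LinearIsometryEquiv.piLpCongrRight 2 fun j =>
    if j = i then LinearIsometryEquiv.neg ℝ else LinearIsometryEquiv.refl ℝ ℝ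

theorem flipCoord_apply_self (i : Fin p) (u : EuclideanSpace ℝ (Fin p)) :
    flipCoord i u i = - u i := by
  simp [flipCoord]

theorem flipCoord_apply_ne {i j : Fin p} (h : j ≠ i) (u : EuclideanSpace ℝ (Fin p)) :
    flipCoord i u j = u j := by
  simp [flipCoord, h]

theorem integral_unifSphere_comp
    (e : EuclideanSpace ℝ (Fin p) ≃ₗᵢ[ℝ] EuclideanSpace ℝ (Fin p))
    (f : EuclideanSpace ℝ (Fin p) → ℝ) :
    ∫ u, f (e u) ∂(unifSphere p) = ∫ u, f u ∂(unifSphere p) := by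
  conv_rhs => rw [← map_unifSphere e]
  exact (integral_map_equiv e.toHomeomorph.toMeasurableEquiv f).symm

theorem integral_coord_unifSphere (i : Fin p) : ∫ u, u i ∂(unifSphere p) = 0 := by
  have := integral_unifSphere_comp (flipCoord i) fun u => u i
  simp only [flipCoord_apply_self, integral_neg] at this
  linarith

theorem integral_coord_mul_coord_unifSphere {i j : Fin p} (h : i ≠ j) :
    ∫ u, u i * u j ∂(unifSphere p) = 0 := by
  have := integral_unifSphere_comp (flipCoord i) fun u => u i * u j
  simp only [flipCoord_apply_self, flipCoord_apply_ne h.symm, neg_mul, integral_neg] at this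
  linarith

theorem abs_coord_ae_unifSphere : ∀ᵐ u ∂(unifSphere p), ∀ i, |u i| ≤ Real.sqrt p := by
  filter_upwards [norm_ae_unifSphere (p := p)] with u hu i
  rw [← hu]
  exact PiLp.norm_apply_le u i

/-- Swapping coordinates is an isometry, so all `p` second moments agree, and they add up to the
constant squared norm `p`. -/
theorem integral_coord_sq_unifSphere [NeZero p] (i : Fin p) :
    ∫ u, u i * u i ∂(unifSphere p) = 1 := by
  have hint : ∀ j : Fin p, Integrable (fun u => u j * u j) (unifSphere p) := by
    intro j
    refine Integrable.of_bound (C := p) (by fun_prop) ?_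
    filter_upwards [abs_coord_ae_unifSphere (p := p)] with u hu
    rw [Real.norm_eq_abs, abs_mul]
    calc |u j| * |u j| ≤ Real.sqrt p * Real.sqrt p := by gcongr <;> exact hu j
      _ = p := Real.mul_self_sqrt (by positivity)
  have heq : ∀ j, ∫ u, u j * u j ∂(unifSphere p) = ∫ u, u i * u i ∂(unifSphere p) := by
    intro j
    have := integral_unifSphere_comp
      (LinearIsometryEquiv.piLpCongrLeft 2 ℝ ℝ (Equiv.swap i j)) fun u => u i * u i
    rw [← this]
    refine integral_congr_ae (Eventually.of_forall fun u => ?_)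
    simp [LinearIsometryEquiv.piLpCongrLeft_apply, Equiv.piCongrLeft']
  have hsum : ∑ j, ∫ u, u j * u j ∂(unifSphere p) = p := by
    rw [← integral_finsetSum _ fun j _ => hint j]
    rw [integral_congr_ae (g := fun _ => (p : ℝ))]
    · simp
    · filter_upwards [norm_ae_unifSphere (p := p)] with u hu
      have h2 := EuclideanSpace.real_norm_sq_eq u
      rw [hu, Real.sq_sqrt (by positivity)] at h2
      rw [h2]
      exact Finset.sum_congr rfl fun j _ => by ring
  rw [Finset.sum_congr rfl fun j _ => heq j] at hsum
  simp only [Finset.sum_const, Finset.card_univ, Fintype.card_fin, nsmul_eq_mul] at hsum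
  have hp : (p : ℝ) ≠ 0 := by exact_mod_cast NeZero.ne p
  exact mul_left_cancel₀ hp (hsum.trans (mul_one _).symm)

/-- Hoeffding's lemma: the inner product is centered by antipodal symmetry and lies in an interval
of half-length `‖v‖ √p`. The variance proxy `p ‖v‖²` is the source of the factor `√p` in the final
constant `K`. -/
theorem lintegral_exp_inner_unifSphere [NeZero p] (v : EuclideanSpace ℝ (Fin p)) :
    ∫⁻ u, ENNReal.ofReal (Real.exp (inner ℝ v u)) ∂(unifSphere p) ≤
      ENNReal.ofReal (Real.exp (p * ‖v‖ ^ 2 / 2)) := by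
  have hb : ∀ᵐ u ∂(unifSphere p),
      inner ℝ v u ∈ Set.Icc (-(‖v‖ * Real.sqrt p)) (‖v‖ * Real.sqrt p) := by
    filter_upwards [norm_ae_unifSphere (p := p)] with u hu
    have := abs_real_inner_le_norm v u
    rw [hu] at this
    exact abs_le.1 this
  have hmean : ∫ u, inner ℝ v u ∂(unifSphere p) = 0 := by
    have := integral_unifSphere_comp (LinearIsometryEquiv.neg ℝ) fun u => inner ℝ v u
    simp only [LinearIsometryEquiv.coe_neg, inner_neg_right, integral_neg] at this
    linarith
  have h := hasSubgaussianMGF_of_mem_Icc_of_integral_eq_zero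
    (μ := unifSphere p) (X := fun u => inner ℝ v u) (by fun_prop) hb hmean
  have h1 := h.mgf_le 1
  have h2 := h.integrable_exp_mul 1
  simp only [mgf, one_mul] at h1 h2
  rw [← ofReal_integral_eq_lintegral_ofReal h2 (Eventually.of_forall fun _ => (Real.exp_pos _).le)]
  refine ENNReal.ofReal_le_ofReal (h1.trans (Real.exp_le_exp.2 (le_of_eq ?_)))
  have : ‖‖v‖ * Real.sqrt p - -(‖v‖ * Real.sqrt p)‖ = 2 * (‖v‖ * Real.sqrt p) := by
    rw [sub_neg_eq_add, Real.norm_of_nonneg (by positivity)]; ring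
  push_cast [coe_nnnorm]
  rw [this]
  have hs : Real.sqrt p ^ 2 = p := Real.sq_sqrt (by positivity)
  ring_nf
  rw [hs]

end BLDS

/-! ### The covariates as coordinates of a tensor product: boundedness and isotropy. -/

namespace BLDS

variable {p : ℕ}

theorem aug_zero (u : EuclideanSpace ℝ (Fin p)) : aug u 0 = 1 := rfl

theorem aug_succ (u : EuclideanSpace ℝ (Fin p)) (k : Fin p) : aug u k.succ = u k := rfl

theorem sum_aug_sq (u : EuclideanSpace ℝ (Fin p)) : ∑ i, aug u i ^ 2 = 1 + ‖u‖ ^ 2 := by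
  rw [Fin.sum_univ_succ, EuclideanSpace.real_norm_sq_eq]
  simp [aug_zero, aug_succ]

theorem continuous_aug (i : Fin (p + 1)) :
    Continuous fun u : EuclideanSpace ℝ (Fin p) => aug u i := by
  refine Fin.cases ?_ (fun k => ?_) i
  · simp only [aug_zero]; fun_prop
  · simp only [aug_succ]; fun_prop

theorem continuous_aug_eval (t : ℕ) (i : Fin (p + 1)) :
    Continuous fun u : ℕ → EuclideanSpace ℝ (Fin p) => aug (u t) i :=
  (continuous_aug i).comp (continuous_apply t)

/-- Position of a covariate in the full tensor product `ū_t ⊗ ū_{t-1} ⊗ ⋯ ⊗ ū_{t-L}`. -/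
def tensorIdx {L : ℕ} : FeatIdx p L → Fin (L + 1) → Fin (p + 1)
  | .inl k => Fin.cons k.succ fun _ => 0
  | .inr ⟨ℓ, (i, k)⟩ => Fin.cons 0 fun r : Fin L =>
      if h : (r : ℕ) < ℓ then i ⟨r, h⟩ else if (r : ℕ) = ℓ then k.succ else 0

/-- The block can be read off as the last slot with a nonzero entry, because the final factor of
each covariate is `u` and not `ū`. The remaining indices are then the earlier entries. -/
theorem tensorIdx_injective {L : ℕ} : Function.Injective (tensorIdx : FeatIdx p L → _) := by
  rintro (k | ⟨ℓ, i, k⟩) (k' | ⟨ℓ', i', k'⟩) h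
  · have := congrFun h 0
    simp [tensorIdx] at this
    rw [this]
  · have := congrFun h 0
    simp [tensorIdx] at this
  · have := congrFun h 0
    simp [tensorIdx] at this
    exact absurd this.symm (Fin.succ_ne_zero _)
  · have h' : ∀ r : Fin L, (if h : (r : ℕ) < ℓ then i ⟨r, h⟩ else if (r : ℕ) = ℓ then k.succ else 0)
        = (if h : (r : ℕ) < ℓ' then i' ⟨r, h⟩ else if (r : ℕ) = ℓ' then k'.succ else 0) := by
      intro r
      simpa [tensorIdx] using congrFun h r.succ
    have hℓ : ℓ = ℓ' := by
      rcases lt_trichotomy (ℓ : ℕ) ℓ' with hl | hl | hl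
      · have := h' ℓ'
        rw [dif_neg (by omega), if_neg (by omega), dif_neg (by omega), if_pos rfl] at this
        exact absurd this.symm (Fin.succ_ne_zero _)
      · exact Fin.ext hl
      · have := h' ℓ
        rw [dif_neg (by omega), if_pos rfl, dif_neg (by omega), if_neg (by omega)] at this
        exact absurd this (Fin.succ_ne_zero _)
    subst hℓ
    have hk : k = k' := by
      have := h' ℓ
      rw [dif_neg (by omega), if_pos rfl, dif_neg (by omega), if_pos rfl] at this
      exact Fin.succ_injective _ this
    have hi : i = i' := by
      funext j
      have := h' ⟨j, j.2.trans ℓ.2⟩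
      simpa using this
    rw [hk, hi]

theorem feature_eq_prod (L : ℕ) (u : ℕ → EuclideanSpace ℝ (Fin p)) (t : ℕ) (c : FeatIdx p L) :
    feature L u t c = ∏ s : Fin (L + 1), aug (u (t - s)) (tensorIdx c s) := by
  rcases c with (k | ⟨ℓ, i, k⟩)
  · rw [Fin.prod_univ_succ]
    simp [tensorIdx, feature, aug_zero, aug_succ]
  · rw [Fin.prod_univ_succ]
    simp only [tensorIdx, feature, Fin.cons_zero, Fin.cons_succ, aug_zero, one_mul, Fin.val_succ]
    let g : ℕ → ℝ := fun r => aug (u (t - (r + 1)))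
      (if h : r < ℓ then i ⟨r, h⟩ else if r = ℓ then k.succ else 0)
    -- Slots older than `ℓ` carry the index `0` and contribute the factor `1`.
    have h1 : ∏ r ∈ Finset.range L, g r = ∏ r ∈ Finset.range (ℓ + 1), g r := by
      symm
      refine Finset.prod_subset (Finset.range_subset_range.2 ℓ.2) fun r _ hr => ?_
      simp only [Finset.mem_range, not_lt] at hr
      simp only [g]
      rw [dif_neg (by omega), if_neg (by omega), aug_zero]
    rw [← Fin.prod_univ_eq_prod_range g L, Finset.prod_range_succ,
      ← Fin.prod_univ_eq_prod_range g ℓ] at h1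
    rw [show (∏ r : Fin L, aug (u (t - (r + 1))) (if h : (r : ℕ) < ℓ then i ⟨r, h⟩ else
      if (r : ℕ) = ℓ then k.succ else 0)) = ∏ r : Fin L, g r from rfl, h1]
    congr 1
    · refine Finset.prod_congr rfl fun j _ => ?_
      simp [g]
    · simp [g, aug_succ]

theorem feature_congr {L t : ℕ} {u u' : ℕ → EuclideanSpace ℝ (Fin p)}
    (h : ∀ s ≤ L, u (t - s) = u' (t - s)) : feature L u t = feature L u' t := by
  funext c
  rw [feature_eq_prod, feature_eq_prod]
  exact Finset.prod_congr rfl fun s _ => by rw [h s (by omega)]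

theorem continuous_feature (L t : ℕ) :
    Continuous fun u : ℕ → EuclideanSpace ℝ (Fin p) => feature L u t := by
  refine continuous_pi fun c => ?_
  simp only [feature_eq_prod]
  exact continuous_finsetProd _ fun s _ => continuous_aug_eval _ _

theorem card_featIdx_le (p L : ℕ) : Fintype.card (FeatIdx p L) ≤ (p + 1) ^ (L + 1) := by
  simpa using Fintype.card_le_of_injective _ (tensorIdx_injective (p := p) (L := L))

/-- By injectivity of `tensorIdx` the covariate is a subvector of the full tensor product, whose
squared norm is the product of the `L + 1` factors `1 + ‖u‖² = 1 + p`. -/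
theorem feature_dotProduct_self_le {L : ℕ} {u : ℕ → EuclideanSpace ℝ (Fin p)}
    (hu : ∀ t, ‖u t‖ = Real.sqrt p) (t : ℕ) :
    feature L u t ⬝ᵥ feature L u t ≤ ((p : ℝ) + 1) ^ (L + 1) := by
  classical
  calc feature L u t ⬝ᵥ feature L u t
      = ∑ c : FeatIdx p L, ∏ s : Fin (L + 1), aug (u (t - s)) (tensorIdx c s) ^ 2 := by
        simp only [dotProduct, feature_eq_prod, ← Finset.prod_mul_distrib, pow_two]
    _ = ∑ e ∈ Finset.univ.image (tensorIdx : FeatIdx p L → _),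
          ∏ s : Fin (L + 1), aug (u (t - s)) (e s) ^ 2 := by
        rw [Finset.sum_image fun _ _ _ _ h => tensorIdx_injective h]
    _ ≤ ∑ e : Fin (L + 1) → Fin (p + 1), ∏ s : Fin (L + 1), aug (u (t - s)) (e s) ^ 2 :=
        Finset.sum_le_sum_of_subset_of_nonneg (Finset.subset_univ _) fun _ _ _ =>
          Finset.prod_nonneg fun _ _ => sq_nonneg _
    _ = ∏ s : Fin (L + 1), ∑ i, aug (u (t - s)) i ^ 2 := by
        rw [Finset.prod_univ_sum]
        simp
    _ = ((p : ℝ) + 1) ^ (L + 1) := by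
        simp [sum_aug_sq, hu, add_comm]

/-- The law of the input sequence: i.i.d. uniform on the sphere of radius `√p`. -/
noncomputable def inputLaw (p : ℕ) : Measure (ℕ → EuclideanSpace ℝ (Fin p)) :=
  Measure.infinitePi fun _ => unifSphere p

instance [NeZero p] : IsProbabilityMeasure (inputLaw p) := by
  unfold inputLaw; infer_instance

theorem map_eval_inputLaw [NeZero p] (t : ℕ) : (inputLaw p).map (fun u => u t) = unifSphere p :=
  Measure.infinitePi_map_eval (fun _ : ℕ => unifSphere p) t

theorem norm_ae_inputLaw [NeZero p] : ∀ᵐ u ∂(inputLaw p), ∀ t, ‖u t‖ = Real.sqrt p := by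
  rw [ae_all_iff]
  intro t
  have h := norm_ae_unifSphere (p := p)
  rw [← map_eval_inputLaw t] at h
  exact ae_of_ae_map (measurable_pi_apply t).aemeasurable h

theorem integral_aug_mul_aug [NeZero p] (i j : Fin (p + 1)) :
    ∫ u, aug u i * aug u j ∂(unifSphere p) = if i = j then 1 else 0 := by
  refine Fin.cases ?_ (fun k => ?_) i <;> refine Fin.cases ?_ (fun l => ?_) j
  · simp [aug_zero]
  · simp only [aug_zero, aug_succ, one_mul]
    rw [integral_coord_unifSphere, if_neg (Fin.succ_ne_zero _).symm]
  · simp only [aug_zero, aug_succ, mul_one]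
    rw [integral_coord_unifSphere, if_neg (Fin.succ_ne_zero _)]
  · simp only [aug_succ, Fin.succ_inj]
    split_ifs with h
    · rw [h, integral_coord_sq_unifSphere]
    · exact integral_coord_mul_coord_unifSphere h

/-- Independence across time factors the moment into entries of `E ū ūᵀ = 1`, and distinct
coordinates of the tensor differ in some slot. The hypothesis `L ≤ t` keeps the times `t - s`
distinct under truncated subtraction. -/
theorem integral_feature_mul_feature [NeZero p] {L t : ℕ} (ht : L ≤ t) (c c' : FeatIdx p L) :
    ∫ u, feature L u t c * feature L u t c' ∂(inputLaw p) = if c = c' then 1 else 0 := by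
  classical
  have hind : iIndepFun (fun (s : Fin (L + 1)) (u : ℕ → EuclideanSpace ℝ (Fin p)) =>
      aug (u (t - s)) (tensorIdx c s) * aug (u (t - s)) (tensorIdx c' s)) (inputLaw p) := by
    have h0 : iIndepFun (fun (s : ℕ) (u : ℕ → EuclideanSpace ℝ (Fin p)) => u s) (inputLaw p) :=
      iIndepFun_infinitePi (P := fun _ : ℕ => unifSphere p) (X := fun _ x => x)
        fun _ => measurable_id
    have h1 : iIndepFun (fun (s : Fin (L + 1)) (u : ℕ → EuclideanSpace ℝ (Fin p)) =>
        u (t - s)) (inputLaw p) :=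
      h0.precomp (g := fun s : Fin (L + 1) => t - (s : ℕ)) fun a b hab => by
        simp only at hab; omega
    exact h1.comp (fun s v => aug v (tensorIdx c s) * aug v (tensorIdx c' s)) fun s =>
      ((continuous_aug _).mul (continuous_aug _)).measurable
  simp only [feature_eq_prod, ← Finset.prod_mul_distrib]
  have hcont : ∀ s : Fin (L + 1), Continuous fun u : ℕ → EuclideanSpace ℝ (Fin p) =>
      aug (u (t - s)) (tensorIdx c s) * aug (u (t - s)) (tensorIdx c' s) := fun s =>
    (continuous_aug_eval _ _).mul (continuous_aug_eval _ _)
  rw [hind.integral_fun_prod_eq_prod_integral fun s => (hcont s).aestronglyMeasurable]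
  have h2 : ∀ s : Fin (L + 1), ∫ u, aug (u (t - s)) (tensorIdx c s) *
      aug (u (t - s)) (tensorIdx c' s) ∂(inputLaw p)
      = if tensorIdx c s = tensorIdx c' s then 1 else 0 := by
    intro s
    rw [← integral_aug_mul_aug, ← map_eval_inputLaw (t - s), integral_map (measurable_pi_apply (t - (s : ℕ))).aemeasurable]
    exact ((continuous_aug _).mul (continuous_aug _)).aestronglyMeasurable
  simp only [h2]
  split_ifs with h
  · simp [h]
  · have : ∃ s, tensorIdx c s ≠ tensorIdx c' s := by
      by_contra! hcon
      exact h (tensorIdx_injective (funext hcon))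
    obtain ⟨s, hs⟩ := this
    exact Finset.prod_eq_zero (Finset.mem_univ s) (if_neg hs)

theorem abs_feature_le {L : ℕ} {u : ℕ → EuclideanSpace ℝ (Fin p)}
    (hu : ∀ t, ‖u t‖ = Real.sqrt p) (t : ℕ) (c : FeatIdx p L) :
    feature L u t c * feature L u t c ≤ ((p : ℝ) + 1) ^ (L + 1) :=
  (Finset.single_le_sum (f := fun c => feature L u t c * feature L u t c)
    (fun _ _ => mul_self_nonneg _) (Finset.mem_univ c)).trans (feature_dotProduct_self_le hu t)

theorem integrable_feature_mul_feature [NeZero p] (L t : ℕ) (c c' : FeatIdx p L) :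
    Integrable (fun u => feature L u t c * feature L u t c') (inputLaw p) := by
  have hc : ∀ c : FeatIdx p L, Continuous fun u : ℕ → EuclideanSpace ℝ (Fin p) =>
      feature L u t c := fun c => (continuous_apply c).comp (continuous_feature L t)
  refine Integrable.of_bound (C := ((p : ℝ) + 1) ^ (L + 1))
    ((hc c).mul (hc c')).aestronglyMeasurable ?_
  filter_upwards [norm_ae_inputLaw (p := p)] with u hu
  rw [Real.norm_eq_abs, abs_le]
  have h1 := abs_feature_le hu t c
  have h2 := abs_feature_le hu t c'
  constructor <;> nlinarith [sq_nonneg (feature L u t c + feature L u t c'),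
    sq_nonneg (feature L u t c - feature L u t c')]

theorem feature_dotProduct_sq (L t : ℕ) (u : ℕ → EuclideanSpace ℝ (Fin p)) (b : FeatIdx p L → ℝ) :
    (feature L u t ⬝ᵥ b) ^ 2 =
      ∑ c, ∑ c', b c * b c' * (feature L u t c * feature L u t c') := by
  rw [pow_two, dotProduct, Finset.sum_mul_sum]
  exact Finset.sum_congr rfl fun c _ => Finset.sum_congr rfl fun c' _ => by ring

theorem integrable_feature_dotProduct_sq [NeZero p] (L t : ℕ) (b : FeatIdx p L → ℝ) :
    Integrable (fun u => (feature L u t ⬝ᵥ b) ^ 2) (inputLaw p) := by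
  simp only [feature_dotProduct_sq]
  exact integrable_finsetSum _ fun c _ => integrable_finsetSum _ fun c' _ =>
    (integrable_feature_mul_feature L t c c').const_mul _

/-- The covariates are isotropic. -/
theorem integral_feature_dotProduct_sq [NeZero p] {L t : ℕ} (ht : L ≤ t) (b : FeatIdx p L → ℝ) :
    ∫ u, (feature L u t ⬝ᵥ b) ^ 2 ∂(inputLaw p) = b ⬝ᵥ b := by
  simp only [feature_dotProduct_sq]
  rw [integral_finsetSum _ fun c _ => integrable_finsetSum _ fun c' _ =>
    (integrable_feature_mul_feature L t c c').const_mul _]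
  simp only [dotProduct]
  refine Finset.sum_congr rfl fun c _ => ?_
  rw [integral_finsetSum _ fun c' _ => (integrable_feature_mul_feature L t c c').const_mul _]
  simp [integral_const_mul, integral_feature_mul_feature ht]

end BLDS

/-! ### Products of rank-one contractions and the directions they see. -/

section Kaczmarz

variable {E : Type*} [NormedAddCommGroup E] [InnerProductSpace ℝ E]

/-- The iterates `v, (1 - θ x₀x₀ᵀ) v, (1 - θ x₁x₁ᵀ) (1 - θ x₀x₀ᵀ) v, …`. -/
noncomputable def kaczmarz (x : ℕ → E) (θ : ℝ) (v : E) : ℕ → E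
  | 0 => v
  | k + 1 => kaczmarz x θ v k - (θ * inner ℝ (x k) (kaczmarz x θ v k)) • x k

theorem kaczmarz_congr {x x' : ℕ → E} {θ : ℝ} {v : E} {n : ℕ} (h : ∀ k < n, x k = x' k) :
    kaczmarz x θ v n = kaczmarz x' θ v n := by
  induction n with
  | zero => rfl
  | succ n ih =>
    rw [kaczmarz, kaczmarz, ih fun k hk => h k (by omega), h n (by omega)]

theorem kaczmarz_sum {ι : Type*} (s : Finset ι) (x : ℕ → E) (θ : ℝ) (a : ι → ℝ) (v : ι → E)
    (n : ℕ) : kaczmarz x θ (∑ i ∈ s, a i • v i) n = ∑ i ∈ s, a i • kaczmarz x θ (v i) n := by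
  induction n with
  | zero => rfl
  | succ n ih =>
    simp only [kaczmarz, ih, inner_sum, inner_smul_right, Finset.mul_sum, Finset.sum_smul,
      ← Finset.sum_sub_distrib, smul_sub, smul_smul]
    exact Finset.sum_congr rfl fun i _ => by congr 2; ring

theorem norm_sub_smul_sq_le {x w : E} {θ : ℝ} (hθ : 0 ≤ θ) (hx : θ * ‖x‖ ^ 2 ≤ 1) :
    ‖w - (θ * inner ℝ x w) • x‖ ^ 2 ≤ ‖w‖ ^ 2 - θ * inner ℝ x w ^ 2 := by
  rw [norm_sub_sq_real, inner_smul_right, norm_smul, mul_pow, Real.norm_eq_abs, sq_abs,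
    real_inner_comm x w]
  have : θ * inner ℝ x w ^ 2 * (θ * ‖x‖ ^ 2) ≤ θ * inner ℝ x w ^ 2 * 1 :=
    mul_le_mul_of_nonneg_left hx (by positivity)
  nlinarith

/-- If the iterates started at a unit vector lose half of its length, then that vector has
a non-negligible component along the directions used. -/
theorem le_sum_inner_sq_of_kaczmarz {x : ℕ → E} {θ : ℝ} (hθ : 0 ≤ θ)
    (hx : ∀ k, θ * ‖x k‖ ^ 2 ≤ 1) {v : E} (hv : ‖v‖ = 1) {n : ℕ}
    (hn : ‖kaczmarz x θ v n‖ ^ 2 ≤ 1 / 4) :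
    1 / 3 ≤ ∑ k ∈ Finset.range n, θ * inner ℝ (x k) v ^ 2 := by
  set y := kaczmarz x θ v with hy
  have h1 : ∑ k ∈ Finset.range n, θ * inner ℝ (x k) (y k) ^ 2 ≤ 1 - ‖y n‖ ^ 2 := by
    have : ∀ k ∈ Finset.range n, θ * inner ℝ (x k) (y k) ^ 2 ≤ ‖y k‖ ^ 2 - ‖y (k + 1)‖ ^ 2 := by
      intro k _
      have := norm_sub_smul_sq_le (w := y k) hθ (hx k)
      have h2 : y (k + 1) = y k - (θ * inner ℝ (x k) (y k)) • x k := rfl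
      rw [h2]; linarith
    refine (Finset.sum_le_sum this).trans ?_
    rw [Finset.sum_range_sub']
    simp [hy, kaczmarz, hv]
  -- Two telescoping sums are compared: `h1` follows the energy `‖y k‖²`, this one the component
  -- along `v`. Cauchy–Schwarz between them gives `(1 - r)² ≤ (1 - r²) ε` with `r = ‖y n‖`, hence `ε
  -- ≥ (1 - r)/(1 + r) ≥ 1/3` for `r ≤ 1/2`.
  have h2 : 1 - inner ℝ v (y n) =
      ∑ k ∈ Finset.range n, θ * (inner ℝ (x k) (y k) * inner ℝ (x k) v) := by
    have : ∀ k ∈ Finset.range n, θ * (inner ℝ (x k) (y k) * inner ℝ (x k) v)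
        = inner ℝ v (y k) - inner ℝ v (y (k + 1)) := by
      intro k _
      have h2 : y (k + 1) = y k - (θ * inner ℝ (x k) (y k)) • x k := rfl
      rw [h2, inner_sub_right, inner_smul_right, real_inner_comm v (x k)]
      ring
    rw [Finset.sum_congr rfl this, Finset.sum_range_sub']
    simp [hy, kaczmarz, hv]
  have h3 : (1 - inner ℝ v (y n)) ^ 2 ≤
      (∑ k ∈ Finset.range n, θ * inner ℝ (x k) (y k) ^ 2) *
      (∑ k ∈ Finset.range n, θ * inner ℝ (x k) v ^ 2) := by
    rw [h2]
    simp only [← Finset.mul_sum]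
    rw [mul_pow, mul_mul_mul_comm, ← pow_two]
    exact mul_le_mul_of_nonneg_left (Finset.sum_mul_sq_le_sq_mul_sq _ _ _) (sq_nonneg _)
  have h4 : inner ℝ v (y n) ≤ ‖y n‖ := by
    simpa [hv] using real_inner_le_norm v (y n)
  have h5 : 0 ≤ ∑ k ∈ Finset.range n, θ * inner ℝ (x k) v ^ 2 :=
    Finset.sum_nonneg fun _ _ => by positivity
  set ε := ∑ k ∈ Finset.range n, θ * inner ℝ (x k) v ^ 2
  have h6 : ‖y n‖ ≤ 1 / 2 := by
    nlinarith [norm_nonneg (y n)]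
  have h7 : (1 - ‖y n‖) ^ 2 ≤ (1 - ‖y n‖ ^ 2) * ε :=
    calc (1 - ‖y n‖) ^ 2 ≤ (1 - inner ℝ v (y n)) ^ 2 :=
          pow_le_pow_left₀ (by linarith) (by linarith) 2
      _ ≤ _ := h3.trans (mul_le_mul_of_nonneg_right h1 h5)
  have h8 : (1 - ‖y n‖) * ((1 + ‖y n‖) * ε - (1 - ‖y n‖)) ≥ 0 := by nlinarith
  have h9 : (1 + ‖y n‖) * ε - (1 - ‖y n‖) ≥ 0 := by
    by_contra! hc
    have := mul_neg_of_pos_of_neg (show 0 < 1 - ‖y n‖ by linarith) hc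
    linarith
  nlinarith [norm_nonneg (y n)]

end Kaczmarz

/-! ### Frobenius norms of blocks, and counting the good blocks. -/

section Frobenius

variable {ι : Type*} [Fintype ι] [DecidableEq ι]

/-- Squared Frobenius norm of the product of the matrices `1 - θ xₖxₖᵀ`, `k < n`. -/
noncomputable def kaczmarzFrob (x : ℕ → EuclideanSpace ℝ ι) (θ : ℝ) (n : ℕ) : ℝ :=
  ∑ i, ‖kaczmarz x θ (EuclideanSpace.single i 1) n‖ ^ 2

theorem kaczmarzFrob_nonneg (x : ℕ → EuclideanSpace ℝ ι) (θ : ℝ) (n : ℕ) :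
    0 ≤ kaczmarzFrob x θ n := Finset.sum_nonneg fun _ _ => by positivity

/-- The iterate is linear in the starting vector, and the operator norm is at most the Frobenius
norm. The latter is a sum over fixed starting vectors, so its mean is computable, yet it controls
all vectors at once. -/
theorem norm_kaczmarz_sq_le (x : ℕ → EuclideanSpace ℝ ι) (θ : ℝ) (v : EuclideanSpace ℝ ι)
    (n : ℕ) : ‖kaczmarz x θ v n‖ ^ 2 ≤ ‖v‖ ^ 2 * kaczmarzFrob x θ n := by
  have hv : v = ∑ i, v i • EuclideanSpace.single i (1 : ℝ) := by
    simpa using ((EuclideanSpace.basisFun ι ℝ).sum_repr v).symm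
  conv_lhs => rw [hv, kaczmarz_sum]
  rw [EuclideanSpace.real_norm_sq_eq v]
  calc ‖∑ i, v i • kaczmarz x θ (EuclideanSpace.single i 1) n‖ ^ 2
      ≤ (∑ i, |v i| * ‖kaczmarz x θ (EuclideanSpace.single i 1) n‖) ^ 2 := by
        refine pow_le_pow_left₀ (norm_nonneg _) ((norm_sum_le _ _).trans (le_of_eq ?_)) 2
        exact Finset.sum_congr rfl fun i _ => by rw [norm_smul, Real.norm_eq_abs]
    _ ≤ _ := by
        refine (Finset.sum_mul_sq_le_sq_mul_sq _ _ _).trans (le_of_eq ?_)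
        simp [kaczmarzFrob]

theorem kaczmarzFrob_congr {x x' : ℕ → EuclideanSpace ℝ ι} {θ : ℝ} {n : ℕ}
    (h : ∀ k < n, x k = x' k) : kaczmarzFrob x θ n = kaczmarzFrob x' θ n := by
  simp only [kaczmarzFrob, kaczmarz_congr h]

/-- If most of the blocks of `N` consecutive vectors have a small Kaczmarz product, then the
second-moment matrix of all vectors is bounded below. -/
theorem le_sum_inner_sq_of_prod_lt {x : ℕ → EuclideanSpace ℝ ι} {D : ℝ} (hD : 0 < D)
    (hx : ∀ k, ‖x k‖ ^ 2 ≤ D) {M N : ℕ} {s : ℝ} (hs : 1 ≤ s)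
    (h : ∏ j ∈ Finset.range M, (1 + 4 * s ^ 2 * kaczmarzFrob (fun k => x (j * N + k)) D⁻¹ N)
      < s ^ M) (v : EuclideanSpace ℝ ι) :
    M * D / 6 * ‖v‖ ^ 2 ≤ ∑ k ∈ Finset.range (M * N), inner ℝ (x k) v ^ 2 := by
  classical
  set F : ℕ → ℝ := fun j => kaczmarzFrob (fun k => x (j * N + k)) D⁻¹ N with hF
  have hF0 : ∀ j, 0 ≤ F j := fun j => kaczmarzFrob_nonneg _ _ _
  set bad := (Finset.range M).filter fun j => ¬ F j ≤ 1 / 4 with hbad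
  set good := (Finset.range M).filter fun j => F j ≤ 1 / 4 with hgood
  have hcard : good.card + bad.card = M := by
    rw [hgood, hbad, Finset.card_filter_add_card_filter_not, Finset.card_range]
  -- A bad block contributes a factor at least `1 + s² ≥ s²` and every other factor is at least `1`.
  -- If half of the blocks were bad, the product would reach `s ^ M`.
  have hbadlt : 2 * bad.card < M := by
    by_contra! hcon
    have h1 : s ^ (2 * bad.card) ≤ ∏ j ∈ Finset.range M, (1 + 4 * s ^ 2 * F j) := by
      calc s ^ (2 * bad.card) = ∏ j ∈ bad, s ^ 2 := by rw [Finset.prod_const, pow_mul]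
        _ ≤ ∏ j ∈ bad, (1 + 4 * s ^ 2 * F j) := by
            refine Finset.prod_le_prod (fun _ _ => by positivity) fun j hj => ?_
            have : 1 / 4 < F j := not_le.1 (Finset.mem_filter.1 hj).2
            nlinarith [sq_nonneg s, mul_le_mul_of_nonneg_left this.le (sq_nonneg s)]
        _ ≤ _ := by
            refine Finset.prod_le_prod_of_subset_of_one_le (Finset.filter_subset _ _)
              (fun j _ => ?_) fun j _ _ => ?_
            · have := hF0 j; positivity
            · have := mul_nonneg (sq_nonneg s) (hF0 j); linarith
    have h2 : s ^ M ≤ s ^ (2 * bad.card) := pow_le_pow_right₀ hs hcon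
    linarith
  have hblock : ∀ j ∈ good, D / 3 * ‖v‖ ^ 2 ≤
      ∑ k ∈ Finset.range N, inner ℝ (x (j * N + k)) v ^ 2 := by
    intro j hj
    have hj' : F j ≤ 1 / 4 := (Finset.mem_filter.1 hj).2
    rcases eq_or_ne v 0 with rfl | hv
    · simp
    have hv' : 0 < ‖v‖ := norm_pos_iff.2 hv
    set e : EuclideanSpace ℝ ι := ‖v‖⁻¹ • v with he
    have hen : ‖e‖ = 1 := by
      rw [he, norm_smul, norm_inv, norm_norm, inv_mul_cancel₀ hv'.ne']
    have h1 := le_sum_inner_sq_of_kaczmarz (x := fun k => x (j * N + k)) (θ := D⁻¹)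
      (inv_nonneg.2 hD.le) (fun k => by
        rw [inv_mul_le_iff₀ hD, mul_one]; exact hx _) hen (n := N)
      ((norm_kaczmarz_sq_le _ _ _ _).trans (by rw [hen]; simpa using hj'))
    rw [← Finset.mul_sum] at h1
    have h2 : ∀ k, inner ℝ (x (j * N + k)) e ^ 2
        = (‖v‖⁻¹) ^ 2 * inner ℝ (x (j * N + k)) v ^ 2 := by
      intro k; rw [he, inner_smul_right, mul_pow]
    simp only [h2, ← Finset.mul_sum] at h1
    set Z := ∑ k ∈ Finset.range N, inner ℝ (x (j * N + k)) v ^ 2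
    have h3 : D * ‖v‖ ^ 2 * (1 / 3) ≤ D * ‖v‖ ^ 2 * (D⁻¹ * (‖v‖⁻¹ ^ 2 * Z)) :=
      mul_le_mul_of_nonneg_left h1 (by positivity)
    have h4 : D * ‖v‖ ^ 2 * (D⁻¹ * (‖v‖⁻¹ ^ 2 * Z)) = Z := by field_simp
    linarith
  have hsplit : ∑ k ∈ Finset.range (M * N), inner ℝ (x k) v ^ 2 =
      ∑ j ∈ Finset.range M, ∑ k ∈ Finset.range N, inner ℝ (x (j * N + k)) v ^ 2 := by
    clear * -
    induction M with
    | zero => simp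
    | succ M ih => rw [Finset.sum_range_succ, ← ih, Nat.succ_mul, Finset.sum_range_add]
  rw [hsplit]
  calc M * D / 6 * ‖v‖ ^ 2 ≤ ∑ j ∈ good, D / 3 * ‖v‖ ^ 2 := by
        rw [Finset.sum_const, nsmul_eq_mul]
        have : (M : ℝ) ≤ 2 * good.card := by exact_mod_cast (by omega : M ≤ 2 * good.card)
        nlinarith [mul_nonneg hD.le (sq_nonneg ‖v‖)]
    _ ≤ ∑ j ∈ good, ∑ k ∈ Finset.range N, inner ℝ (x (j * N + k)) v ^ 2 :=
        Finset.sum_le_sum hblock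
    _ ≤ _ := Finset.sum_le_sum_of_subset_of_nonneg (Finset.filter_subset _ _) fun _ _ _ =>
        Finset.sum_nonneg fun _ _ => sq_nonneg _

end Frobenius

/-! ### Lower tail of the least eigenvalue of the Gram matrix. -/

namespace BLDS

variable {p : ℕ}

/-- Covariates at the times `L, 2L + 1, 3L + 2, …`, which depend on disjoint sets of inputs. -/
def sparseFeature (L : ℕ) (u : ℕ → EuclideanSpace ℝ (Fin p)) (k : ℕ) :
    EuclideanSpace ℝ (FeatIdx p L) := WithLp.toLp 2 (feature L u (L + k * (L + 1)))

/-- The window `t - L, …, t` with `t = L + k(L+1)` is exactly `[k(L+1), (k+1)(L+1))`, and these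
windows are disjoint. -/
theorem sparseFeature_congr {L k : ℕ} {u u' : ℕ → EuclideanSpace ℝ (Fin p)}
    (h : ∀ t, k * (L + 1) ≤ t → t < (k + 1) * (L + 1) → u t = u' t) :
    sparseFeature L u k = sparseFeature L u' k := by
  unfold sparseFeature
  rw [feature_congr (u' := u') fun s hs => h _ (by omega) (by rw [add_mul]; omega)]

theorem continuous_sparseFeature (L k : ℕ) :
    Continuous fun u : ℕ → EuclideanSpace ℝ (Fin p) => sparseFeature L u k :=
  (PiLp.continuous_toLp 2 _).comp (continuous_feature L _)

theorem continuous_kaczmarz {X E : Type*} [TopologicalSpace X] [NormedAddCommGroup E]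
    [InnerProductSpace ℝ E] {x : X → ℕ → E} (hx : ∀ k, Continuous fun u => x u k) (θ : ℝ) (v : E)
    (n : ℕ) : Continuous fun u => kaczmarz (x u) θ v n := by
  induction n with
  | zero => exact continuous_const
  | succ n ih =>
    simp only [kaczmarz]
    exact ih.sub ((continuous_const.mul ((hx n).inner ih)).smul (hx n))

theorem continuous_kaczmarzFrob {X ι : Type*} [TopologicalSpace X] [Fintype ι] [DecidableEq ι]
    {x : X → ℕ → EuclideanSpace ℝ ι} (hx : ∀ k, Continuous fun u => x u k) (θ : ℝ)
    (n : ℕ) : Continuous fun u => kaczmarzFrob (x u) θ n :=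
  continuous_finsetSum _ fun _ _ => (continuous_kaczmarz hx θ _ n).norm.pow 2

theorem norm_sparseFeature_sq_le {L : ℕ} {u : ℕ → EuclideanSpace ℝ (Fin p)}
    (hu : ∀ t, ‖u t‖ = Real.sqrt p) (k : ℕ) :
    ‖sparseFeature L u k‖ ^ 2 ≤ ((p : ℝ) + 1) ^ (L + 1) := by
  refine le_trans (le_of_eq ?_) (feature_dotProduct_self_le hu (L + k * (L + 1)))
  rw [EuclideanSpace.real_norm_sq_eq]
  simp [dotProduct, sparseFeature, pow_two]

theorem inner_sparseFeature (L : ℕ) (u : ℕ → EuclideanSpace ℝ (Fin p)) (k : ℕ)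
    (w : EuclideanSpace ℝ (FeatIdx p L)) :
    inner ℝ (sparseFeature L u k) w = feature L u (L + k * (L + 1)) ⬝ᵥ w.ofLp := by
  rw [EuclideanSpace.inner_eq_star_dotProduct, dotProduct_comm]
  simp [sparseFeature]

/-- One step removes at least `D⁻¹ ⟨x, w⟩²` from the squared length, and by isotropy this has mean
`D⁻¹ ‖w‖²`. -/
theorem lintegral_norm_sub_smul_sq_le [NeZero p] (L k : ℕ) (w : EuclideanSpace ℝ (FeatIdx p L)) :
    ∫⁻ u, ENNReal.ofReal (‖w - ((((p : ℝ) + 1) ^ (L + 1))⁻¹ * inner ℝ (sparseFeature L u k) w) •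
      sparseFeature L u k‖ ^ 2) ∂(inputLaw p) ≤
    ENNReal.ofReal (1 - (((p : ℝ) + 1) ^ (L + 1))⁻¹) * ENNReal.ofReal (‖w‖ ^ 2) := by
  set D : ℝ := ((p : ℝ) + 1) ^ (L + 1) with hDdef
  have hD : 1 ≤ D := one_le_pow₀ (by linarith [Nat.cast_nonneg (α := ℝ) p])
  have hD0 : 0 < D := by linarith
  have hint : Integrable (fun u => inner ℝ (sparseFeature L u k) w ^ 2) (inputLaw p) := by
    simp only [inner_sparseFeature]
    exact integrable_feature_dotProduct_sq L _ _
  have hval : ∫ u, inner ℝ (sparseFeature L u k) w ^ 2 ∂(inputLaw p) = ‖w‖ ^ 2 := by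
    simp only [inner_sparseFeature]
    rw [integral_feature_dotProduct_sq (by omega), EuclideanSpace.real_norm_sq_eq]
    simp [dotProduct, pow_two]
  have h1 : ∀ᵐ u ∂(inputLaw p),
      ‖w - (D⁻¹ * inner ℝ (sparseFeature L u k) w) • sparseFeature L u k‖ ^ 2 ≤
        ‖w‖ ^ 2 - D⁻¹ * inner ℝ (sparseFeature L u k) w ^ 2 := by
    filter_upwards [norm_ae_inputLaw (p := p)] with u hu
    refine norm_sub_smul_sq_le (by positivity) ?_
    rw [inv_mul_le_iff₀ hD0, mul_one]
    exact norm_sparseFeature_sq_le hu k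
  calc _ ≤ ∫⁻ u, ENNReal.ofReal (‖w‖ ^ 2 - D⁻¹ * inner ℝ (sparseFeature L u k) w ^ 2)
        ∂(inputLaw p) := lintegral_mono_ae (h1.mono fun u hu => ENNReal.ofReal_le_ofReal hu)
    _ = ENNReal.ofReal (‖w‖ ^ 2 - D⁻¹ * ‖w‖ ^ 2) := by
        have hi : Integrable (fun u => ‖w‖ ^ 2 - D⁻¹ * inner ℝ (sparseFeature L u k) w ^ 2)
            (inputLaw p) := (integrable_const _).sub (hint.const_mul _)
        rw [← ofReal_integral_eq_lintegral_ofReal hi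
          (h1.mono fun u hu => le_trans (by positivity) hu),
          integral_sub (integrable_const _) (hint.const_mul _), integral_const_mul, hval]
        simp
    _ = _ := by
        rw [← ENNReal.ofReal_mul (by rw [sub_nonneg]; exact inv_le_one_of_one_le₀ hD)]
        ring_nf

theorem lintegral_norm_kaczmarz_sq_le [NeZero p] (L s n : ℕ)
    (v : EuclideanSpace ℝ (FeatIdx p L)) :
    ∫⁻ u, ENNReal.ofReal (‖kaczmarz (fun k => sparseFeature L u (s + k))
      (((p : ℝ) + 1) ^ (L + 1))⁻¹ v n‖ ^ 2) ∂(inputLaw p) ≤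
    ENNReal.ofReal (1 - (((p : ℝ) + 1) ^ (L + 1))⁻¹) ^ n * ENNReal.ofReal (‖v‖ ^ 2) := by
  set θ : ℝ := (((p : ℝ) + 1) ^ (L + 1))⁻¹ with hθ
  have hmeas : ∀ n, Measurable fun u : ℕ → EuclideanSpace ℝ (Fin p) =>
      ENNReal.ofReal (‖kaczmarz (fun k => sparseFeature L u (s + k)) θ v n‖ ^ 2) := fun n =>
    ((continuous_kaczmarz (fun k => continuous_sparseFeature L (s + k)) θ v n).norm.pow
      2).measurable.ennreal_ofReal
  induction n with
  | zero => simp [kaczmarz]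
  | succ n ih =>
    unfold inputLaw at *
    -- Resampling from the window of the last covariate onwards leaves the first `n` iterates
    -- untouched, so the one-step bound applies with a frozen vector.
    let I : Set ℕ := {t | (s + n) * (L + 1) ≤ t}
    rw [lintegral_infinitePi_splice _ I (hmeas (n + 1))]
    have h1 : ∀ x y : ℕ → EuclideanSpace ℝ (Fin p),
        kaczmarz (fun k => sparseFeature L (splice I x y) (s + k)) θ v (n + 1) =
        kaczmarz (fun k => sparseFeature L y (s + k)) θ v n -
          (θ * inner ℝ (sparseFeature L x (s + n))
            (kaczmarz (fun k => sparseFeature L y (s + k)) θ v n)) •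
              sparseFeature L x (s + n) := by
      intro x y
      have e1 : kaczmarz (fun k => sparseFeature L (splice I x y) (s + k)) θ v n =
          kaczmarz (fun k => sparseFeature L y (s + k)) θ v n :=
        kaczmarz_congr fun k hk => sparseFeature_congr fun t _ ht2 =>
          splice_of_notMem (fun hI : (s + n) * (L + 1) ≤ t => by
            have : (s + k + 1) * (L + 1) ≤ (s + n) * (L + 1) :=
              Nat.mul_le_mul_right _ (by omega)
            omega) x y
      have e2 : sparseFeature L (splice I x y) (s + n) = sparseFeature L x (s + n) :=
        sparseFeature_congr fun t ht1 _ => splice_of_mem (show (s + n) * (L + 1) ≤ t from ht1) x y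
      rw [kaczmarz, e1, e2]
    simp only [h1]
    calc _ ≤ ∫⁻ y, ENNReal.ofReal (1 - θ) * ENNReal.ofReal
          (‖kaczmarz (fun k => sparseFeature L y (s + k)) θ v n‖ ^ 2)
            ∂(Measure.infinitePi fun _ => unifSphere p) :=
          lintegral_mono fun y => lintegral_norm_sub_smul_sq_le L (s + n) _
      _ ≤ _ := by
          rw [lintegral_const_mul _ (hmeas n), pow_succ', mul_assoc]
          gcongr

theorem lintegral_kaczmarzFrob_le [NeZero p] (L s n : ℕ) :
    ∫⁻ u, ENNReal.ofReal (kaczmarzFrob (fun k => sparseFeature L u (s + k))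
      (((p : ℝ) + 1) ^ (L + 1))⁻¹ n) ∂(inputLaw p) ≤
    ENNReal.ofReal (((p : ℝ) + 1) ^ (L + 1) * (1 - (((p : ℝ) + 1) ^ (L + 1))⁻¹) ^ n) := by
  set D : ℝ := ((p : ℝ) + 1) ^ (L + 1) with hDdef
  have hD : 1 ≤ D := one_le_pow₀ (by linarith [Nat.cast_nonneg (α := ℝ) p])
  have hθ : 0 ≤ 1 - D⁻¹ := by rw [sub_nonneg]; exact inv_le_one_of_one_le₀ hD
  simp only [kaczmarzFrob]
  simp_rw [ENNReal.ofReal_sum_of_nonneg fun _ _ => sq_nonneg _]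
  have hmeas : ∀ i, Measurable fun u : ℕ → EuclideanSpace ℝ (Fin p) =>
      ENNReal.ofReal (‖kaczmarz (fun k => sparseFeature L u (s + k)) D⁻¹
        (EuclideanSpace.single i 1) n‖ ^ 2) := fun i =>
    ((continuous_kaczmarz (fun k => continuous_sparseFeature L (s + k)) _ _ n).norm.pow
      2).measurable.ennreal_ofReal
  rw [lintegral_finsetSum _ fun i _ => hmeas i]
  refine (Finset.sum_le_sum fun i _ => lintegral_norm_kaczmarz_sq_le L s n _).trans ?_
  simp only [PiLp.norm_single, norm_one, one_pow, ENNReal.ofReal_one, mul_one,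
    Finset.sum_const, Finset.card_univ, nsmul_eq_mul]
  rw [← ENNReal.ofReal_pow hθ, ← ENNReal.ofReal_natCast, ← ENNReal.ofReal_mul (by positivity)]
  refine ENNReal.ofReal_le_ofReal (mul_le_mul_of_nonneg_right ?_ (by positivity))
  rw [hDdef]
  exact_mod_cast card_featIdx_le p L

/-- Different blocks read disjoint inputs, so the mean of the product is bounded factor by factor,
and the hypothesis makes each factor at most `1 + 1` in mean. -/
theorem lintegral_prod_kaczmarzFrob_le [NeZero p] (L M N : ℕ) {r : ℝ} (hr : 0 ≤ r)
    (h : r * (((p : ℝ) + 1) ^ (L + 1) * (1 - (((p : ℝ) + 1) ^ (L + 1))⁻¹) ^ N) ≤ 1) :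
    ∫⁻ u, ENNReal.ofReal (∏ j ∈ Finset.range M, (1 + r * kaczmarzFrob
      (fun k => sparseFeature L u (j * N + k)) (((p : ℝ) + 1) ^ (L + 1))⁻¹ N)) ∂(inputLaw p) ≤
    2 ^ M := by
  set D : ℝ := ((p : ℝ) + 1) ^ (L + 1) with hDdef
  have hcont : ∀ j, Continuous fun u : ℕ → EuclideanSpace ℝ (Fin p) => 1 + r * kaczmarzFrob
      (fun k => sparseFeature L u (j * N + k)) D⁻¹ N := fun j =>
    continuous_const.add (continuous_const.mul
      (continuous_kaczmarzFrob (fun k => continuous_sparseFeature L _) _ _))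
  have hnn : ∀ j (u : ℕ → EuclideanSpace ℝ (Fin p)), 0 ≤ 1 + r * kaczmarzFrob
      (fun k => sparseFeature L u (j * N + k)) D⁻¹ N := fun j u => by
    have := mul_nonneg hr (kaczmarzFrob_nonneg (fun k => sparseFeature L u (j * N + k)) D⁻¹ N)
    linarith
  have hmeas : ∀ M, Measurable fun u : ℕ → EuclideanSpace ℝ (Fin p) =>
      ENNReal.ofReal (∏ j ∈ Finset.range M, (1 + r * kaczmarzFrob
        (fun k => sparseFeature L u (j * N + k)) D⁻¹ N)) := fun M =>
    (continuous_finsetProd _ fun j _ => hcont j).measurable.ennreal_ofReal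
  have hone : ∀ j, ∫⁻ u, ENNReal.ofReal (1 + r * kaczmarzFrob
      (fun k => sparseFeature L u (j * N + k)) D⁻¹ N) ∂(inputLaw p) ≤ 2 := by
    intro j
    simp_rw [ENNReal.ofReal_add zero_le_one (mul_nonneg hr (kaczmarzFrob_nonneg _ _ _)),
      ENNReal.ofReal_mul hr]
    rw [lintegral_add_left measurable_const, lintegral_const_mul _
      (continuous_kaczmarzFrob (fun k => continuous_sparseFeature L _) _ _).measurable.ennreal_ofReal]
    simp only [ENNReal.ofReal_one, lintegral_const, measure_univ, mul_one]
    calc _ ≤ (1 : ℝ≥0∞) + ENNReal.ofReal r * ENNReal.ofReal (D * (1 - D⁻¹) ^ N) := by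
          gcongr; exact lintegral_kaczmarzFrob_le L _ N
      _ ≤ 1 + 1 := by
          rw [← ENNReal.ofReal_mul hr]
          gcongr
          rw [← ENNReal.ofReal_one]
          exact ENNReal.ofReal_le_ofReal h
      _ = 2 := one_add_one_eq_two
  induction M with
  | zero => simp
  | succ M ih =>
    unfold inputLaw at *
    let I : Set ℕ := {t | M * N * (L + 1) ≤ t}
    rw [lintegral_infinitePi_splice _ I (hmeas (M + 1))]
    have h1 : ∀ x y : ℕ → EuclideanSpace ℝ (Fin p),
        ∏ j ∈ Finset.range (M + 1), (1 + r * kaczmarzFrob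
          (fun k => sparseFeature L (splice I x y) (j * N + k)) D⁻¹ N) =
        (∏ j ∈ Finset.range M, (1 + r * kaczmarzFrob
          (fun k => sparseFeature L y (j * N + k)) D⁻¹ N)) *
          (1 + r * kaczmarzFrob (fun k => sparseFeature L x (M * N + k)) D⁻¹ N) := by
      intro x y
      rw [Finset.prod_range_succ]
      congr 1
      · refine Finset.prod_congr rfl fun j hj => ?_
        have e : ∀ k < N, sparseFeature L (splice I x y) (j * N + k) =
            sparseFeature L y (j * N + k) := fun k hk => sparseFeature_congr fun t _ ht2 =>
          splice_of_notMem (fun hI : M * N * (L + 1) ≤ t => ?_) x y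
        · rw [kaczmarzFrob_congr e]
        have h2 : (j + 1) * N ≤ M * N := Nat.mul_le_mul_right _ (Finset.mem_range.1 hj)
        rw [Nat.succ_mul] at h2
        have : (j * N + k + 1) * (L + 1) ≤ M * N * (L + 1) :=
          Nat.mul_le_mul_right _ (by omega)
        omega
      · have e : ∀ k < N, sparseFeature L (splice I x y) (M * N + k) =
            sparseFeature L x (M * N + k) := fun k _ => sparseFeature_congr fun t ht1 _ =>
          splice_of_mem (show M * N * (L + 1) ≤ t from
            (Nat.mul_le_mul_right _ (by omega)).trans ht1) x y
        rw [kaczmarzFrob_congr e]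
    simp only [h1]
    simp_rw [ENNReal.ofReal_mul (Finset.prod_nonneg fun j _ => hnn j _)]
    calc _ ≤ ∫⁻ y, ENNReal.ofReal (∏ j ∈ Finset.range M, (1 + r * kaczmarzFrob
          (fun k => sparseFeature L y (j * N + k)) D⁻¹ N)) * 2
            ∂(Measure.infinitePi fun _ => unifSphere p) :=
          lintegral_mono fun y => by
            rw [lintegral_const_mul _ (hcont M).measurable.ennreal_ofReal]
            gcongr
            exact hone M
      _ ≤ _ := by
          rw [lintegral_mul_const _ (hmeas M), pow_succ]
          gcongr

theorem gram_quadForm {L T : ℕ} (u : ℕ → EuclideanSpace ℝ (Fin p)) (b : FeatIdx p L → ℝ) :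
    b ⬝ᵥ (gram L T u *ᵥ b) = ∑ t ∈ Finset.Icc L T, (feature L u t ⬝ᵥ b) ^ 2 := by
  rw [gram, Matrix.sum_mulVec, dotProduct_sum]
  refine Finset.sum_congr rfl fun t _ => ?_
  rw [Matrix.vecMulVec_mulVec, pow_two, dotProduct_smul, dotProduct_comm b]
  simp

/-- Lower tail of the least eigenvalue of the empirical second-moment matrix. -/
theorem measure_gram_lt_le [NeZero p] (L T M N : ℕ) (hT : ∀ k < M * N, L + k * (L + 1) ≤ T)
    {η : ℝ} (hη : 0 < η) (hη2 : η ≤ 2)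
    (h : 16 * (((p : ℝ) + 1) ^ (L + 1) * (1 - (((p : ℝ) + 1) ^ (L + 1))⁻¹) ^ N) ≤ η ^ 2) :
    inputLaw p {u | ¬ ∀ b : FeatIdx p L → ℝ,
      M * ((p : ℝ) + 1) ^ (L + 1) / 6 * (b ⬝ᵥ b) ≤ b ⬝ᵥ (gram L T u *ᵥ b)} ≤
      ENNReal.ofReal (η ^ M) := by
  set D : ℝ := ((p : ℝ) + 1) ^ (L + 1) with hDdef
  have hD : 1 ≤ D := one_le_pow₀ (by linarith [Nat.cast_nonneg (α := ℝ) p])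
  -- Markov's inequality at level `s ^ M` for a product of mean at most `2 ^ M` gives `(2/s) ^ M = η
  -- ^ M`. The weight `4 s² = 16/η²` accounts for the factor `16` in the hypothesis.
  set s : ℝ := 2 / η with hs
  have hs1 : 1 ≤ s := by rw [hs, le_div_iff₀ hη]; linarith
  have hs0 : 0 < s := by linarith
  set Φ : (ℕ → EuclideanSpace ℝ (Fin p)) → ℝ := fun u => ∏ j ∈ Finset.range M,
    (1 + 4 * s ^ 2 * kaczmarzFrob (fun k => sparseFeature L u (j * N + k)) D⁻¹ N) with hΦ
  have hΦm : Measurable Φ := (continuous_finsetProd _ fun j _ =>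
    continuous_const.add (continuous_const.mul
      (continuous_kaczmarzFrob (fun k => continuous_sparseFeature L _) _ _))).measurable
  have hsub : {u | ¬ ∀ b : FeatIdx p L → ℝ, M * D / 6 * (b ⬝ᵥ b) ≤ b ⬝ᵥ (gram L T u *ᵥ b)} ≤ᵐ[
      inputLaw p] {u | ENNReal.ofReal (s ^ M) ≤ ENNReal.ofReal (Φ u)} := by
    filter_upwards [norm_ae_inputLaw (p := p)] with u hu hbad
    by_contra hcon
    have hcon' : Φ u < s ^ M := by
      by_contra! hle
      exact hcon (ENNReal.ofReal_le_ofReal hle)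
    refine hbad fun b => ?_
    have h1 := le_sum_inner_sq_of_prod_lt (by linarith) (norm_sparseFeature_sq_le (L := L) hu) hs1
      hcon' (WithLp.toLp 2 b)
    have h2 : ‖WithLp.toLp 2 b‖ ^ 2 = b ⬝ᵥ b := by
      rw [EuclideanSpace.real_norm_sq_eq]; simp [dotProduct, pow_two]
    rw [h2] at h1
    refine h1.trans ?_
    rw [gram_quadForm]
    simp only [inner_sparseFeature]
    have hinj : Set.InjOn (fun k => L + k * (L + 1)) (Finset.range (M * N)) := by
      intro a _ c _ hac
      simpa using hac
    rw [← Finset.sum_image (f := fun t => (feature L u t ⬝ᵥ b) ^ 2) hinj]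
    refine Finset.sum_le_sum_of_subset_of_nonneg ?_ fun _ _ _ => sq_nonneg _
    intro t ht
    obtain ⟨k, hk, rfl⟩ := Finset.mem_image.1 ht
    exact Finset.mem_Icc.2 ⟨by omega, hT k (Finset.mem_range.1 hk)⟩
  refine (measure_mono_ae hsub).trans ?_
  have hsM : ENNReal.ofReal (s ^ M) ≠ 0 := by
    rw [Ne, ENNReal.ofReal_eq_zero, not_le]; positivity
  refine (meas_ge_le_lintegral_div hΦm.ennreal_ofReal.aemeasurable hsM
    ENNReal.ofReal_ne_top).trans ?_
  have hexp := lintegral_prod_kaczmarzFrob_le (p := p) L M N (r := 4 * s ^ 2) (by positivity) (by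
    have : 4 * s ^ 2 = 16 / η ^ 2 := by rw [hs, div_pow]; ring
    rw [this, div_mul_eq_mul_div, div_le_one (by positivity)]
    exact h)
  refine (ENNReal.div_le_div_right hexp _).trans (le_of_eq ?_)
  rw [show (2 : ℝ≥0∞) ^ M = ENNReal.ofReal (2 ^ M) by
    rw [ENNReal.ofReal_pow zero_le_two]; simp, ← ENNReal.ofReal_div_of_pos (by positivity),
    ← div_pow, hs]
  congr 2
  field_simp

end BLDS

/-! ### Rounding to integer points, and Gaussian sums over the lattice. -/

section Rounding

variable {ι : Type*} [Fintype ι]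

theorem sum_sq_le_of_round {x : ι → ℝ} {z : ι → ℤ} (h : ∀ i, |(z i : ℝ) - x i| ≤ 1) :
    ∑ i, (z i : ℝ) ^ 2 ≤ 2 * (x ⬝ᵥ x + Fintype.card ι) := by
  have : ∀ i ∈ Finset.univ, (z i : ℝ) ^ 2 ≤ 2 * (x i * x i + 1) := by
    intro i _
    have h1 : ((z i : ℝ) - x i) ^ 2 ≤ 1 := by rw [sq_le_one_iff_abs_le_one]; exact h i
    nlinarith [sq_nonneg ((z i : ℝ) - 2 * x i)]
  refine (Finset.sum_le_sum this).trans (le_of_eq ?_)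
  simp [← Finset.mul_sum, Finset.sum_add_distrib, dotProduct]

theorem sum_Icc_exp_neg_sq_le (B : ℕ) :
    ∑ k ∈ Finset.Icc (-(B : ℤ)) B, Real.exp (-(k : ℝ) ^ 2) ≤ 3 := by
  -- Since `exp(-k²) ≤ 2^(-k)` for `k ≥ 1`, the sum is dominated by `1 + 2 ∑ 2^(-k)`; its partial
  -- sums make the induction close.
  suffices h : ∑ k ∈ Finset.Icc (-(B : ℤ)) B, Real.exp (-(k : ℝ) ^ 2) ≤ 3 - 2 * (1 / 2) ^ B by
    have : (0 : ℝ) ≤ 2 * (1 / 2) ^ B := by positivity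
    linarith
  induction B with
  | zero => norm_num
  | succ B ih =>
    have hset : Finset.Icc (-((B + 1 : ℕ) : ℤ)) ((B + 1 : ℕ) : ℤ) =
        insert (-((B : ℤ) + 1)) (insert ((B : ℤ) + 1) (Finset.Icc (-(B : ℤ)) B)) := by
      ext k; simp only [Finset.mem_Icc, Finset.mem_insert]; push_cast; omega
    rw [hset, Finset.sum_insert (by simp; omega), Finset.sum_insert (by simp)]
    have he : Real.exp (-((B : ℝ) + 1) ^ 2) ≤ (1 / 2) ^ (B + 1) := by
      calc Real.exp (-((B : ℝ) + 1) ^ 2) ≤ Real.exp (((B + 1 : ℕ) : ℝ) * (-1)) := by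
            apply Real.exp_le_exp.2
            push_cast
            nlinarith [Nat.cast_nonneg (α := ℝ) B]
        _ = Real.exp (-1) ^ (B + 1) := Real.exp_nat_mul _ _
        _ ≤ (1 / 2) ^ (B + 1) := by
            refine pow_le_pow_left₀ (Real.exp_pos _).le ?_ _
            rw [Real.exp_neg, one_div]
            refine inv_anti₀ two_pos ?_
            linarith [Real.add_one_le_exp (1 : ℝ)]
    push_cast
    have e3 : (-(-((B : ℝ) + 1)) ^ 2) = -((B : ℝ) + 1) ^ 2 := by ring
    simp only [e3]
    rw [pow_succ (1 / 2 : ℝ)] at he ⊢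
    linarith

variable [DecidableEq ι]

/-- Every point can be rounded to an integer point at a controlled loss in the value of a concave
quadratic function. -/
theorem exists_int_round (S : Matrix ι ι ℝ) (hS : Sᵀ = S) (hS0 : ∀ i, 0 ≤ S i i) (q x : ι → ℝ) :
    ∃ z : ι → ℤ, (∀ i, |(z i : ℝ) - x i| ≤ 1) ∧
      q ⬝ᵥ x - x ⬝ᵥ (S *ᵥ x) / 2 - (∑ i, S i i) / 8 ≤
        q ⬝ᵥ (fun i => (z i : ℝ)) - (fun i => (z i : ℝ)) ⬝ᵥ (S *ᵥ fun i => (z i : ℝ)) / 2 := by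
  have key : ∀ s : Finset ι, ∃ y : ι → ℝ, (∀ i ∈ s, ∃ k : ℤ, y i = k) ∧ (∀ i ∉ s, y i = x i) ∧
      (∀ i, |y i - x i| ≤ 1) ∧
      q ⬝ᵥ x - x ⬝ᵥ (S *ᵥ x) / 2 - (∑ i ∈ s, S i i) / 8 ≤ q ⬝ᵥ y - y ⬝ᵥ (S *ᵥ y) / 2 := by
    intro s
    induction s using Finset.induction_on with
    | empty => exact ⟨x, by simp, by simp, by simp, by simp⟩
    | insert i s hi ih =>
      obtain ⟨y, hy1, hy2, hy3, hy4⟩ := ih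
      have hval : ∀ t : ℝ, q ⬝ᵥ (y + Pi.single i t) -
          (y + Pi.single i t) ⬝ᵥ (S *ᵥ (y + Pi.single i t)) / 2 =
          q ⬝ᵥ y - y ⬝ᵥ (S *ᵥ y) / 2 + t * (q i - (S *ᵥ y) i) - t ^ 2 * S i i / 2 := by
        intro t
        have h1 : y ⬝ᵥ (S *ᵥ Pi.single i t) = t * (S *ᵥ y) i := by
          rw [Matrix.dotProduct_mulVec, dotProduct_single, ← Matrix.mulVec_transpose, hS, mul_comm]
        have h2 : (S *ᵥ Pi.single i t) i = S i i * t := by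
          rw [← single_one_dotProduct (i := i) (S *ᵥ Pi.single i t), Matrix.dotProduct_mulVec,
            dotProduct_single, ← Matrix.mulVec_transpose, hS]
          simp
        rw [Matrix.mulVec_add, dotProduct_add, add_dotProduct, dotProduct_add, dotProduct_add,
          dotProduct_single, single_dotProduct, single_dotProduct, h1, h2]
        ring
      have hnew : ∀ t : ℝ, (∃ k : ℤ, x i + t = k) → |t| ≤ 1 →
          -(S i i / 8) ≤ t * (q i - (S *ᵥ y) i) - t ^ 2 * S i i / 2 →
          ∃ y : ι → ℝ, (∀ j ∈ insert i s, ∃ k : ℤ, y j = k) ∧ (∀ j ∉ insert i s, y j = x j) ∧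
          (∀ j, |y j - x j| ≤ 1) ∧
          q ⬝ᵥ x - x ⬝ᵥ (S *ᵥ x) / 2 - (∑ i ∈ insert i s, S i i) / 8 ≤
            q ⬝ᵥ y - y ⬝ᵥ (S *ᵥ y) / 2 := by
        intro t hk ht hle
        refine ⟨y + Pi.single i t, ?_, ?_, ?_, ?_⟩
        · intro j hj
          rcases Finset.mem_insert.1 hj with rfl | hj
          · simpa [hy2 _ hi] using hk
          · have : j ≠ i := fun h => hi (h ▸ hj)
            simpa [this] using hy1 j hj
        · intro j hj
          rw [Finset.mem_insert, not_or] at hj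
          simpa [hj.1] using hy2 j hj.2
        · intro j
          by_cases h : j = i
          · subst h
            simpa [hy2 _ hi] using ht
          · simpa [h] using hy3 j
        · rw [hval, Finset.sum_insert hi]
          linarith
      set θ := Int.fract (x i) with hθ
      have hθ0 : 0 ≤ θ := Int.fract_nonneg _
      have hθ1 : θ < 1 := Int.fract_lt_one _
      set β := q i - (S *ᵥ y) i
      by_cases hc : -(S i i / 8) ≤ -θ * β - (-θ) ^ 2 * S i i / 2
      · refine hnew (-θ) ⟨⌊x i⌋, ?_⟩ (by rw [abs_neg, abs_of_nonneg hθ0]; exact hθ1.le) hc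
        rw [hθ, Int.fract]; ring
      · refine hnew (1 - θ) ⟨⌊x i⌋ + 1, ?_⟩ (by rw [abs_le]; constructor <;> linarith) ?_
        · push_cast; rw [hθ, Int.fract]; ring
        -- Rounding down with weight `1 - θ` and up with weight `θ` preserves the mean, so the
        -- linear terms cancel in the average. The quadratic loss averages to `S i i θ(1-θ)/2 ≤ S i
        -- i / 8`; the two choices cannot both lose more.
        by_contra hc'
        push Not at hc hc'
        have h1 := mul_lt_mul_of_pos_left hc (sub_pos.2 hθ1)
        have h2 := mul_le_mul_of_nonneg_left hc'.le hθ0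
        have h3 : S i i * (θ * (1 - θ)) ≤ S i i * (1 / 4) :=
          mul_le_mul_of_nonneg_left (by nlinarith [sq_nonneg (θ - 1 / 2)]) (hS0 i)
        nlinarith
  obtain ⟨y, hy1, -, hy3, hy4⟩ := key Finset.univ
  choose z hz using fun i => hy1 i (Finset.mem_univ i)
  obtain rfl : y = fun i => (z i : ℝ) := funext hz
  exact ⟨z, hy3, hy4⟩

theorem sum_box_exp_le (B : ℕ) :
    ∑ z ∈ Fintype.piFinset fun _ : ι => Finset.Icc (-(B : ℤ)) B,
      Real.exp (-∑ i, (z i : ℝ) ^ 2) ≤ 3 ^ Fintype.card ι := by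
  have : ∀ z : ι → ℤ, Real.exp (-∑ i, (z i : ℝ) ^ 2) = ∏ i, Real.exp (-(z i : ℝ) ^ 2) := by
    intro z
    rw [← Finset.sum_neg_distrib, Real.exp_sum]
  simp only [this]
  rw [← Finset.prod_univ_sum (fun _ : ι => Finset.Icc (-(B : ℤ)) B)
    fun _ k => Real.exp (-(k : ℝ) ^ 2)]
  calc _ ≤ ∏ _i : ι, (3 : ℝ) :=
        Finset.prod_le_prod (fun _ _ => Finset.sum_nonneg fun _ _ => (Real.exp_pos _).le)
          fun _ _ => sum_Icc_exp_neg_sq_le B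
    _ = _ := by simp

end Rounding

/-! ### Self-normalized tail bound for a random matrix. -/

section SelfNormalized

variable {ι κ : Type*} [Fintype ι] [Fintype κ]

theorem dotProduct_smul_mulVec_smul (S : Matrix ι ι ℝ) (c : ℝ) (x : ι → ℝ) :
    (c • x) ⬝ᵥ (S *ᵥ (c • x)) = c ^ 2 * (x ⬝ᵥ (S *ᵥ x)) := by
  rw [Matrix.mulVec_smul, smul_dotProduct, dotProduct_smul, smul_eq_mul, smul_eq_mul]; ring

variable [DecidableEq ι] [DecidableEq κ]

/-- For integers `|z| ≤ z²`. The box only serves to keep the union bound finite; its size does not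
enter the probability. -/
theorem mem_box_of_sum_sq_le {B : ℕ} (z : ι → ℤ) (hz : ∑ i, (z i : ℝ) ^ 2 ≤ B) :
    z ∈ Fintype.piFinset fun _ : ι => Finset.Icc (-(B : ℤ)) B := by
  rw [Fintype.mem_piFinset]
  intro i
  have h1 : (z i : ℝ) ^ 2 ≤ B := (Finset.single_le_sum (f := fun i => (z i : ℝ) ^ 2)
    (fun _ _ => sq_nonneg _) (Finset.mem_univ i)).trans hz
  have h2 : (z i) ^ 2 ≤ (B : ℤ) := by exact_mod_cast h1
  rw [Finset.mem_Icc]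
  constructor <;> nlinarith

set_option maxHeartbeats 1000000 in
/-- A bound on the quadratically penalized bilinear form at the points of two integer grids
bounds the matrix itself. -/
theorem mulVec_sq_le_of_grid (Q : Matrix κ ι ℝ) {S : Matrix ι ι ℝ} (hS : Sᵀ = S)
    (hS0 : ∀ b, 0 ≤ b ⬝ᵥ (S *ᵥ b)) {N K D ℓ τ : ℝ} (hN : 0 < N) (hK : 0 < K)
    (htr : ∑ i, S i i ≤ D * N) (hcard : (Fintype.card ι : ℝ) ≤ D) (hℓ : 0 ≤ ℓ)
    (hτ : ℓ + Fintype.card κ + D ≤ τ) (hτ0 : 0 < τ) {B : ℕ} (hB : 4 * τ ≤ B)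
    (hgrid : ∀ za ∈ Fintype.piFinset fun _ : κ => Finset.Icc (-(B : ℤ)) B,
      ∀ zb ∈ Fintype.piFinset fun _ : ι => Finset.Icc (-(B : ℤ)) B,
      ((K * Real.sqrt (Fintype.card κ))⁻¹ • fun i => (za i : ℝ)) ⬝ᵥ
        (Q *ᵥ ((Real.sqrt N)⁻¹ • fun i => (zb i : ℝ))) -
      K ^ 2 / 2 * ((((K * Real.sqrt (Fintype.card κ))⁻¹ • fun i => (za i : ℝ)) ⬝ᵥ
        ((K * Real.sqrt (Fintype.card κ))⁻¹ • fun i => (za i : ℝ))) *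
        (((Real.sqrt N)⁻¹ • fun i => (zb i : ℝ)) ⬝ᵥ
          (S *ᵥ ((Real.sqrt N)⁻¹ • fun i => (zb i : ℝ))))) ≤
      ℓ + ∑ i, (za i : ℝ) ^ 2 + ∑ i, (zb i : ℝ) ^ 2 +
        2 * (Fintype.card κ + Fintype.card ι)) (b : ι → ℝ) :
    (Q *ᵥ b) ⬝ᵥ (Q *ᵥ b) ≤ (13 * K) ^ 2 * τ * (b ⬝ᵥ (S *ᵥ b) + N * (b ⬝ᵥ b)) := by
  set R := b ⬝ᵥ (S *ᵥ b) + N * (b ⬝ᵥ b) with hR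
  have hbb : 0 ≤ b ⬝ᵥ b := Finset.sum_nonneg fun i _ => mul_self_nonneg _
  have hR0 : 0 ≤ R := add_nonneg (hS0 b) (mul_nonneg hN.le hbb)
  set Y := (Q *ᵥ b) ⬝ᵥ (Q *ᵥ b) with hY
  have hY0 : 0 ≤ Y := Finset.sum_nonneg fun i _ => mul_self_nonneg ((Q *ᵥ b) i)
  rcases hY0.eq_or_lt with h0 | hYpos
  · rw [← h0]; positivity
  have hRpos : 0 < R := by
    rcases hR0.eq_or_lt with h | h
    · exfalso
      have h1 : b ⬝ᵥ b = 0 := by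
        have := hS0 b
        have h2 : N * (b ⬝ᵥ b) = 0 := by linarith [mul_nonneg hN.le hbb]
        exact (mul_eq_zero.1 h2).resolve_left hN.ne'
      rw [dotProduct_self_eq_zero.1 h1] at hY
      simp at hY
      linarith
    · exact h
  have hm : 0 < (Fintype.card κ : ℝ) := by
    rw [Nat.cast_pos, Fintype.card_pos_iff]
    by_contra hne
    rw [not_nonempty_iff] at hne
    simp [dotProduct] at hY
    linarith
  set m : ℝ := (Fintype.card κ : ℝ) with hmdef
  -- The claim is homogeneous in `b`, so `b` is rescaled until the penalized quadratic form equals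
  -- `τ`, the level at which penalty and deviation balance.
  set c := Real.sqrt (τ / R) with hc
  have hc2 : c ^ 2 = τ / R := Real.sq_sqrt (by positivity)
  have hcpos : 0 < c := Real.sqrt_pos.2 (by positivity)
  set b₀ := c • b with hb₀
  have hb₀R : b₀ ⬝ᵥ (S *ᵥ b₀) + N * (b₀ ⬝ᵥ b₀) = τ := by
    rw [hb₀, dotProduct_smul_mulVec_smul, smul_dotProduct, dotProduct_smul, smul_eq_mul,
      smul_eq_mul]
    calc _ = c ^ 2 * R := by rw [hR]; ring
      _ = τ := by rw [hc2]; field_simp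
  have hb₀b₀ : 0 ≤ b₀ ⬝ᵥ b₀ := Finset.sum_nonneg fun i _ => mul_self_nonneg _
  set y := Q *ᵥ b₀ with hy
  have hyy : y ⬝ᵥ y = c ^ 2 * Y := by
    rw [hy, hb₀, Matrix.mulVec_smul, smul_dotProduct, dotProduct_smul, smul_eq_mul, smul_eq_mul]
    ring
  set ν := Real.sqrt (y ⬝ᵥ y) with hν
  have hν2 : ν ^ 2 = y ⬝ᵥ y := Real.sq_sqrt (by rw [hyy]; positivity)
  have hνpos : 0 < ν := Real.sqrt_pos.2 (by rw [hyy]; positivity)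
  have hsm : 0 < Real.sqrt m := Real.sqrt_pos.2 hm
  have hsm2 : Real.sqrt m ^ 2 = m := Real.sq_sqrt hm.le
  -- In its own lattice units, `a` rounds the multiple of `y` of length `√m`. The functional `⟨y,
  -- ·⟩` is linear, so rounding loses nothing, and the squared length stays at most `4m`.
  obtain ⟨za, hza1, hza2⟩ := exists_int_round (0 : Matrix κ κ ℝ) (by simp) (by simp) y
    ((Real.sqrt m / ν) • y)
  simp only [Matrix.zero_mulVec, dotProduct_zero, Matrix.zero_apply, Finset.sum_const_zero,
    zero_div, sub_zero, dotProduct_smul, smul_eq_mul] at hza2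
  have hza3 := sum_sq_le_of_round hza1
  rw [smul_dotProduct, dotProduct_smul, smul_eq_mul, smul_eq_mul, ← hν2, ← hmdef] at hza3
  have hza4 : ∑ i, (za i : ℝ) ^ 2 ≤ 4 * m := by
    have : Real.sqrt m / ν * (Real.sqrt m / ν * ν ^ 2) = Real.sqrt m ^ 2 := by
      field_simp
    linarith
  set g := (K * Real.sqrt m)⁻¹ with hg
  have hgpos : 0 < g := by positivity
  set a : κ → ℝ := g • fun i => (za i : ℝ) with ha
  have hay : ν / K ≤ a ⬝ᵥ y := by
    rw [ha, smul_dotProduct, smul_eq_mul, dotProduct_comm]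
    calc ν / K = g * (Real.sqrt m / ν * (y ⬝ᵥ y)) := by
          rw [← hν2, hg]; field_simp
      _ ≤ _ := mul_le_mul_of_nonneg_left hza2 hgpos.le
  have haa : a ⬝ᵥ a = g ^ 2 * ∑ i, (za i : ℝ) ^ 2 := by
    rw [ha, smul_dotProduct, dotProduct_smul, smul_eq_mul, smul_eq_mul, ← mul_assoc, ← pow_two]
    simp [dotProduct, pow_two]
  set α := K ^ 2 * (a ⬝ᵥ a) with hα
  have hα0 : 0 ≤ α := by
    rw [hα, haa]
    have : 0 ≤ ∑ i, (za i : ℝ) ^ 2 := Finset.sum_nonneg fun _ _ => sq_nonneg _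
    positivity
  have hα4 : α ≤ 4 := by
    rw [hα, haa]
    calc K ^ 2 * (g ^ 2 * ∑ i, (za i : ℝ) ^ 2) ≤ K ^ 2 * (g ^ 2 * (4 * m)) := by gcongr
      _ = K ^ 2 * (g ^ 2 * (4 * Real.sqrt m ^ 2)) := by rw [hsm2]
      _ = 4 := by rw [hg]; field_simp
  have hsN : 0 < Real.sqrt N := Real.sqrt_pos.2 hN
  have hsN2 : Real.sqrt N ^ 2 = N := Real.sq_sqrt hN.le
  set h := (Real.sqrt N)⁻¹ with hh
  have hhpos : 0 < h := by positivity
  have hhN : h * Real.sqrt N = 1 := inv_mul_cancel₀ hsN.ne'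
  have hh2 : h ^ 2 * N = 1 := by rw [← hsN2, ← mul_pow, hhN, one_pow]
  have hSii : ∀ i, 0 ≤ S i i := fun i => by
    simpa using hS0 (Pi.single i 1)
  -- With `a` fixed, the penalized form is a concave quadratic in `b`. Rounding `b₀` on the grid of
  -- mesh `N^(-1/2)` costs at most `α h² tr S / 8 ≤ D/2`.
  obtain ⟨zb, hzb1, hzb2⟩ := exists_int_round ((α * h ^ 2) • S) (by rw [Matrix.transpose_smul, hS])
    (fun i => by simpa using mul_nonneg (mul_nonneg hα0 (sq_nonneg h)) (hSii i))
    (h • (a ᵥ* Q)) (Real.sqrt N • b₀)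
  have hzb3 := sum_sq_le_of_round hzb1
  rw [smul_dotProduct, dotProduct_smul, smul_eq_mul, smul_eq_mul, ← mul_assoc, ← pow_two,
    hsN2] at hzb3
  have hb₀S := hS0 b₀
  have hzb4 : ∑ i, (zb i : ℝ) ^ 2 ≤ 2 * (τ + D) := by linarith
  have hm0 := hm.le
  have hD0 : 0 ≤ D := le_trans (Nat.cast_nonneg _) hcard
  have hgr := hgrid za (mem_box_of_sum_sq_le za (by linarith)) zb
    (mem_box_of_sum_sq_le zb (by linarith))
  rw [dotProduct_smul_mulVec_smul, Matrix.mulVec_smul, dotProduct_smul, smul_eq_mul] at hgr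
  simp only [Matrix.smul_mulVec, dotProduct_smul, smul_dotProduct, smul_eq_mul, Matrix.smul_apply,
    Matrix.mulVec_smul, ← Finset.mul_sum, ← Matrix.dotProduct_mulVec] at hzb2
  rw [← hy] at hzb2
  have e1 : Real.sqrt N * (h * (a ⬝ᵥ y)) = a ⬝ᵥ y := by rw [← mul_assoc, mul_comm _ h, hhN, one_mul]
  have e2 : Real.sqrt N * (α * h ^ 2 * (Real.sqrt N * (b₀ ⬝ᵥ (S *ᵥ b₀)))) =
      α * (b₀ ⬝ᵥ (S *ᵥ b₀)) := by
    calc _ = α * (h * Real.sqrt N) ^ 2 * (b₀ ⬝ᵥ (S *ᵥ b₀)) := by ring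
      _ = _ := by rw [hhN]; ring
  have e3 : α * h ^ 2 * ∑ i, S i i ≤ 4 * D := by
    calc α * h ^ 2 * ∑ i, S i i ≤ α * h ^ 2 * (D * N) := by gcongr
      _ = α * D * (h ^ 2 * N) := by ring
      _ = α * D := by rw [hh2, mul_one]
      _ ≤ 4 * D := by gcongr
  have e4 : α * (b₀ ⬝ᵥ (S *ᵥ b₀)) ≤ 4 * τ := by
    have : b₀ ⬝ᵥ (S *ᵥ b₀) ≤ τ := by linarith [mul_nonneg hN.le hb₀b₀]
    calc _ ≤ 4 * (b₀ ⬝ᵥ (S *ᵥ b₀)) := by gcongr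
      _ ≤ _ := by linarith
  set zbr : ι → ℝ := fun i => (zb i : ℝ)
  have e5 : K ^ 2 / 2 * ((a ⬝ᵥ a) * (h ^ 2 * (zbr ⬝ᵥ (S *ᵥ zbr)))) =
      α * h ^ 2 * (zbr ⬝ᵥ (S *ᵥ zbr)) / 2 := by rw [hα]; ring
  rw [e1, e2] at hzb2
  rw [e5] at hgr
  -- Penalty `2τ`, rounding `D/2`, grid weights `4m + 2(τ + D)` and offsets `ℓ + 2m + 2D` sum to at
  -- most `10 τ`.
  have hfin : ν / K ≤ 13 * τ := by linarith
  have hfin' : ν ≤ 13 * K * τ := by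
    rw [div_le_iff₀ hK] at hfin; linarith
  have : c ^ 2 * Y ≤ (13 * K * τ) ^ 2 := by
    rw [← hyy, ← hν2]; exact pow_le_pow_left₀ hνpos.le hfin' 2
  rw [hc2, div_mul_eq_mul_div, div_le_iff₀ hRpos] at this
  have h3 : τ * Y ≤ τ * ((13 * K) ^ 2 * τ * R) := by linarith
  exact le_of_mul_le_mul_left h3 hτ0

end SelfNormalized

section SelfNormalized

variable {ι κ : Type*} [Fintype ι] [Fintype κ] [DecidableEq ι] [DecidableEq κ]

theorem measure_log_ge_le {Ω : Type*} [MeasurableSpace Ω] {μ : Measure Ω} {f : Ω → ℝ}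
    (hf : AEMeasurable f μ) (h : ∫⁻ ω, ENNReal.ofReal (Real.exp (f ω)) ∂μ ≤ 1) (x : ℝ) :
    μ {ω | x < f ω} ≤ ENNReal.ofReal (Real.exp (-x)) := by
  have hx : ENNReal.ofReal (Real.exp x) ≠ 0 := by
    rw [Ne, ENNReal.ofReal_eq_zero, not_le]; positivity
  calc μ {ω | x < f ω} ≤ μ {ω | ENNReal.ofReal (Real.exp x) ≤ ENNReal.ofReal (Real.exp (f ω))} :=
        measure_mono fun ω hω => ENNReal.ofReal_le_ofReal (Real.exp_le_exp.2 (le_of_lt hω))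
    _ ≤ (∫⁻ ω, ENNReal.ofReal (Real.exp (f ω)) ∂μ) / ENNReal.ofReal (Real.exp x) :=
        meas_ge_le_lintegral_div hf.exp.ennreal_ofReal hx ENNReal.ofReal_ne_top
    _ ≤ 1 / ENNReal.ofReal (Real.exp x) := ENNReal.div_le_div_right h _
    _ = _ := by
        rw [← ENNReal.ofReal_one, ← ENNReal.ofReal_div_of_pos (Real.exp_pos _), Real.exp_neg,
          one_div]

/-- Self-normalized tail bound for a random matrix. -/
theorem measure_mulVec_sq_gt_le {Ω : Type*} [MeasurableSpace Ω] {μ : Measure Ω}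
    (Q : Ω → Matrix κ ι ℝ) (S : Ω → Matrix ι ι ℝ) {N K D ℓ τ : ℝ} (hN : 0 < N) (hK : 0 < K)
    (hmeas : ∀ a b, AEMeasurable (fun ω => a ⬝ᵥ (Q ω *ᵥ b) -
      K ^ 2 / 2 * ((a ⬝ᵥ a) * (b ⬝ᵥ (S ω *ᵥ b)))) μ)
    (hexp : ∀ a b, ∫⁻ ω, ENNReal.ofReal (Real.exp (a ⬝ᵥ (Q ω *ᵥ b) -
      K ^ 2 / 2 * ((a ⬝ᵥ a) * (b ⬝ᵥ (S ω *ᵥ b))))) ∂μ ≤ 1)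
    (hS : ∀ ω, (S ω)ᵀ = S ω) (hS0 : ∀ ω b, 0 ≤ b ⬝ᵥ (S ω *ᵥ b))
    (htr : ∀ᵐ ω ∂μ, ∑ i, S ω i i ≤ D * N) (hcard : (Fintype.card ι : ℝ) ≤ D) (hℓ : 0 ≤ ℓ)
    (hτ : ℓ + Fintype.card κ + D ≤ τ) (hτ0 : 0 < τ) :
    μ {ω | ¬ ∀ b, (Q ω *ᵥ b) ⬝ᵥ (Q ω *ᵥ b) ≤
      (13 * K) ^ 2 * τ * (b ⬝ᵥ (S ω *ᵥ b) + N * (b ⬝ᵥ b))} ≤ ENNReal.ofReal (Real.exp (-ℓ)) := by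
  obtain ⟨B, hB⟩ := exists_nat_ge (4 * τ)
  set boxA := Fintype.piFinset fun _ : κ => Finset.Icc (-(B : ℤ)) B
  set boxB := Fintype.piFinset fun _ : ι => Finset.Icc (-(B : ℤ)) B
  set a : (κ → ℤ) → κ → ℝ := fun z => (K * Real.sqrt (Fintype.card κ))⁻¹ • fun i => (z i : ℝ)
    with ha
  set c : (ι → ℤ) → ι → ℝ := fun z => (Real.sqrt N)⁻¹ • fun i => (z i : ℝ) with hc
  set f : (κ → ℤ) × (ι → ℤ) → Ω → ℝ := fun z ω => a z.1 ⬝ᵥ (Q ω *ᵥ c z.2) -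
      K ^ 2 / 2 * ((a z.1 ⬝ᵥ a z.1) * (c z.2 ⬝ᵥ (S ω *ᵥ c z.2))) with hf
  -- The threshold grows with the grid point, so the union bound is a Gaussian lattice sum bounded
  -- uniformly in the box. The offset of `2` per coordinate absorbs the factor `3 ≤ e²` that each
  -- coordinate contributes.
  set x : (κ → ℤ) × (ι → ℤ) → ℝ := fun z => ℓ + ∑ i, (z.1 i : ℝ) ^ 2 + ∑ i, (z.2 i : ℝ) ^ 2 +
        2 * (Fintype.card κ + Fintype.card ι) with hx
  have hsub : {ω | ¬ ∀ b, (Q ω *ᵥ b) ⬝ᵥ (Q ω *ᵥ b) ≤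
      (13 * K) ^ 2 * τ * (b ⬝ᵥ (S ω *ᵥ b) + N * (b ⬝ᵥ b))} ≤ᵐ[μ]
      ⋃ z ∈ boxA ×ˢ boxB, {ω | x z < f z ω} := by
    filter_upwards [htr] with ω hω hbad
    by_contra hcon
    change ω ∉ ⋃ z ∈ boxA ×ˢ boxB, {ω | x z < f z ω} at hcon
    refine hbad fun b => mulVec_sq_le_of_grid (Q ω) (hS ω) (hS0 ω) hN hK hω hcard hℓ hτ hτ0 hB
      (fun za hza zb hzb => ?_) b
    by_contra hlt
    refine hcon (Set.mem_biUnion (Finset.mem_product.2 ⟨hza, hzb⟩ : (za, zb) ∈ boxA ×ˢ boxB) ?_)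
    exact not_le.1 hlt
  refine (measure_mono_ae hsub).trans ((measure_biUnion_finset_le _ _).trans ?_)
  calc ∑ z ∈ boxA ×ˢ boxB, μ {ω | x z < f z ω}
      ≤ ∑ z ∈ boxA ×ˢ boxB, ENNReal.ofReal (Real.exp (-x z)) :=
        Finset.sum_le_sum fun z _ => measure_log_ge_le (hmeas _ _) (hexp _ _) _
    _ = ENNReal.ofReal (∑ z ∈ boxA ×ˢ boxB, Real.exp (-x z)) :=
        (ENNReal.ofReal_sum_of_nonneg fun _ _ => (Real.exp_pos _).le).symm
    _ ≤ _ := ENNReal.ofReal_le_ofReal ?_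
  have he : (3 : ℝ) ≤ Real.exp 2 := by linarith [Real.add_one_le_exp (2 : ℝ)]
  have hfac : ∀ z, Real.exp (-x z) = Real.exp (-ℓ) * (Real.exp (-2) ^ Fintype.card κ *
      Real.exp (-2) ^ Fintype.card ι) *
      (Real.exp (-∑ i, (z.1 i : ℝ) ^ 2) * Real.exp (-∑ i, (z.2 i : ℝ) ^ 2)) := by
    intro z
    rw [← Real.exp_nat_mul, ← Real.exp_nat_mul, ← Real.exp_add, ← Real.exp_add, ← Real.exp_add,
      ← Real.exp_add]
    congr 1
    simp only [hx]
    ring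
  simp only [hfac]
  rw [← Finset.mul_sum, Finset.sum_product]
  simp only [← Finset.mul_sum]
  rw [← Finset.sum_mul]
  have h3 : ∀ n : ℕ, Real.exp (-2) ^ n * 3 ^ n ≤ 1 := by
    intro n
    rw [← mul_pow]
    refine pow_le_one₀ (by positivity) ?_
    calc Real.exp (-2) * 3 ≤ Real.exp (-2) * Real.exp 2 := by gcongr
      _ = 1 := by rw [← Real.exp_add]; simp
  calc _ ≤ Real.exp (-ℓ) * (Real.exp (-2) ^ Fintype.card κ *
      Real.exp (-2) ^ Fintype.card ι) * (3 ^ Fintype.card κ * 3 ^ Fintype.card ι) := by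
        gcongr
        · exact sum_box_exp_le B
        · exact sum_box_exp_le B
    _ = Real.exp (-ℓ) * ((Real.exp (-2) ^ Fintype.card κ * 3 ^ Fintype.card κ) *
        (Real.exp (-2) ^ Fintype.card ι * 3 ^ Fintype.card ι)) := by ring
    _ ≤ Real.exp (-ℓ) * (1 * 1) := by
        gcongr
        · exact h3 _
        · exact h3 _
    _ = Real.exp (-ℓ) := by ring

end SelfNormalized

/-! ### Geometrically decaying causal filters and their adjoints. -/

section Convolution

theorem sum_pow_le_of_injOn {ρ : ℝ} (h0 : 0 < ρ) (h1 : ρ < 1) (F : Finset ℕ) (e : ℕ → ℕ) (r : ℕ)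
    (he : Set.InjOn e F) (hr : ∀ t ∈ F, r ≤ e t) : ∑ t ∈ F, ρ ^ e t ≤ ρ ^ r / (1 - ρ) := by
  have h2 : ∀ t ∈ F, ρ ^ e t = ρ ^ r * ρ ^ (e t - r) := fun t ht => by
    rw [← pow_add, Nat.add_sub_cancel' (hr t ht)]
  have hinj : Set.InjOn (fun t => e t - r) F := fun a ha b hb hab => by
    have := hr a ha
    have := hr b hb
    exact he ha hb (by simp only at hab; omega)
  rw [Finset.sum_congr rfl h2, ← Finset.mul_sum,
    ← Finset.sum_image (f := fun k => ρ ^ k) hinj, div_eq_mul_inv]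
  refine mul_le_mul_of_nonneg_left ?_ (by positivity)
  rw [← tsum_geometric_of_lt_one h0.le h1]
  exact (summable_geometric_of_lt_one h0.le h1).sum_le_tsum _ fun _ _ => by positivity

variable {m d : ℕ}

theorem norm_toLp_sq {ι : Type*} [Fintype ι] (a : ι → ℝ) : ‖WithLp.toLp 2 a‖ ^ 2 = a ⬝ᵥ a := by
  rw [EuclideanSpace.real_norm_sq_eq]; simp [dotProduct, pow_two]

theorem norm_toLp_transpose_mulVec_le (M : Matrix (Fin m) (Fin d) ℝ) (a : Fin m → ℝ) :
    ‖WithLp.toLp 2 (Mᵀ *ᵥ a)‖ ≤ ‖M‖ * ‖WithLp.toLp 2 a‖ := by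
  have h := Matrix.l2_opNorm_mulVec Mᵀ (WithLp.toLp 2 a)
  rw [← Matrix.conjTranspose_eq_transpose_of_trivial, Matrix.l2_opNorm_conjTranspose] at h
  simpa using h

/-- The adjoint of the causal filter with kernel `H` and delay `r`, applied to `(β t) a`. -/
def adjFilter (H : ℕ → ℕ → Matrix (Fin m) (Fin d) ℝ) (r L T : ℕ) (β : ℕ → ℝ) (a : Fin m → ℝ)
    (s : ℕ) : EuclideanSpace ℝ (Fin d) :=
  WithLp.toLp 2 (∑ t ∈ (Finset.Icc L T).filter fun t => s + r < t, β t • ((H t s)ᵀ *ᵥ a))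

/-- Exchanging the two sums moves the filter onto `β` and `a` and displays the form as linear in the
driving sequence `v`, ready for exponential moments. -/
theorem sum_mul_dotProduct_filter (H : ℕ → ℕ → Matrix (Fin m) (Fin d) ℝ) (r L T : ℕ) (β : ℕ → ℝ)
    (a : Fin m → ℝ) (v : ℕ → EuclideanSpace ℝ (Fin d)) :
    ∑ t ∈ Finset.Icc L T, (a ⬝ᵥ ∑ s ∈ Finset.range (t - r), H t s *ᵥ (v s).ofLp) * β t =
      ∑ s ∈ Finset.range T, inner ℝ (adjFilter H r L T β a s) (v s) := by
  have h1 : ∀ s, inner ℝ (adjFilter H r L T β a s) (v s) =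
      ∑ t ∈ (Finset.Icc L T).filter fun t => s + r < t, β t * (a ⬝ᵥ (H t s *ᵥ (v s).ofLp)) := by
    intro s
    rw [EuclideanSpace.inner_eq_star_dotProduct, dotProduct_comm]
    simp only [adjFilter, star_trivial, sum_dotProduct, smul_dotProduct, smul_eq_mul]
    refine Finset.sum_congr rfl fun t _ => ?_
    rw [Matrix.mulVec_transpose, Matrix.dotProduct_mulVec]
  simp only [h1, dotProduct_sum, Finset.sum_mul]
  rw [Finset.sum_comm' (t' := Finset.range T)
    (s' := fun s => (Finset.Icc L T).filter fun t => s + r < t)]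
  · exact Finset.sum_congr rfl fun s _ => Finset.sum_congr rfl fun t _ => mul_comm _ _
  · intro t s
    simp only [Finset.mem_Icc, Finset.mem_range, Finset.mem_filter]
    omega

/-- Young's inequality for the adjoint of a geometrically decaying filter. -/
theorem sum_norm_adjFilter_sq_le {H : ℕ → ℕ → Matrix (Fin m) (Fin d) ℝ} {r : ℕ} (L T : ℕ)
    (β : ℕ → ℝ) (a : Fin m → ℝ) {c ρ : ℝ} (h0 : 0 < ρ) (h1 : ρ < 1)
    (hH : ∀ t s, s + r < t → ‖H t s‖ ≤ c * ρ ^ (t - 1 - s)) :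
    ∑ s ∈ Finset.range T, ‖adjFilter H r L T β a s‖ ^ 2 ≤
      (c * ρ ^ r / (1 - ρ)) ^ 2 * ((a ⬝ᵥ a) * ∑ t ∈ Finset.Icc L T, β t ^ 2) := by
  have hρ : 0 < 1 - ρ := sub_pos.2 h1
  set F : ℕ → Finset ℕ := fun s => (Finset.Icc L T).filter fun t => s + r < t with hF
  have hs : ∀ s ∈ Finset.range T, ‖adjFilter H r L T β a s‖ ^ 2 ≤
      c ^ 2 * (a ⬝ᵥ a) * (ρ ^ r / (1 - ρ)) * ∑ t ∈ F s, β t ^ 2 * ρ ^ (t - 1 - s) := by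
    intro s _
    have hn : ‖adjFilter H r L T β a s‖ ≤
        c * ‖WithLp.toLp 2 a‖ * ∑ t ∈ F s, |β t| * ρ ^ (t - 1 - s) := by
      rw [adjFilter, WithLp.toLp_sum, Finset.mul_sum]
      refine norm_sum_le_of_le _ fun t ht => ?_
      rw [WithLp.toLp_smul, norm_smul, Real.norm_eq_abs]
      calc |β t| * ‖WithLp.toLp 2 ((H t s)ᵀ *ᵥ a)‖ ≤ |β t| * (‖H t s‖ * ‖WithLp.toLp 2 a‖) := by
            gcongr; exact norm_toLp_transpose_mulVec_le _ _
        _ ≤ |β t| * (c * ρ ^ (t - 1 - s) * ‖WithLp.toLp 2 a‖) := by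
            gcongr; exact hH t s (Finset.mem_filter.1 ht).2
        _ = _ := by ring
    -- Schur test: Cauchy–Schwarz with the kernel as weight. The sum of the kernel over `t` and its
    -- sum over `s` each contribute one factor `ρ^r/(1-ρ)`.
    have hcs : (∑ t ∈ F s, |β t| * ρ ^ (t - 1 - s)) ^ 2 ≤
        (∑ t ∈ F s, ρ ^ (t - 1 - s)) * ∑ t ∈ F s, β t ^ 2 * ρ ^ (t - 1 - s) :=
      Finset.sum_sq_le_sum_mul_sum_of_sq_le_mul _ (fun _ _ => by positivity)
        (fun _ _ => by positivity) fun t _ => le_of_eq (by rw [mul_pow, sq_abs]; ring)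
    have hgeo : ∑ t ∈ F s, ρ ^ (t - 1 - s) ≤ ρ ^ r / (1 - ρ) := by
      refine sum_pow_le_of_injOn h0 h1 _ _ _ (fun t ht t' ht' h => ?_) fun t ht => ?_
      · have := (Finset.mem_filter.1 ht).2
        have := (Finset.mem_filter.1 ht').2
        omega
      · have := (Finset.mem_filter.1 ht).2
        omega
    have hnn : 0 ≤ ∑ t ∈ F s, β t ^ 2 * ρ ^ (t - 1 - s) :=
      Finset.sum_nonneg fun _ _ => by positivity
    calc ‖adjFilter H r L T β a s‖ ^ 2
        ≤ (c * ‖WithLp.toLp 2 a‖ * ∑ t ∈ F s, |β t| * ρ ^ (t - 1 - s)) ^ 2 :=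
          pow_le_pow_left₀ (norm_nonneg _) hn 2
      _ = c ^ 2 * (a ⬝ᵥ a) * (∑ t ∈ F s, |β t| * ρ ^ (t - 1 - s)) ^ 2 := by
          rw [mul_pow, mul_pow, norm_toLp_sq]
      _ ≤ c ^ 2 * (a ⬝ᵥ a) * (ρ ^ r / (1 - ρ) * ∑ t ∈ F s, β t ^ 2 * ρ ^ (t - 1 - s)) := by
          refine mul_le_mul_of_nonneg_left (hcs.trans (mul_le_mul_of_nonneg_right hgeo hnn)) ?_
          rw [← norm_toLp_sq]; positivity
      _ = _ := by ring
  refine (Finset.sum_le_sum hs).trans ?_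
  rw [← Finset.mul_sum]
  have hswap : ∑ s ∈ Finset.range T, ∑ t ∈ F s, β t ^ 2 * ρ ^ (t - 1 - s) =
      ∑ t ∈ Finset.Icc L T, ∑ s ∈ Finset.range (t - r), β t ^ 2 * ρ ^ (t - 1 - s) := by
    refine Finset.sum_comm' ?_
    intro s t
    simp only [hF, Finset.mem_Icc, Finset.mem_range, Finset.mem_filter]
    omega
  have hsum : ∑ s ∈ Finset.range T, ∑ t ∈ F s, β t ^ 2 * ρ ^ (t - 1 - s) ≤
      (ρ ^ r / (1 - ρ)) * ∑ t ∈ Finset.Icc L T, β t ^ 2 := by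
    rw [hswap, Finset.mul_sum]
    refine Finset.sum_le_sum fun t _ => ?_
    rw [← Finset.mul_sum, mul_comm]
    refine mul_le_mul_of_nonneg_right ?_ (sq_nonneg _)
    refine sum_pow_le_of_injOn h0 h1 _ _ _ (fun s hs s' hs' h => ?_) fun s hs => ?_
    · have := Finset.mem_range.1 hs
      have := Finset.mem_range.1 hs'
      omega
    · have := Finset.mem_range.1 hs
      omega
  calc _ ≤ c ^ 2 * (a ⬝ᵥ a) * (ρ ^ r / (1 - ρ)) *
        ((ρ ^ r / (1 - ρ)) * ∑ t ∈ Finset.Icc L T, β t ^ 2) := by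
        refine mul_le_mul_of_nonneg_left hsum ?_
        rw [← norm_toLp_sq]; positivity
    _ = _ := by ring

end Convolution

/-! ### Unrolling the dynamics. -/

/-- The distributive law for ordered products; it turns a product of matrices `u ∘ A` into a linear
expression in the monomials forming the covariates. -/
theorem ofFn_prod_sum_smul {α R : Type*} [Fintype α] [Ring R] [Algebra ℝ R]
    (A : α → R) (ℓ : ℕ) (c : Fin ℓ → α → ℝ) :
    (List.ofFn fun j => ∑ i, c j i • A i).prod =
      ∑ i : Fin ℓ → α, (∏ j, c j (i j)) • (List.ofFn fun j => A (i j)).prod := by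
  induction ℓ with
  | zero => simp
  | succ ℓ ih =>
    rw [List.ofFn_succ, List.prod_cons, ih, Finset.sum_mul_sum, ← Finset.sum_product',
      Finset.univ_product_univ]
    refine Fintype.sum_equiv (Fin.consEquiv fun _ => α) _ _ fun q => ?_
    simp [Fin.consEquiv, Fin.prod_univ_succ, smul_smul, mul_comm]

namespace BLDS

variable {n p m : ℕ}

/-- The state transition matrix `(u_{s+k-1} ∘ A) ⋯ (u_s ∘ A)`. -/
noncomputable def transition (S : BLDS n p m) (u : ℕ → EuclideanSpace ℝ (Fin p)) (s k : ℕ) :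
    Matrix (Fin n) (Fin n) ℝ := (List.ofFn fun j : Fin k => S.transMat (u (s + k - 1 - j))).prod

theorem transition_zero (S : BLDS n p m) (u : ℕ → EuclideanSpace ℝ (Fin p)) (s : ℕ) :
    S.transition u s 0 = 1 := by simp [transition]

theorem transition_succ (S : BLDS n p m) (u : ℕ → EuclideanSpace ℝ (Fin p)) (s k : ℕ) :
    S.transition u s (k + 1) = S.transMat (u (s + k)) * S.transition u s k := by
  rw [transition, List.ofFn_succ, List.prod_cons]
  congr 3
  · funext j
    simp only [Fin.val_succ]
    congr 2
    omega

theorem transition_congr (S : BLDS n p m) {u u' : ℕ → EuclideanSpace ℝ (Fin p)} {s k : ℕ}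
    (h : ∀ t, s ≤ t → t < s + k → u t = u' t) : S.transition u s k = S.transition u' s k := by
  unfold transition
  congr 2
  funext j
  rw [h _ (by omega) (by omega)]

theorem continuous_transition (S : BLDS n p m) (s k : ℕ) :
    Continuous fun u : ℕ → EuclideanSpace ℝ (Fin p) => S.transition u s k := by
  induction k with
  | zero => simp only [transition_zero]; exact continuous_const
  | succ k ih =>
    simp only [transition_succ]
    refine Continuous.mul ?_ ih
    simp only [transMat]
    fun_prop

theorem norm_transition_le {S : BLDS n p m} {κ ρ : ℝ}
    (hS : S.UniformlyStable (Metric.sphere 0 (Real.sqrt p)) κ ρ)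
    {u : ℕ → EuclideanSpace ℝ (Fin p)} (hu : ∀ t, ‖u t‖ = Real.sqrt p) (s k : ℕ) :
    ‖S.transition u s k‖ ≤ κ * ρ ^ k := by
  rcases Nat.eq_zero_or_pos k with rfl | hk
  -- The transient growth ranges over `k ≥ 1` only, so the empty product needs `1 ≤ κ`; for `n = 0`
  -- the identity matrix has norm `0`.
  · rw [transition_zero, pow_zero, mul_one]
    refine le_trans ?_ hS.one_le
    rcases isEmpty_or_nonempty (Fin n) with h | h
    · rw [Subsingleton.elim (1 : Matrix (Fin n) (Fin n) ℝ) 0, norm_zero]; exact zero_le_one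
    · exact norm_one.le
  · have h1 : ENNReal.ofReal (‖S.transition u s k‖ / ρ ^ k) ≤ ENNReal.ofReal κ := by
      refine le_trans ?_ hS.growth_le
      unfold transientGrowth
      refine le_iSup₂_of_le k hk (le_iSup₂_of_le
        (fun j : Fin k => S.transMat (u (s + k - 1 - j))) (fun j => ?_) le_rfl)
      exact ⟨_, by simp [hu], rfl⟩
    have h2 := (ENNReal.ofReal_le_ofReal_iff (by linarith [hS.one_le])).1 h1
    rwa [div_le_iff₀ (pow_pos hS.pos k)] at h2

theorem state_eq_sum (S : BLDS n p m) (u : ℕ → EuclideanSpace ℝ (Fin p))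
    (w : ℕ → EuclideanSpace ℝ (Fin n)) (t : ℕ) :
    (S.state u w t).ofLp = ∑ s ∈ Finset.range t,
      S.transition u (s + 1) (t - 1 - s) *ᵥ (S.B *ᵥ (u s).ofLp + (w s).ofLp) := by
  induction t with
  | zero => rfl
  | succ t ih =>
    have h : ∀ s ∈ Finset.range t, S.transition u (s + 1) (t + 1 - 1 - s) =
        S.transMat (u t) * S.transition u (s + 1) (t - 1 - s) := by
      intro s hs
      have := Finset.mem_range.1 hs
      rw [show t + 1 - 1 - s = (t - 1 - s) + 1 by omega, transition_succ,
        show s + 1 + (t - 1 - s) = t by omega]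
    rw [Finset.sum_range_succ, Finset.sum_congr rfl fun s hs => by rw [h s hs]]
    simp only [← Matrix.mulVec_mulVec]
    rw [← Matrix.mulVec_sum, ← ih, show t + 1 - 1 - t = 0 by omega, transition_zero,
      Matrix.one_mulVec]
    simp [state, add_assoc]

theorem transMat_eq_sum (S : BLDS n p m) (v : EuclideanSpace ℝ (Fin p)) :
    S.transMat v = ∑ i, aug v i • S.A i := by
  rw [transMat, Fin.sum_univ_succ]
  simp [aug_zero, aug_succ]

/-- An input of age `ℓ + 1` reaches the output through `ℓ` factors `∑ i, ū_i A_i`; expanding them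
yields exactly the block `ℓ` of parameters paired with the block `ℓ` of the covariate. -/
theorem markov_mulVec_feature (S : BLDS n p m) (u : ℕ → EuclideanSpace ℝ (Fin p)) {L t : ℕ}
    (ht : L ≤ t) : S.markov L *ᵥ feature L u t = S.D *ᵥ (u t).ofLp +
      ∑ s ∈ Finset.Ico (t - L) t,
        (S.C * S.transition u (s + 1) (t - 1 - s) * S.B) *ᵥ (u s).ofLp := by
  have hsum : ∑ s ∈ Finset.Ico (t - L) t,
      (S.C * S.transition u (s + 1) (t - 1 - s) * S.B) *ᵥ (u s).ofLp =
      ∑ ℓ : Fin L, (S.C * S.transition u (t - ℓ) ℓ * S.B) *ᵥ (u (t - (ℓ + 1))).ofLp := by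
    rw [Fin.sum_univ_eq_sum_range (fun ℓ =>
      (S.C * S.transition u (t - ℓ) ℓ * S.B) *ᵥ (u (t - (ℓ + 1))).ofLp) L]
    refine Finset.sum_nbij' (fun s => t - 1 - s) (fun ℓ => t - 1 - ℓ) ?_ ?_ ?_ ?_ ?_
    · intro s hs; simp only [Finset.mem_Ico, Finset.mem_range] at *; omega
    · intro s hs; simp only [Finset.mem_Ico, Finset.mem_range] at *; omega
    · intro s hs; simp only [Finset.mem_Ico] at *; omega
    · intro s hs; simp only [Finset.mem_range] at *; omega
    · intro s hs
      simp only [Finset.mem_Ico] at hs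
      rw [show t - (t - 1 - s) = s + 1 by omega, show t - (t - 1 - s + 1) = s by omega]
  have htr : ∀ ℓ : Fin L, S.transition u (t - ℓ) ℓ = ∑ i : Fin ℓ → Fin (p + 1),
      (∏ j : Fin ℓ, aug (u (t - (j + 1))) (i j)) • (List.ofFn fun j : Fin ℓ => S.A (i j)).prod := by
    intro ℓ
    rw [transition, ← ofFn_prod_sum_smul]
    congr 2
    funext j
    rw [← transMat_eq_sum, show t - ℓ + ℓ - 1 - j = t - (j + 1) by omega]
  rw [hsum]
  funext r
  simp only [Matrix.mulVec, dotProduct, Pi.add_apply, Finset.sum_apply]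
  rw [Fintype.sum_sum_type, Fintype.sum_sigma]
  congr 1
  refine Finset.sum_congr rfl fun ℓ _ => ?_
  rw [Fintype.sum_prod_type, htr ℓ, Finset.sum_comm]
  refine Finset.sum_congr rfl fun k _ => ?_
  simp only [Matrix.mul_sum, Matrix.sum_mul, Matrix.sum_apply, Finset.sum_mul, Matrix.mul_smul,
    Matrix.smul_mul, Matrix.smul_apply, smul_eq_mul]
  refine Finset.sum_congr rfl fun i _ => ?_
  simp only [markov, feature, Matrix.of_apply]
  ring

/-- The part of the output not explained by the covariates: measurement noise, process noise
and inputs that are too old. -/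
theorem output_eq (S : BLDS n p m) (u : ℕ → EuclideanSpace ℝ (Fin p))
    (w : ℕ → EuclideanSpace ℝ (Fin n)) (z : ℕ → EuclideanSpace ℝ (Fin m)) {L t : ℕ} (ht : L ≤ t) :
    (S.output u w z t).ofLp = S.markov L *ᵥ feature L u t + ((z t).ofLp +
      (∑ s ∈ Finset.range (t - 0), (S.C * S.transition u (s + 1) (t - 1 - s)) *ᵥ (w s).ofLp +
      ∑ s ∈ Finset.range (t - L),
        (S.C * S.transition u (s + 1) (t - 1 - s) * S.B) *ᵥ (u s).ofLp)) := by
  have h1 : S.C *ᵥ (S.state u w t).ofLp =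
      ∑ s ∈ Finset.range t, (S.C * S.transition u (s + 1) (t - 1 - s) * S.B) *ᵥ (u s).ofLp +
      ∑ s ∈ Finset.range t, (S.C * S.transition u (s + 1) (t - 1 - s)) *ᵥ (w s).ofLp := by
    rw [state_eq_sum, Matrix.mulVec_sum, ← Finset.sum_add_distrib]
    refine Finset.sum_congr rfl fun s _ => ?_
    simp only [Matrix.mulVec_add, Matrix.mulVec_mulVec, Matrix.mul_assoc]
  have h2 := Finset.sum_range_add_sum_Ico
    (fun s => (S.C * S.transition u (s + 1) (t - 1 - s) * S.B) *ᵥ (u s).ofLp) (Nat.sub_le t L)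
  rw [markov_mulVec_feature S u ht, Nat.sub_zero, output, WithLp.ofLp_add, h1, ← h2]
  simp only
  abel

end BLDS

/-! ### Exponential moment bounds for the three parts of the error. -/

/-- Fubini for the product law. It is used with the inputs frozen and the noise averaged. -/
theorem lintegral_indepFun_le_one {Ω α β : Type*} [MeasurableSpace Ω] [MeasurableSpace α]
    [MeasurableSpace β] {μ : Measure Ω} [IsProbabilityMeasure μ] {U : Ω → α} {V : Ω → β}
    (hU : Measurable U) (hV : Measurable V) (h : IndepFun U V μ) {f : α × β → ℝ≥0∞}
    (hf : Measurable f) (hle : ∀ᵐ x ∂(μ.map U), ∫⁻ ω, f (x, V ω) ∂μ ≤ 1) :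
    ∫⁻ ω, f (U ω, V ω) ∂μ ≤ 1 := by
  have : IsProbabilityMeasure (μ.map U) := Measure.isProbabilityMeasure_map hU.aemeasurable
  have hmap := (indepFun_iff_map_prod_eq_prod_map_map hU.aemeasurable hV.aemeasurable).1 h
  rw [← lintegral_map (f := f) (g := fun ω => (U ω, V ω)) hf (hU.prodMk hV), hmap,
    lintegral_prod _ hf.aemeasurable]
  calc _ ≤ ∫⁻ _, 1 ∂(μ.map U) := by
        refine lintegral_mono_ae (hle.mono fun x hx => ?_)
        rwa [lintegral_map (show Measurable fun y => f (x, y) from hf.comp measurable_prodMk_left) hV]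
    _ = 1 := by simp

namespace BLDS

variable {n p m : ℕ}

theorem IsCenteredSubgaussian.hasSubgaussianMGF_inner {Ω : Type*} [MeasurableSpace Ω] {μ : Measure Ω}
    [IsProbabilityMeasure μ] {d : ℕ} {σ : ℝ} {X : Ω → EuclideanSpace ℝ (Fin d)}
    (hX : IsCenteredSubgaussian μ d σ X) (g : EuclideanSpace ℝ (Fin d)) :
    HasSubgaussianMGF (fun ω => inner ℝ g (X ω)) (Real.toNNReal (σ ^ 2 * ‖g‖ ^ 2)) μ := by
  rcases eq_or_ne g 0 with rfl | hg
  · simp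
  have hg' : ‖g‖ ≠ 0 := norm_ne_zero_iff.2 hg
  have h := (hX.subgaussian (‖g‖⁻¹ • g) (by
    rw [norm_smul, norm_inv, norm_norm, inv_mul_cancel₀ hg'])).const_mul ‖g‖
  have h1 : (fun ω => ‖g‖ * inner ℝ (‖g‖⁻¹ • g) (X ω)) = fun ω => inner ℝ g (X ω) := by
    funext ω
    rw [real_inner_smul_left, mul_inv_cancel_left₀ hg']
  rw [h1] at h
  convert h using 1
  apply NNReal.eq
  change _ = ‖g‖ ^ 2 * (Real.toNNReal (σ ^ 2) : ℝ)
  rw [Real.coe_toNNReal _ (sq_nonneg σ), Real.coe_toNNReal _ (by positivity), mul_comm]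

theorem lintegral_exp_sum_inner_le {Ω : Type*} [MeasurableSpace Ω] {μ : Measure Ω}
    [IsProbabilityMeasure μ] {d : ℕ} {σ : ℝ} {v : ℕ → Ω → EuclideanSpace ℝ (Fin d)}
    (hind : iIndepFun v μ) (hv : ∀ t, IsCenteredSubgaussian μ d σ (v t)) (F : Finset ℕ)
    (g : ℕ → EuclideanSpace ℝ (Fin d)) :
    ∫⁻ ω, ENNReal.ofReal (Real.exp (∑ s ∈ F, inner ℝ (g s) (v s ω))) ∂μ ≤
      ENNReal.ofReal (Real.exp (σ ^ 2 / 2 * ∑ s ∈ F, ‖g s‖ ^ 2)) := by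
  have hi : iIndepFun (fun s ω => inner ℝ (g s) (v s ω)) μ :=
    hind.comp (fun s x => inner ℝ (g s) x) fun s => by fun_prop
  have h := HasSubgaussianMGF.sum_of_iIndepFun hi (s := F) fun s _ => (hv s).hasSubgaussianMGF_inner (g s)
  have h1 := h.mgf_le 1
  have h2 := h.integrable_exp_mul 1
  simp only [mgf, one_mul] at h1 h2
  rw [← ofReal_integral_eq_lintegral_ofReal h2 (Eventually.of_forall fun _ => (Real.exp_pos _).le)]
  refine ENNReal.ofReal_le_ofReal (h1.trans (Real.exp_le_exp.2 (le_of_eq ?_)))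
  rw [NNReal.coe_sum, Finset.sum_congr rfl fun s _ =>
    Real.coe_toNNReal (σ ^ 2 * ‖g s‖ ^ 2) (by positivity), ← Finset.mul_sum]
  ring

/-- Exponential supermartingale bound in reversed time: the coefficient of the input at time `s`
may depend on all later inputs. -/
theorem lintegral_exp_sum_inner_future_le [NeZero p]
    {h : ℕ → (ℕ → EuclideanSpace ℝ (Fin p)) → EuclideanSpace ℝ (Fin p)}
    (hc : ∀ s, Continuous (h s))
    (hdep : ∀ s u u', (∀ t, s < t → u t = u' t) → h s u = h s u') (N k : ℕ) :
    ∫⁻ u, ENNReal.ofReal (Real.exp (∑ i ∈ Finset.range N,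
      (inner ℝ (h (k + i) u) (u (k + i)) - p / 2 * ‖h (k + i) u‖ ^ 2))) ∂(inputLaw p) ≤ 1 := by
  have hcont : ∀ s, Continuous fun u : ℕ → EuclideanSpace ℝ (Fin p) =>
      inner ℝ (h s u) (u s) - p / 2 * ‖h s u‖ ^ 2 := fun s =>
    ((hc s).inner (continuous_apply s)).sub (continuous_const.mul ((hc s).norm.pow 2))
  have hmeas : ∀ N k, Measurable fun u : ℕ → EuclideanSpace ℝ (Fin p) =>
      ENNReal.ofReal (Real.exp (∑ i ∈ Finset.range N,
        (inner ℝ (h (k + i) u) (u (k + i)) - p / 2 * ‖h (k + i) u‖ ^ 2))) := fun N k =>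
    (continuous_finsetSum _ fun i _ => hcont (k + i)).measurable.exp.ennreal_ofReal
  induction N generalizing k with
  | zero => simp
  | succ N ih =>
    have hone : ∀ v : EuclideanSpace ℝ (Fin p), ∫⁻ x, ENNReal.ofReal (Real.exp
        (inner ℝ v (x k) - p / 2 * ‖v‖ ^ 2)) ∂(inputLaw p) ≤ 1 := by
      intro v
      have hexp : ∀ x : EuclideanSpace ℝ (Fin p), ENNReal.ofReal (Real.exp
          (inner ℝ v x - p / 2 * ‖v‖ ^ 2)) = ENNReal.ofReal (Real.exp (inner ℝ v x)) *
            ENNReal.ofReal (Real.exp (-(p / 2 * ‖v‖ ^ 2))) := fun x => by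
        rw [← ENNReal.ofReal_mul (Real.exp_pos _).le, ← Real.exp_add, sub_eq_add_neg]
      have hm : Measurable fun x : EuclideanSpace ℝ (Fin p) =>
          ENNReal.ofReal (Real.exp (inner ℝ v x)) := by fun_prop
      rw [← lintegral_map (μ := inputLaw p) (g := fun x : ℕ → EuclideanSpace ℝ (Fin p) => x k)
        (f := fun x => ENNReal.ofReal (Real.exp (inner ℝ v x - p / 2 * ‖v‖ ^ 2)))
        (by fun_prop) (measurable_pi_apply k), map_eval_inputLaw]
      simp only [hexp]
      rw [lintegral_mul_const _ hm]
      calc _ ≤ ENNReal.ofReal (Real.exp (p * ‖v‖ ^ 2 / 2)) *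
            ENNReal.ofReal (Real.exp (-(p / 2 * ‖v‖ ^ 2))) := by
            gcongr; exact lintegral_exp_inner_unifSphere v
        _ = 1 := by
            rw [← ENNReal.ofReal_mul (Real.exp_pos _).le, ← Real.exp_add,
              show (p : ℝ) * ‖v‖ ^ 2 / 2 + -(p / 2 * ‖v‖ ^ 2) = 0 by ring]
            simp
    specialize ih (k + 1)
    unfold inputLaw at *
    -- Only the earliest input `u k` is resampled. All terms of later index and the coefficient `h
    -- k` depend on later inputs alone, so the fresh input enters one factor, of mean at most one.
    rw [lintegral_infinitePi_splice _ {k} (hmeas (N + 1) k)]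
    have h1 : ∀ x y : ℕ → EuclideanSpace ℝ (Fin p),
        ENNReal.ofReal (Real.exp (∑ i ∈ Finset.range (N + 1),
          (inner ℝ (h (k + i) (splice {k} x y)) (splice {k} x y (k + i)) -
            p / 2 * ‖h (k + i) (splice {k} x y)‖ ^ 2))) =
        ENNReal.ofReal (Real.exp (∑ i ∈ Finset.range N,
          (inner ℝ (h (k + 1 + i) y) (y (k + 1 + i)) - p / 2 * ‖h (k + 1 + i) y‖ ^ 2))) *
        ENNReal.ofReal (Real.exp (inner ℝ (h k y) (x k) - p / 2 * ‖h k y‖ ^ 2)) := by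
      intro x y
      have hne : ∀ t, k < t → splice {k} x y t = y t := fun t ht =>
        splice_of_notMem (by simp; omega) x y
      have hh : ∀ s, k ≤ s → h s (splice {k} x y) = h s y := fun s hs =>
        hdep s _ _ fun t ht => hne t (by omega)
      rw [← ENNReal.ofReal_mul (Real.exp_pos _).le, ← Real.exp_add, Finset.sum_range_succ']
      congr 3
      · refine Finset.sum_congr rfl fun i _ => ?_
        rw [hh _ (by omega), hne _ (by omega), show k + (i + 1) = k + 1 + i by omega]
      · rw [add_zero, hh k le_rfl, splice_of_mem (Set.mem_singleton k)]
    simp only [h1]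
    calc _ ≤ ∫⁻ y, ENNReal.ofReal (Real.exp (∑ i ∈ Finset.range N,
          (inner ℝ (h (k + 1 + i) y) (y (k + 1 + i)) - p / 2 * ‖h (k + 1 + i) y‖ ^ 2))) * 1
            ∂(Measure.infinitePi fun _ => unifSphere p) :=
          lintegral_mono fun y => by
            rw [lintegral_const_mul _ (by fun_prop)]
            gcongr
            exact hone _
      _ ≤ 1 := by simpa using ih

/-- Empirical cross-moment matrix `∑_{t=L}^T e_t ũ_tᵀ`. -/
def crossMoment (L T : ℕ) (u : ℕ → EuclideanSpace ℝ (Fin p)) (e : ℕ → Fin m → ℝ) :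
    Matrix (Fin m) (FeatIdx p L) ℝ :=
  ∑ t ∈ Finset.Icc L T, Matrix.vecMulVec (e t) (feature L u t)

theorem crossMoment_bilin {L T : ℕ} (u : ℕ → EuclideanSpace ℝ (Fin p)) (e : ℕ → Fin m → ℝ)
    (a : Fin m → ℝ) (b : FeatIdx p L → ℝ) : a ⬝ᵥ (crossMoment L T u e *ᵥ b) =
      ∑ t ∈ Finset.Icc L T, (a ⬝ᵥ e t) * (feature L u t ⬝ᵥ b) := by
  rw [crossMoment, Matrix.sum_mulVec, dotProduct_sum]
  refine Finset.sum_congr rfl fun t _ => ?_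
  rw [Matrix.vecMulVec_mulVec, dotProduct_smul]
  simp

theorem crossMoment_add (L T : ℕ) (u : ℕ → EuclideanSpace ℝ (Fin p)) (e e' : ℕ → Fin m → ℝ) :
    crossMoment L T u (fun t => e t + e' t) = crossMoment L T u e + crossMoment L T u e' := by
  simp only [crossMoment, ← Finset.sum_add_distrib, Matrix.add_vecMulVec]

/-- The bilinear form of the cross-moment matrix, with a quadratic penalty. -/
noncomputable def penalized (L T : ℕ) (K : ℝ) (u : ℕ → EuclideanSpace ℝ (Fin p))
    (e : ℕ → Fin m → ℝ) (a : Fin m → ℝ) (b : FeatIdx p L → ℝ) : ℝ :=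
  a ⬝ᵥ (crossMoment L T u e *ᵥ b) - K ^ 2 / 2 * ((a ⬝ᵥ a) * (b ⬝ᵥ (gram L T u *ᵥ b)))

theorem continuous_penalized {X : Type*} [TopologicalSpace X] (L T : ℕ) (K : ℝ)
    {u : X → ℕ → EuclideanSpace ℝ (Fin p)} (hu : Continuous u) {e : X → ℕ → Fin m → ℝ}
    (he : ∀ t, Continuous fun x => e x t) (a : Fin m → ℝ) (b : FeatIdx p L → ℝ) :
    Continuous fun x => penalized L T K (u x) (e x) a b := by
  have hf : ∀ t, Continuous fun x => feature L (u x) t := fun t =>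
    (continuous_feature L t).comp hu
  simp only [penalized, crossMoment_bilin, gram_quadForm]
  refine (continuous_finsetSum _ fun t _ => ?_).sub (continuous_const.mul (continuous_const.mul
    (continuous_finsetSum _ fun t _ => ?_)))
  · exact (continuous_const.dotProduct (he t)).mul ((hf t).dotProduct continuous_const)
  · exact ((hf t).dotProduct continuous_const).pow 2

/-- Given the inputs, the form is a sum of `⟨g t, z t⟩` with `∑ ‖g t‖² = |a|² b·Sb`, so the
subgaussian bound is cancelled by the penalty as soon as `σ ≤ K`. -/
theorem lintegral_exp_penalized_measurement [NeZero p] {Ω : Type*} [MeasurableSpace Ω]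
    {μ : Measure Ω} [IsProbabilityMeasure μ] {u : ℕ → Ω → EuclideanSpace ℝ (Fin p)}
    {z : ℕ → Ω → EuclideanSpace ℝ (Fin m)} (hu : ∀ t, Measurable (u t))
    (hz : ∀ t, Measurable (z t)) {σ K : ℝ} (hσ : 0 ≤ σ) (hK : σ ≤ K) (hzi : iIndepFun z μ)
    (hzs : ∀ t, IsCenteredSubgaussian μ m σ (z t))
    (huz : IndepFun (fun ω t => u t ω) (fun ω t => z t ω) μ) (L T : ℕ)
    (a : Fin m → ℝ) (b : FeatIdx p L → ℝ) :
    ∫⁻ ω, ENNReal.ofReal (Real.exp (penalized L T K (fun t => u t ω)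
      (fun t => (z t ω).ofLp) a b)) ∂μ ≤ 1 := by
  have hcont : Continuous fun q : (ℕ → EuclideanSpace ℝ (Fin p)) ×
      (ℕ → EuclideanSpace ℝ (Fin m)) => penalized L T K q.1 (fun t => (q.2 t).ofLp) a b :=
    continuous_penalized L T K continuous_fst (fun t => by fun_prop) a b
  refine lintegral_indepFun_le_one (measurable_pi_lambda _ hu) (measurable_pi_lambda _ hz) huz
    (f := fun q => ENNReal.ofReal (Real.exp (penalized L T K q.1 (fun t => (q.2 t).ofLp) a b)))
    hcont.measurable.exp.ennreal_ofReal (Eventually.of_forall fun x => ?_)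
  set g : ℕ → EuclideanSpace ℝ (Fin m) := fun t => (feature L x t ⬝ᵥ b) • WithLp.toLp 2 a with hg
  have hsum : ∀ ω, penalized L T K x (fun t => (z t ω).ofLp) a b =
      ∑ t ∈ Finset.Icc L T, inner ℝ (g t) (z t ω) +
        -(K ^ 2 / 2 * ((a ⬝ᵥ a) * (b ⬝ᵥ (gram L T x *ᵥ b)))) := by
    intro ω
    rw [penalized, crossMoment_bilin, sub_eq_add_neg]
    congr 1
    refine Finset.sum_congr rfl fun t _ => ?_
    rw [hg, real_inner_smul_left, EuclideanSpace.inner_eq_star_dotProduct, dotProduct_comm, mul_comm]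
    simp [dotProduct_comm]
  have hgn : ∑ t ∈ Finset.Icc L T, ‖g t‖ ^ 2 = (a ⬝ᵥ a) * (b ⬝ᵥ (gram L T x *ᵥ b)) := by
    rw [gram_quadForm, Finset.mul_sum]
    refine Finset.sum_congr rfl fun t _ => ?_
    rw [hg, norm_smul, mul_pow, norm_toLp_sq, Real.norm_eq_abs, sq_abs, mul_comm]
  simp only [hsum, Real.exp_add]
  simp_rw [ENNReal.ofReal_mul (Real.exp_pos _).le]
  rw [lintegral_mul_const' _ _ ENNReal.ofReal_ne_top]
  refine (mul_le_mul_left (lintegral_exp_sum_inner_le hzi hzs _ g) _).trans ?_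
  rw [← ENNReal.ofReal_mul (Real.exp_pos _).le, ← Real.exp_add, hgn, ← ENNReal.ofReal_one]
  refine ENNReal.ofReal_le_ofReal (Real.exp_le_one_iff.2 ?_)
  have h1 : σ ^ 2 ≤ K ^ 2 := pow_le_pow_left₀ hσ hK 2
  have h2 : 0 ≤ (a ⬝ᵥ a) * (b ⬝ᵥ (gram L T x *ᵥ b)) := by
    rw [← hgn]; exact Finset.sum_nonneg fun _ _ => sq_nonneg _
  nlinarith

/-- Given the inputs, the process noise enters through a filter without delay (`r = 0`), whose
adjoint has gain at most `‖C‖ κ/(1-ρ)`. -/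
theorem lintegral_exp_penalized_process [NeZero p] {S : BLDS n p m} {κ ρ : ℝ}
    (hS : S.UniformlyStable (Metric.sphere 0 (Real.sqrt p)) κ ρ)
    {Ω : Type*} [MeasurableSpace Ω]
    {μ : Measure Ω} [IsProbabilityMeasure μ] {u : ℕ → Ω → EuclideanSpace ℝ (Fin p)}
    {w : ℕ → Ω → EuclideanSpace ℝ (Fin n)} (hu : ∀ t, Measurable (u t))
    (hlaw : μ.map (fun ω t => u t ω) = inputLaw p)
    (hw : ∀ t, Measurable (w t)) {σ K : ℝ} (hσ : 0 ≤ σ)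
    (hK : σ * (‖S.C‖ * κ / (1 - ρ)) ≤ K) (hwi : iIndepFun w μ)
    (hws : ∀ t, IsCenteredSubgaussian μ n σ (w t))
    (huw : IndepFun (fun ω t => u t ω) (fun ω t => w t ω) μ) (L T : ℕ)
    (a : Fin m → ℝ) (b : FeatIdx p L → ℝ) :
    ∫⁻ ω, ENNReal.ofReal (Real.exp (penalized L T K (fun t => u t ω)
      (fun t => ∑ s ∈ Finset.range (t - 0),
        (S.C * S.transition (fun t => u t ω) (s + 1) (t - 1 - s)) *ᵥ (w s ω).ofLp) a b)) ∂μ ≤ 1 := by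
  have hcont : Continuous fun q : (ℕ → EuclideanSpace ℝ (Fin p)) ×
      (ℕ → EuclideanSpace ℝ (Fin n)) => penalized L T K q.1 (fun t => ∑ s ∈ Finset.range (t - 0),
        (S.C * S.transition q.1 (s + 1) (t - 1 - s)) *ᵥ (q.2 s).ofLp) a b :=
    continuous_penalized L T K continuous_fst (fun t => continuous_finsetSum _ fun s _ =>
      (continuous_const.matrix_mul ((continuous_transition S _ _).comp
        continuous_fst)).matrix_mulVec (by fun_prop)) a b
  refine lintegral_indepFun_le_one (measurable_pi_lambda _ hu) (measurable_pi_lambda _ hw) huw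
    (f := fun q => ENNReal.ofReal (Real.exp (penalized L T K q.1
      (fun t => ∑ s ∈ Finset.range (t - 0),
        (S.C * S.transition q.1 (s + 1) (t - 1 - s)) *ᵥ (q.2 s).ofLp) a b)))
    hcont.measurable.exp.ennreal_ofReal ?_
  rw [hlaw]
  filter_upwards [norm_ae_inputLaw (p := p)] with x hx
  set H : ℕ → ℕ → Matrix (Fin m) (Fin n) ℝ := fun t s =>
    S.C * S.transition x (s + 1) (t - 1 - s) with hH
  have hHn : ∀ t s, s + 0 < t → ‖H t s‖ ≤ (‖S.C‖ * κ) * ρ ^ (t - 1 - s) := fun t s _ => by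
    refine (Matrix.l2_opNorm_mul _ _).trans ?_
    rw [mul_assoc]
    exact mul_le_mul_of_nonneg_left (norm_transition_le hS hx _ _) (norm_nonneg _)
  set g := adjFilter H 0 L T (fun t => feature L x t ⬝ᵥ b) a with hg
  have hsum : ∀ ω, penalized L T K x (fun t => ∑ s ∈ Finset.range (t - 0),
      H t s *ᵥ (w s ω).ofLp) a b = ∑ s ∈ Finset.range T, inner ℝ (g s) (w s ω) +
        -(K ^ 2 / 2 * ((a ⬝ᵥ a) * (b ⬝ᵥ (gram L T x *ᵥ b)))) := by
    intro ω
    rw [penalized, crossMoment_bilin, sub_eq_add_neg,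
      sum_mul_dotProduct_filter H 0 L T _ a fun s => w s ω]
  have hgn := sum_norm_adjFilter_sq_le L T (fun t => feature L x t ⬝ᵥ b) a hS.pos hS.lt_one hHn
  rw [← gram_quadForm, ← hg, pow_zero, mul_one] at hgn
  change ∫⁻ ω, ENNReal.ofReal (Real.exp (penalized L T K x (fun t =>
    ∑ s ∈ Finset.range (t - 0), H t s *ᵥ (w s ω).ofLp) a b)) ∂μ ≤ 1
  simp only [hsum, Real.exp_add]
  simp_rw [ENNReal.ofReal_mul (Real.exp_pos _).le]
  rw [lintegral_mul_const' _ _ ENNReal.ofReal_ne_top]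
  refine (mul_le_mul_left (lintegral_exp_sum_inner_le hwi hws _ g) _).trans ?_
  rw [← ENNReal.ofReal_mul (Real.exp_pos _).le, ← Real.exp_add, ← ENNReal.ofReal_one]
  refine ENNReal.ofReal_le_ofReal (Real.exp_le_one_iff.2 ?_)
  have hκ : 0 ≤ κ := zero_le_one.trans hS.one_le
  have hρ : 0 < 1 - ρ := sub_pos.2 hS.lt_one
  have h1 : (σ * (‖S.C‖ * κ / (1 - ρ))) ^ 2 ≤ K ^ 2 := pow_le_pow_left₀ (by positivity) hK 2
  have h2 : 0 ≤ (a ⬝ᵥ a) * (b ⬝ᵥ (gram L T x *ᵥ b)) := by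
    rw [gram_quadForm, ← norm_toLp_sq]
    exact mul_nonneg (sq_nonneg _) (Finset.sum_nonneg fun _ _ => sq_nonneg _)
  have h3 := mul_le_mul_of_nonneg_right h1 h2
  have h4 := mul_le_mul_of_nonneg_left hgn (sq_nonneg σ)
  rw [mul_pow] at h3
  linarith

/-- The coefficient of `u s` uses only times `t > s + L`, and the covariates at those times read
inputs after `s`, as do the transition matrices. This permits the reversed-time bound. The delay `L`
gives the gain its factor `ρ^L`. -/
theorem lintegral_exp_penalized_input [NeZero p] {S : BLDS n p m} {κ ρ : ℝ}
    (hS : S.UniformlyStable (Metric.sphere 0 (Real.sqrt p)) κ ρ) {L : ℕ} (T : ℕ) {K : ℝ}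
    (hK : Real.sqrt p * (‖S.C‖ * κ * ‖S.B‖ * ρ ^ L / (1 - ρ)) ≤ K)
    (a : Fin m → ℝ) (b : FeatIdx p L → ℝ) :
    ∫⁻ u, ENNReal.ofReal (Real.exp (penalized L T K u (fun t => ∑ s ∈ Finset.range (t - L),
        (S.C * S.transition u (s + 1) (t - 1 - s) * S.B) *ᵥ (u s).ofLp) a b)) ∂(inputLaw p)
      ≤ 1 := by
  set H : (ℕ → EuclideanSpace ℝ (Fin p)) → ℕ → ℕ → Matrix (Fin m) (Fin p) ℝ := fun u t s =>
    S.C * S.transition u (s + 1) (t - 1 - s) * S.B with hH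
  set h : ℕ → (ℕ → EuclideanSpace ℝ (Fin p)) → EuclideanSpace ℝ (Fin p) := fun s u =>
    adjFilter (H u) L L T (fun t => feature L u t ⬝ᵥ b) a s with hh
  have hHc : ∀ t s, Continuous fun u => H u t s := fun t s =>
    (continuous_const.matrix_mul (continuous_transition S _ _)).matrix_mul continuous_const
  have hc : ∀ s, Continuous (h s) := fun s => by
    refine (PiLp.continuous_toLp 2 _).comp (continuous_finsetSum _ fun t _ => ?_)
    exact ((continuous_feature L t).dotProduct continuous_const).smul
      ((hHc t s).matrix_transpose.matrix_mulVec continuous_const)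
  have hdep : ∀ s u u', (∀ t, s < t → u t = u' t) → h s u = h s u' := by
    intro s u u' huu
    simp only [hh, adjFilter]
    congr 1
    refine Finset.sum_congr rfl fun t ht => ?_
    have hst := (Finset.mem_filter.1 ht).2
    rw [feature_congr (u' := u') fun r hr => huu _ (by omega), hH]
    simp only
    rw [transition_congr S (u' := u') fun r hr _ => huu _ (by omega)]
  refine le_trans (lintegral_mono_ae ?_) (lintegral_exp_sum_inner_future_le hc hdep T 0)
  filter_upwards [norm_ae_inputLaw (p := p)] with x hx
  refine ENNReal.ofReal_le_ofReal (Real.exp_le_exp.2 ?_)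
  have hκ : 0 ≤ κ := zero_le_one.trans hS.one_le
  have hρ : 0 < 1 - ρ := sub_pos.2 hS.lt_one
  have hρ0 := hS.pos
  have hHn : ∀ t s, s + L < t → ‖H x t s‖ ≤ (‖S.C‖ * κ * ‖S.B‖) * ρ ^ (t - 1 - s) := fun t s _ => by
    refine (Matrix.l2_opNorm_mul _ _).trans ?_
    calc ‖S.C * S.transition x (s + 1) (t - 1 - s)‖ * ‖S.B‖
        ≤ (‖S.C‖ * (κ * ρ ^ (t - 1 - s))) * ‖S.B‖ := by
          gcongr
          refine (Matrix.l2_opNorm_mul _ _).trans ?_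
          gcongr
          exact norm_transition_le hS hx _ _
      _ = _ := by ring
  have hgn := sum_norm_adjFilter_sq_le L T (fun t => feature L x t ⬝ᵥ b) a hS.pos hS.lt_one hHn
  rw [← gram_quadForm] at hgn
  rw [penalized, crossMoment_bilin, sum_mul_dotProduct_filter (H x) L L T _ a x]
  simp only [zero_add, Finset.sum_sub_distrib, ← Finset.mul_sum]
  refine sub_le_sub_left ?_ _
  have h1 := pow_le_pow_left₀ (by positivity) hK 2
  have h2 : 0 ≤ (a ⬝ᵥ a) * (b ⬝ᵥ (gram L T x *ᵥ b)) := by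
    rw [gram_quadForm, ← norm_toLp_sq]
    exact mul_nonneg (sq_nonneg _) (Finset.sum_nonneg fun _ _ => sq_nonneg _)
  have h3 := mul_le_mul_of_nonneg_right h1 h2
  rw [mul_pow, Real.sq_sqrt (Nat.cast_nonneg p)] at h3
  have h4 := mul_le_mul_of_nonneg_left hgn (Nat.cast_nonneg (α := ℝ) p)
  linarith

end BLDS

/-! ### From moment matrices to the estimation error. -/

theorem l2_opNorm_le_of_mulVec {ι κ : Type*} [Fintype ι] [Fintype κ] [DecidableEq ι]
    (A : Matrix κ ι ℝ) {C : ℝ} (hC : 0 ≤ C)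
    (h : ∀ c : ι → ℝ, ‖WithLp.toLp 2 (A *ᵥ c)‖ ≤ C * ‖WithLp.toLp 2 c‖) : ‖A‖ ≤ C := by
  rw [Matrix.l2_opNorm_def]
  exact ContinuousLinearMap.opNorm_le_bound _ hC fun x => h x.ofLp

/-- An upper bound for the solution of a linear system with a positive definite matrix. -/
theorem quadForm_add_le_of_mulVec_eq {ι : Type*} [Fintype ι] {S : Matrix ι ι ℝ} {Λ N : ℝ}
    (hΛ : 0 < Λ) (hΛN : Λ ≤ N) (hS : ∀ b, Λ * (b ⬝ᵥ b) ≤ b ⬝ᵥ (S *ᵥ b)) {b c : ι → ℝ}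
    (h : S *ᵥ b = c) :
    b ⬝ᵥ (S *ᵥ b) + N * (b ⬝ᵥ b) ≤ 2 * N / Λ ^ 2 * (c ⬝ᵥ c) := by
  have h1 := hS b
  have hcs : (b ⬝ᵥ c) ^ 2 ≤ (b ⬝ᵥ b) * (c ⬝ᵥ c) := by
    simpa [dotProduct, pow_two] using Finset.sum_mul_sq_le_sq_mul_sq Finset.univ b c
  rw [h] at h1 ⊢
  have hb : 0 ≤ b ⬝ᵥ b := Finset.sum_nonneg fun _ _ => mul_self_nonneg _
  have hc : 0 ≤ c ⬝ᵥ c := Finset.sum_nonneg fun _ _ => mul_self_nonneg _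
  have hbc : 0 ≤ b ⬝ᵥ c := le_trans (by positivity) h1
  have h2 : b ⬝ᵥ c ≤ (c ⬝ᵥ c) / Λ := by
    rw [le_div_iff₀ hΛ]
    rcases hbc.eq_or_lt with h0 | h0
    · rw [← h0]; simpa using hc
    · have : (b ⬝ᵥ c) * ((b ⬝ᵥ c) * Λ) ≤ (b ⬝ᵥ c) * (c ⬝ᵥ c) := by
        calc (b ⬝ᵥ c) * ((b ⬝ᵥ c) * Λ) = Λ * (b ⬝ᵥ c) ^ 2 := by ring
          _ ≤ Λ * ((b ⬝ᵥ b) * (c ⬝ᵥ c)) := by gcongr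
          _ = Λ * (b ⬝ᵥ b) * (c ⬝ᵥ c) := by ring
          _ ≤ _ := by gcongr
      exact le_of_mul_le_mul_left this h0
  have h3 : b ⬝ᵥ b ≤ (c ⬝ᵥ c) / Λ ^ 2 := by
    rw [pow_two, ← div_div, le_div_iff₀ hΛ, mul_comm]
    exact h1.trans h2
  have hN : 0 < N := hΛ.trans_le hΛN
  calc b ⬝ᵥ c + N * (b ⬝ᵥ b) ≤ (c ⬝ᵥ c) / Λ + N * ((c ⬝ᵥ c) / Λ ^ 2) := by gcongr
    _ = Λ * ((c ⬝ᵥ c) / Λ ^ 2) + N * ((c ⬝ᵥ c) / Λ ^ 2) := by field_simp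
    _ ≤ N * ((c ⬝ᵥ c) / Λ ^ 2) + N * ((c ⬝ᵥ c) / Λ ^ 2) := by gcongr
    _ = _ := by ring

namespace BLDS

variable {n p m : ℕ}

/-- The lower bound makes the Gram matrix `S` injective, and the Penrose condition `S X S = S` then
forces `X S = 1`. -/
theorem gram_mul_pinv {L T : ℕ} {u : ℕ → EuclideanSpace ℝ (Fin p)} {Λ : ℝ} (hΛ : 0 < Λ)
    (hS : ∀ b, Λ * (b ⬝ᵥ b) ≤ b ⬝ᵥ (gram L T u *ᵥ b)) : gram L T u * pinv (gram L T u) = 1 := by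
  have hX := isMoorePenrose_pinv (gram_isHermitian L T u)
  set S := gram L T u
  have hinj : ∀ v, S *ᵥ v = 0 → v = 0 := by
    intro v hv
    have h1 := hS v
    rw [hv, dotProduct_zero] at h1
    have h2 : 0 ≤ v ⬝ᵥ v := Finset.sum_nonneg fun _ _ => mul_self_nonneg _
    exact dotProduct_self_eq_zero.1 (le_antisymm (by nlinarith) h2)
  have h1 : pinv S * S = 1 := by
    refine Matrix.ext_of_mulVec_single fun i => ?_
    rw [← sub_eq_zero, ← Matrix.sub_mulVec]
    apply hinj
    rw [Matrix.mulVec_mulVec, mul_sub, mul_one, ← mul_assoc, hX.mul_mul, sub_self,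
      Matrix.zero_mulVec]
  exact mul_eq_one_comm.1 h1

theorem lse_sub_eq {L T : ℕ} {u : ℕ → EuclideanSpace ℝ (Fin p)}
    {y : ℕ → EuclideanSpace ℝ (Fin m)} {G : Matrix (Fin m) (FeatIdx p L) ℝ} {e : ℕ → Fin m → ℝ}
    (hy : ∀ t, L ≤ t → (y t).ofLp = G *ᵥ feature L u t + e t)
    (hX : gram L T u * pinv (gram L T u) = 1) :
    lse L T u y - G = crossMoment L T u e * pinv (gram L T u) := by
  have h1 : ∑ t ∈ Finset.Icc L T, Matrix.vecMulVec (y t).ofLp (feature L u t) =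
      G * gram L T u + crossMoment L T u e := by
    rw [gram, crossMoment, Matrix.mul_sum, ← Finset.sum_add_distrib]
    refine Finset.sum_congr rfl fun t ht => ?_
    rw [hy t (Finset.mem_Icc.1 ht).1, Matrix.add_vecMulVec, Matrix.mul_vecMulVec]
  rw [lse, h1, Matrix.add_mul, Matrix.mul_assoc, hX, Matrix.mul_one, add_sub_cancel_left]

/-- The error applied to `c` is the cross moment applied to `b = S⁻¹c`, and the self-normalized
bound at this `b` is turned into `|c|²` by the lower bound on `S`. The factor `3` counts the parts
of the error. -/
theorem norm_lse_sub_le {L T : ℕ} {u : ℕ → EuclideanSpace ℝ (Fin p)}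
    {y : ℕ → EuclideanSpace ℝ (Fin m)} {G : Matrix (Fin m) (FeatIdx p L) ℝ}
    {e₁ e₂ e₃ : ℕ → Fin m → ℝ}
    (hy : ∀ t, L ≤ t → (y t).ofLp = G *ᵥ feature L u t + (e₁ t + (e₂ t + e₃ t)))
    {Λ N R : ℝ} (hΛ : 0 < Λ) (hΛN : Λ ≤ N) (hR : 0 ≤ R)
    (hS : ∀ b, Λ * (b ⬝ᵥ b) ≤ b ⬝ᵥ (gram L T u *ᵥ b))
    (hQ : ∀ e ∈ ({e₁, e₂, e₃} : Set (ℕ → Fin m → ℝ)), ∀ b,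
      (crossMoment L T u e *ᵥ b) ⬝ᵥ (crossMoment L T u e *ᵥ b) ≤
        R * (b ⬝ᵥ (gram L T u *ᵥ b) + N * (b ⬝ᵥ b))) :
    ‖lse L T u y - G‖ ≤ 3 * Real.sqrt (R * (2 * N / Λ ^ 2)) := by
  have hX := gram_mul_pinv hΛ hS
  rw [lse_sub_eq hy hX]
  refine l2_opNorm_le_of_mulVec _ (by positivity) fun c => ?_
  rw [← Matrix.mulVec_mulVec]
  set b := pinv (gram L T u) *ᵥ c with hb
  have hSb : gram L T u *ᵥ b = c := by rw [hb, Matrix.mulVec_mulVec, hX, Matrix.one_mulVec]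
  have hq := quadForm_add_le_of_mulVec_eq hΛ hΛN hS hSb
  have hone : ∀ e ∈ ({e₁, e₂, e₃} : Set (ℕ → Fin m → ℝ)),
      ‖WithLp.toLp 2 (crossMoment L T u e *ᵥ b)‖ ≤
        Real.sqrt (R * (2 * N / Λ ^ 2)) * ‖WithLp.toLp 2 c‖ := by
    intro e he
    refine abs_le_of_sq_le_sq' ?_ (by positivity) |>.2
    rw [mul_pow, Real.sq_sqrt (by have := hΛ.trans_le hΛN; positivity), norm_toLp_sq, norm_toLp_sq]
    calc _ ≤ R * (b ⬝ᵥ (gram L T u *ᵥ b) + N * (b ⬝ᵥ b)) := hQ e he b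
      _ ≤ R * (2 * N / Λ ^ 2 * (c ⬝ᵥ c)) := by gcongr
      _ = _ := by ring
  rw [crossMoment_add, crossMoment_add L T u e₂ e₃, Matrix.add_mulVec, Matrix.add_mulVec,
    WithLp.toLp_add, WithLp.toLp_add]
  have h1 := hone e₁ (by simp)
  have h2 := hone e₂ (by simp)
  have h3 := hone e₃ (by simp)
  have h4 := norm_add_le (WithLp.toLp 2 (crossMoment L T u e₁ *ᵥ b))
    (WithLp.toLp 2 (crossMoment L T u e₂ *ᵥ b) + WithLp.toLp 2 (crossMoment L T u e₃ *ᵥ b))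
  have h5 := norm_add_le (WithLp.toLp 2 (crossMoment L T u e₂ *ᵥ b))
    (WithLp.toLp 2 (crossMoment L T u e₃ *ᵥ b))
  linarith

/-- The trace controls the loss from rounding in the self-normalized bound. -/
theorem sum_gram_diag_le {L T : ℕ} (hT : L ≤ T) {u : ℕ → EuclideanSpace ℝ (Fin p)}
    (hu : ∀ t, ‖u t‖ = Real.sqrt p) :
    ∑ i, gram L T u i i ≤ ((p : ℝ) + 1) ^ (L + 1) * ((T : ℝ) - L + 1) := by
  have h1 : ∑ i, gram L T u i i = ∑ t ∈ Finset.Icc L T, feature L u t ⬝ᵥ feature L u t := by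
    simp only [gram, Matrix.sum_apply, Matrix.vecMulVec_apply, dotProduct]
    exact Finset.sum_comm
  rw [h1]
  refine (Finset.sum_le_card_nsmul _ _ _ fun t _ => feature_dotProduct_self_le hu t).trans
    (le_of_eq ?_)
  rw [nsmul_eq_mul, Nat.card_Icc, Nat.cast_sub (by omega), mul_comm]
  push_cast
  ring

/-- The least eigenvalue of the empirical second-moment matrix is, with high probability, at least
of the order of the number of samples, up to a factor logarithmic in the dimension. -/
theorem measure_gram_lt_le_of_long [NeZero p] {L T : ℕ} {δ : ℝ} (hL : 1 ≤ L) (hδ : 0 < δ)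
    (hδ1 : δ < 1)
    (hT : 9 * (L * (L + 1) * (((p : ℝ) + 1) ^ (L + 1) *
      Real.log (((p : ℝ) + 1) ^ (L + 1) / δ))) ≤ (T : ℝ) - L) :
    inputLaw p {u | ¬ ∀ b : FeatIdx p L → ℝ,
      ((T : ℝ) - L) / (108 * (L + 1) * Real.log (((p : ℝ) + 1) ^ (L + 1))) * (b ⬝ᵥ b) ≤
        b ⬝ᵥ (gram L T u *ᵥ b)} ≤ ENNReal.ofReal (δ / 4) := by
  set D : ℝ := ((p : ℝ) + 1) ^ (L + 1) with hD
  have hp : (1 : ℝ) ≤ p := by exact_mod_cast NeZero.one_le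
  have hL' : (1 : ℝ) ≤ L := by exact_mod_cast hL
  have hD4 : 4 ≤ D := by
    calc (4 : ℝ) = 2 ^ 2 := by norm_num
      _ ≤ ((p : ℝ) + 1) ^ 2 := by gcongr; linarith
      _ ≤ D := pow_le_pow_right₀ (by linarith) (by omega)
  have hD0 : 0 < D := by linarith
  have hlog2 : (0.69 : ℝ) < Real.log 2 := by linarith [Real.log_two_gt_d9]
  have hlog4 : Real.log 4 = 2 * Real.log 2 := by
    rw [show (4 : ℝ) = 2 ^ 2 by norm_num, Real.log_pow]; norm_num
  have hlog16 : Real.log 16 = 4 * Real.log 2 := by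
    rw [show (16 : ℝ) = 2 ^ 4 by norm_num, Real.log_pow]; norm_num
  have hlogD : 2 * Real.log 2 ≤ Real.log D := by
    rw [← hlog4]; exact Real.log_le_log (by norm_num) hD4
  have hlogD' : Real.log (16 * D) ≤ 3 * Real.log D := by
    rw [Real.log_mul (by norm_num) hD0.ne', hlog16]; linarith
  have hlogDδ : Real.log D ≤ Real.log (D / δ) := by
    refine Real.log_le_log hD0 ?_
    rw [le_div_iff₀ hδ]; nlinarith
  have hlog4δ : Real.log (4 / δ) ≤ Real.log (D / δ) :=
    Real.log_le_log (by positivity) (by gcongr)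
  set ℓ := Real.log (D / δ) with hℓ
  have hℓ0 : 0 < ℓ := by linarith
  have hTL : (L : ℝ) < T := by
    have : 0 < 9 * (L * (L + 1) * (D * ℓ)) := by positivity
    linarith
  have hTL' : L < T := by exact_mod_cast hTL
  -- `N₀` is the block length, `N₁` the number of times `L + k(L+1) ≤ T`, and `M` the number of
  -- complete blocks. Since `N₀ ≤ 9 D log D` and `M N₀ ≥ N₁/2`, the bound `M D/6` yields the
  -- constant `108 = 6 · 2 · 9`.
  set N₀ := ⌈2 * D * Real.log (16 * D)⌉₊ with hN₀
  set N₁ := (T - L) / (L + 1) + 1 with hN₁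
  set M := N₁ / N₀ with hM
  have hlogpos : 0 < Real.log (16 * D) := Real.log_pos (by linarith)
  have hN₀le : (2 * D * Real.log (16 * D)) ≤ N₀ := Nat.le_ceil _
  have hN₀ub : (N₀ : ℝ) ≤ 9 * D * Real.log D := by
    have h1 : (N₀ : ℝ) < 2 * D * Real.log (16 * D) + 1 := Nat.ceil_lt_add_one (by positivity)
    have h2 : 2 * D * Real.log (16 * D) ≤ 2 * D * (3 * Real.log D) := by gcongr
    have h3 : 4 * 1 ≤ D * Real.log D := by
      have : 1 ≤ Real.log D := by linarith
      gcongr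
    linarith
  have hN₁lb : ((T : ℝ) - L) / (L + 1) ≤ N₁ := by
    rw [div_le_iff₀ (by positivity)]
    have h1 := Nat.lt_div_mul_add (a := T - L) (b := L + 1) (by omega)
    have h2 : T - L ≤ N₁ * (L + 1) := by rw [hN₁, add_mul]; omega
    have h3 : ((T - L : ℕ) : ℝ) ≤ ((N₁ * (L + 1) : ℕ) : ℝ) := by exact_mod_cast h2
    rw [Nat.cast_sub hTL'.le] at h3
    push_cast at h3
    exact h3
  have hN₁lb' : 9 * (D * ℓ) ≤ N₁ := by
    refine le_trans ?_ hN₁lb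
    rw [le_div_iff₀ (by positivity)]
    refine le_trans ?_ hT
    have : 1 * ((L + 1) * (D * ℓ)) ≤ L * ((L + 1) * (D * ℓ)) := by gcongr
    nlinarith
  have hN₀N₁ : N₀ ≤ N₁ := by
    have h1 : 9 * D * Real.log D ≤ 9 * (D * ℓ) := by
      rw [mul_assoc]; gcongr
    exact_mod_cast hN₀ub.trans (h1.trans hN₁lb')
  have hN₀pos : 0 < N₀ := Nat.ceil_pos.2 (by positivity)
  have hN₀pos' : (0 : ℝ) < N₀ := by exact_mod_cast hN₀pos
  have hM1 : 1 ≤ M := (Nat.one_le_div_iff hN₀pos).2 hN₀N₁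
  have hMN : N₁ ≤ 2 * (M * N₀) := by
    have h1 := Nat.lt_div_mul_add (a := N₁) hN₀pos
    have h2 : N₀ ≤ M * N₀ := Nat.le_mul_of_pos_left _ hM1
    rw [← hM] at h1
    omega
  have hMN' : (N₁ : ℝ) ≤ 2 * (M * N₀) := by exact_mod_cast hMN
  have hMle : M * N₀ ≤ N₁ := Nat.div_mul_le_self _ _
  -- The choice of `N₀` gives `16 D ≤ e^(N₀/(2D))`, and `(1 - 1/D)^N₀ ≤ e^(-N₀/D)`; the product is
  -- at most `e^(-N₀/(2D)) = η²`.
  set η : ℝ := Real.exp (-(N₀ / (4 * D))) with hη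
  have hη1 : η ≤ 1 := Real.exp_le_one_iff.2 (by rw [neg_nonpos]; positivity)
  have hmain := measure_gram_lt_le (p := p) L T M N₀ (fun k hk => by
    have h1 : k ≤ (T - L) / (L + 1) := by omega
    have h2 := (Nat.mul_le_mul_right (L + 1) h1).trans (Nat.div_mul_le_self _ _)
    omega) (Real.exp_pos _ : 0 < η) (by linarith) (by
    rw [← hD]
    have h1 : (1 - D⁻¹) ^ N₀ ≤ Real.exp (-(N₀ / D)) := by
      calc (1 - D⁻¹) ^ N₀ ≤ Real.exp (-D⁻¹) ^ N₀ := by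
            refine pow_le_pow_left₀ ?_ (Real.one_sub_le_exp_neg _) _
            rw [sub_nonneg]; exact inv_le_one_of_one_le₀ (by linarith)
        _ = _ := by rw [← Real.exp_nat_mul]; congr 1; rw [div_eq_mul_inv]; ring
    have h2 : 16 * D ≤ Real.exp (N₀ / (2 * D)) := by
      rw [← Real.log_le_iff_le_exp (by positivity), le_div_iff₀ (by positivity)]
      linarith
    calc 16 * (D * (1 - D⁻¹) ^ N₀) = (16 * D) * (1 - D⁻¹) ^ N₀ := by ring
      _ ≤ Real.exp (N₀ / (2 * D)) * Real.exp (-(N₀ / D)) := by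
          refine mul_le_mul h2 h1 (pow_nonneg ?_ _) (Real.exp_pos _).le
          rw [sub_nonneg]; exact inv_le_one_of_one_le₀ (by linarith)
      _ = η ^ 2 := by
          rw [hη, ← Real.exp_nat_mul, ← Real.exp_add]
          congr 1
          push_cast
          field_simp
          ring)
  refine le_trans (measure_mono fun u hu => ?_) (hmain.trans (ENNReal.ofReal_le_ofReal ?_))
  · intro hall
    refine hu fun b => le_trans ?_ (hall b)
    have hbb : 0 ≤ b ⬝ᵥ b := Finset.sum_nonneg fun _ _ => mul_self_nonneg _
    refine mul_le_mul_of_nonneg_right ?_ hbb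
    have hlD : 0 < Real.log D := by linarith
    rw [← hD, div_le_div_iff₀ (by positivity) (by norm_num)]
    rw [div_le_iff₀ (by positivity)] at hN₁lb
    calc ((T : ℝ) - L) * 6 ≤ (2 * (M * N₀)) * (L + 1) * 6 := by
          gcongr
          exact hN₁lb.trans (by gcongr)
      _ ≤ (2 * (M * (9 * D * Real.log D))) * (L + 1) * 6 := by gcongr
      _ = _ := by ring
  · rw [← Real.exp_nat_mul, ← Real.le_log_iff_exp_le (by positivity),
      show δ / 4 = (4 / δ)⁻¹ by rw [inv_div], Real.log_inv, mul_neg, neg_le_neg_iff]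
    -- The exponent `M N₀/(4D)` is at least `N₁/(8D) ≥ 9ℓ/8`, which exceeds `log (4/δ)` because `D ≥
    -- 4`.
    rw [mul_div_assoc', le_div_iff₀ (by positivity)]
    have : Real.log (4 / δ) * (4 * D) ≤ ℓ * (4 * D) := by gcongr
    nlinarith

end BLDS

/-! ### Comparison of rates and conclusion. -/

/-- The factor `((L+1) log D)²` lost in the eigenvalue bound is `(L+1)^4 log²(p+1)`; this estimate
absorbs its power of `L` into `(p+1)^L`. -/
theorem succ_pow_four_le (L : ℕ) : ((L : ℝ) + 1) ^ 4 ≤ 49 * 2 ^ L := by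
  have h : ∀ L : ℕ, (L + 1) ^ 4 ≤ 49 * 2 ^ L := by
    intro L
    by_cases hL : L < 6
    · interval_cases L <;> norm_num
    · induction L, (not_lt.1 hL) using Nat.le_induction with
      | base => norm_num
      | succ k hk ih =>
        have h1 := ih (by omega)
        have h2 : (k + 1 + 1) ^ 4 ≤ 2 * (k + 1) ^ 4 := by
          have h3 : 7 * (k + 1 + 1) ≤ 8 * (k + 1) := by omega
          have h4 := Nat.pow_le_pow_left h3 4
          rw [mul_pow, mul_pow] at h4
          omega
        rw [pow_succ 2]
        omega
  exact_mod_cast h L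

namespace BLDS

variable {n p m : ℕ}

/-- Elementary comparison of the two error rates. -/
theorem rate_le {p L : ℕ} (hp : 1 ≤ p) (hL : 1 ≤ L) {A τ G N' : ℝ} (hA : 0 ≤ A)
    (hG : 0 ≤ G) (hτG : τ ≤ 2 * G) (hN' : 1 ≤ N') :
    3 * Real.sqrt ((13 * (Real.sqrt p * A)) ^ 2 * τ * (2 * (N' + 1) /
      (N' / (108 * (L + 1) * Real.log (((p : ℝ) + 1) ^ (L + 1)))) ^ 2)) ≤
    100000 * A * Real.sqrt (L * (p : ℝ) ^ 2 * ((p : ℝ) + 1) ^ (L + 1) * G / N') := by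
  have hp' : (1 : ℝ) ≤ p := by exact_mod_cast hp
  have hL' : (1 : ℝ) ≤ L := by exact_mod_cast hL
  have hlog : Real.log ((p : ℝ) + 1) ≤ p := by
    have := Real.log_le_sub_one_of_pos (show (0 : ℝ) < p + 1 by linarith)
    linarith
  have hlog0 : 0 ≤ Real.log ((p : ℝ) + 1) := Real.log_nonneg (by linarith)
  set l := Real.log ((p : ℝ) + 1)
  rw [Real.log_pow]
  push_cast
  rw [← Real.sqrt_sq (show (0 : ℝ) ≤ 3 by norm_num), ← Real.sqrt_mul (by positivity),
    ← Real.sqrt_sq (show (0 : ℝ) ≤ 100000 * A by positivity), ← Real.sqrt_mul (by positivity)]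
  refine Real.sqrt_le_sqrt ?_
  have e1 : (2 * (N' + 1) / (N' / (108 * (L + 1) * ((L + 1) * l))) ^ 2 : ℝ) =
      2 * (N' + 1) * (108 ^ 2 * (((L : ℝ) + 1) ^ 4 * l ^ 2)) / N' ^ 2 := by
    rw [div_pow, div_div_eq_mul_div]
    congr 1
    ring
  rw [e1, mul_pow 13, mul_pow (Real.sqrt p), Real.sq_sqrt (by positivity)]
  have h2 : ((L : ℝ) + 1) ^ 4 * l ^ 2 ≤ 49 * (p + 1) ^ L * p ^ 2 := by
    have : (2 : ℝ) ^ L ≤ (p + 1) ^ L := pow_le_pow_left₀ (by norm_num) (by linarith) L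
    have h3 := succ_pow_four_le L
    have h4 : l ^ 2 ≤ (p : ℝ) ^ 2 := pow_le_pow_left₀ hlog0 hlog 2
    calc _ ≤ (49 * 2 ^ L) * (p : ℝ) ^ 2 := by gcongr
      _ ≤ _ := by gcongr
  calc 3 ^ 2 * (13 ^ 2 * (p * A ^ 2) * τ *
        (2 * (N' + 1) * (108 ^ 2 * (((L : ℝ) + 1) ^ 4 * l ^ 2)) / N' ^ 2))
      ≤ 3 ^ 2 * (13 ^ 2 * (p * A ^ 2) * (2 * G) *
        (2 * (N' + N') * (108 ^ 2 * (49 * (p + 1) ^ L * p ^ 2)) / N' ^ 2)) := by gcongr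
    _ = (3 ^ 2 * 13 ^ 2 * 8 * 108 ^ 2 * 49) * (A ^ 2 * G * ((p : ℝ) * (p + 1) ^ L * p ^ 2) / N') := by
        field_simp
        ring
    -- The numerical constant is about `6.95 · 10^9`, below `100000²`.
    _ ≤ 100000 ^ 2 * (A ^ 2 * G * (L * (p + 1) * (p + 1) ^ L * p ^ 2) / N') := by
        gcongr
        · norm_num
        · nlinarith
    _ = _ := by rw [pow_succ]; ring

theorem measurable_penalized_measurement {Ω : Type*} [MeasurableSpace Ω]
    {u : ℕ → Ω → EuclideanSpace ℝ (Fin p)} {z : ℕ → Ω → EuclideanSpace ℝ (Fin m)}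
    (hu : ∀ t, Measurable (u t)) (hz : ∀ t, Measurable (z t)) (L T : ℕ) (K : ℝ)
    (a : Fin m → ℝ) (b : FeatIdx p L → ℝ) :
    Measurable fun ω => penalized L T K (fun t => u t ω) (fun t => (z t ω).ofLp) a b := by
  have hc : Continuous fun q : (ℕ → EuclideanSpace ℝ (Fin p)) × (ℕ → EuclideanSpace ℝ (Fin m)) =>
      penalized L T K q.1 (fun t => (q.2 t).ofLp) a b :=
    continuous_penalized L T K continuous_fst (fun t => by fun_prop) a b
  have hm : Measurable fun ω => ((fun t => u t ω, fun t => z t ω) :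
      (ℕ → EuclideanSpace ℝ (Fin p)) × (ℕ → EuclideanSpace ℝ (Fin m))) :=
    (measurable_pi_lambda _ hu).prodMk (measurable_pi_lambda _ hz)
  have h := hc.measurable.comp hm
  exact h

theorem measurable_penalized_process (S : BLDS n p m) {Ω : Type*} [MeasurableSpace Ω]
    {u : ℕ → Ω → EuclideanSpace ℝ (Fin p)} {w : ℕ → Ω → EuclideanSpace ℝ (Fin n)}
    (hu : ∀ t, Measurable (u t)) (hw : ∀ t, Measurable (w t)) (L T : ℕ) (K : ℝ)
    (a : Fin m → ℝ) (b : FeatIdx p L → ℝ) :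
    Measurable fun ω => penalized L T K (fun t => u t ω) (fun t => ∑ s ∈ Finset.range (t - 0),
      (S.C * S.transition (fun t => u t ω) (s + 1) (t - 1 - s)) *ᵥ (w s ω).ofLp) a b := by
  have hc : Continuous fun q : (ℕ → EuclideanSpace ℝ (Fin p)) × (ℕ → EuclideanSpace ℝ (Fin n)) =>
      penalized L T K q.1 (fun t => ∑ s ∈ Finset.range (t - 0),
        (S.C * S.transition q.1 (s + 1) (t - 1 - s)) *ᵥ (q.2 s).ofLp) a b :=
    continuous_penalized L T K continuous_fst (fun t => continuous_finsetSum _ fun s _ =>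
      (continuous_const.matrix_mul ((continuous_transition S _ _).comp
        continuous_fst)).matrix_mulVec (by fun_prop)) a b
  have hm : Measurable fun ω => ((fun t => u t ω, fun t => w t ω) :
      (ℕ → EuclideanSpace ℝ (Fin p)) × (ℕ → EuclideanSpace ℝ (Fin n))) :=
    (measurable_pi_lambda _ hu).prodMk (measurable_pi_lambda _ hw)
  have h := hc.measurable.comp hm
  exact h

theorem measurable_penalized_input (S : BLDS n p m) (L T : ℕ) (K : ℝ)
    (a : Fin m → ℝ) (b : FeatIdx p L → ℝ) :
    Measurable fun u => penalized L T K u (fun t => ∑ s ∈ Finset.range (t - L),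
      (S.C * S.transition u (s + 1) (t - 1 - s) * S.B) *ᵥ (u s).ofLp) a b :=
  (continuous_penalized L T K continuous_id (fun t => continuous_finsetSum _ fun s _ =>
    ((continuous_const.matrix_mul (continuous_transition S _ _)).matrix_mul
      continuous_const).matrix_mulVec (by fun_prop)) a b).measurable

/-- Tail bound for the cross moment of the covariates with one error process. -/
theorem measure_crossMoment_sq_gt_le [NeZero p] {L T : ℕ} (hTL : L ≤ T) {Ω : Type*}
    [MeasurableSpace Ω] {μ : Measure Ω} [IsProbabilityMeasure μ]
    {U : Ω → ℕ → EuclideanSpace ℝ (Fin p)} (hU : Measurable U) (hlaw : μ.map U = inputLaw p)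
    {K : ℝ} (hK : 0 < K) {ℓ τ : ℝ} (hℓ : 0 ≤ ℓ)
    (hτ : ℓ + m + ((p : ℝ) + 1) ^ (L + 1) ≤ τ) {e : Ω → ℕ → Fin m → ℝ}
    (hm : ∀ a b, Measurable fun ω => penalized L T K (U ω) (e ω) a b)
    (he : ∀ a b, ∫⁻ ω, ENNReal.ofReal (Real.exp (penalized L T K (U ω) (e ω) a b)) ∂μ ≤ 1) :
    μ {ω | ¬ ∀ b, (crossMoment L T (U ω) (e ω) *ᵥ b) ⬝ᵥ (crossMoment L T (U ω) (e ω) *ᵥ b) ≤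
      (13 * K) ^ 2 * τ * (b ⬝ᵥ (gram L T (U ω) *ᵥ b) + ((T : ℝ) - L + 1) * (b ⬝ᵥ b))} ≤
      ENNReal.ofReal (Real.exp (-ℓ)) := by
  have hTL' : (L : ℝ) ≤ T := by exact_mod_cast hTL
  have hτ0 : 0 < τ := lt_of_lt_of_le (by positivity) hτ
  have hcard : (Fintype.card (FeatIdx p L) : ℝ) ≤ ((p : ℝ) + 1) ^ (L + 1) := by
    exact_mod_cast card_featIdx_le p L
  refine measure_mulVec_sq_gt_le (fun ω => crossMoment L T (U ω) (e ω))
    (fun ω => gram L T (U ω)) (by linarith) hK (fun a b => (hm a b).aemeasurable)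
    he (fun ω => ?_) (fun ω b => ?_) ?_ hcard hℓ (by simpa using hτ) hτ0
  · simpa using (gram_isHermitian L T (U ω)).eq
  · rw [gram_quadForm]; exact Finset.sum_nonneg fun _ _ => sq_nonneg _
  · have h := norm_ae_inputLaw (p := p)
    rw [← hlaw] at h
    filter_upwards [ae_of_ae_map hU.aemeasurable h] with ω hω
    exact sum_gram_diag_le hTL hω

/-- The error bound of the least-squares estimator with explicit constants. -/
theorem measure_norm_lse_sub_le {n p m L T : ℕ} (hp : 1 ≤ p) (hL : 1 ≤ L) {S : BLDS n p m}
    {κ ρ σ δ : ℝ} (hS : S.UniformlyStable (Metric.sphere 0 (Real.sqrt p)) κ ρ)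
    (hσ : 0 < σ) (hδ : 0 < δ) (hδ1 : δ < 1)
    {Ω : Type*} [MeasurableSpace Ω] {μ : Measure Ω} [IsProbabilityMeasure μ]
    {u : ℕ → Ω → EuclideanSpace ℝ (Fin p)} {w : ℕ → Ω → EuclideanSpace ℝ (Fin n)}
    {z : ℕ → Ω → EuclideanSpace ℝ (Fin m)}
    (hu : ∀ t, Measurable (u t)) (hw : ∀ t, Measurable (w t)) (hz : ∀ t, Measurable (z t))
    (hui : iIndepFun u μ) (hulaw : ∀ t, μ.map (u t) = unifSphere p)
    (hwi : iIndepFun w μ) (hws : ∀ t, IsCenteredSubgaussian μ n σ (w t))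
    (hzi : iIndepFun z μ) (hzs : ∀ t, IsCenteredSubgaussian μ m σ (z t))
    (hind : IndepFun (fun ω t => u t ω) (fun ω t => (w t ω, z t ω)) μ)
    (hT : 9 * (L * (L + 1) * (3 * p / (p + 2) : ℝ) ^ (L + 1) *
      (Real.log ((L + 1) / δ) +
        (p + 1 : ℝ) ^ (L + 1) * Real.log ((p + 1 : ℝ) ^ (L + 1) / δ))) ≤ (T : ℝ) - L) :
    ENNReal.ofReal (1 - δ) ≤ μ {ω |
      ‖lse L T (fun t => u t ω)
          (S.output (fun t => u t ω) (fun t => w t ω) (fun t => z t ω)) - S.markov L‖ ≤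
        100000 * ((1 + σ) * (1 + ‖S.B‖) * (1 + ‖S.C‖) * (κ ^ 2 * ρ ^ L + κ) / (1 - ρ)) *
          Real.sqrt (L * (p : ℝ) ^ 2 * (p + 1 : ℝ) ^ (L + 1) *
            (Real.log (Real.exp 1 * L / δ) + m + n * L + (p + 1 : ℝ) ^ (L + 1)) /
              ((T : ℝ) - L))} := by
  classical
  have : NeZero p := ⟨by omega⟩
  have hp' : (1 : ℝ) ≤ p := by exact_mod_cast hp
  have hL' : (1 : ℝ) ≤ L := by exact_mod_cast hL
  set D : ℝ := ((p : ℝ) + 1) ^ (L + 1) with hD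
  have hD4 : 4 ≤ D := by
    calc (4 : ℝ) = 2 ^ 2 := by norm_num
      _ ≤ ((p : ℝ) + 1) ^ 2 := by gcongr; linarith
      _ ≤ D := pow_le_pow_right₀ (by linarith) (by omega)
  have hlogDδ : 0 < Real.log (D / δ) := Real.log_pos (by rw [lt_div_iff₀ hδ]; linarith)
  have hT' : 9 * (L * (L + 1) * (D * Real.log (D / δ))) ≤ (T : ℝ) - L := by
    refine le_trans ?_ hT
    have h1 : (1 : ℝ) ≤ (3 * p / (p + 2) : ℝ) ^ (L + 1) :=
      one_le_pow₀ (by rw [le_div_iff₀ (by linarith)]; linarith)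
    have h2 : 0 ≤ Real.log (((L : ℝ) + 1) / δ) :=
      Real.log_nonneg (by rw [le_div_iff₀ hδ]; linarith)
    have h3 : L * (L + 1) * (1 : ℝ) * (0 + D * Real.log (D / δ)) ≤
        L * (L + 1) * (3 * p / (p + 2) : ℝ) ^ (L + 1) *
          (Real.log ((L + 1) / δ) + D * Real.log (D / δ)) := by gcongr
    linarith
  have hTL : L < T := by
    have : 0 < 9 * (L * (L + 1) * (D * Real.log (D / δ))) := by positivity
    have h2 : (L : ℝ) < T := by linarith
    exact_mod_cast h2
  have hN1 : (1 : ℝ) ≤ (T : ℝ) - L := by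
    have : ((L + 1 : ℕ) : ℝ) ≤ T := by exact_mod_cast hTL
    push_cast at this
    linarith
  set U : Ω → ℕ → EuclideanSpace ℝ (Fin p) := fun ω t => u t ω with hU
  have hUm : Measurable U := measurable_pi_lambda _ hu
  have hlaw : μ.map U = inputLaw p := by
    rw [hU, hui.map_fun_eq_infinitePi_map hu, inputLaw]
    congr 1
    funext t
    exact hulaw t
  have huw : IndepFun U (fun ω t => w t ω) μ := by
    have h := hind.comp (φ := id) (ψ := fun (q : ℕ → EuclideanSpace ℝ (Fin n) ×
      EuclideanSpace ℝ (Fin m)) t => (q t).1) measurable_id (by fun_prop)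
    exact h
  have huz : IndepFun U (fun ω t => z t ω) μ := by
    have h := hind.comp (φ := id) (ψ := fun (q : ℕ → EuclideanSpace ℝ (Fin n) ×
      EuclideanSpace ℝ (Fin m)) t => (q t).2) measurable_id (by fun_prop)
    exact h
  have hκ := hS.one_le
  have hρ : 0 < 1 - ρ := sub_pos.2 hS.lt_one
  have hρ0 := hS.pos
  have hB := norm_nonneg S.B
  have hC := norm_nonneg S.C
  set A : ℝ := (1 + σ) * (1 + ‖S.B‖) * (1 + ‖S.C‖) * (κ ^ 2 * ρ ^ L + κ) / (1 - ρ) with hA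
  have hA0 : 0 < A := by positivity
  -- One `K` dominates the scale of all three parts of the error. The factor `√p` is needed for the
  -- old inputs, whose variance proxy is `p`, and `κ ρ^L ≤ κ² ρ^L` since `1 ≤ κ`.
  set K : ℝ := Real.sqrt p * A with hK
  have hsp : 1 ≤ Real.sqrt p := Real.one_le_sqrt.2 hp'
  have hAK : A ≤ K := le_mul_of_one_le_left hA0.le hsp
  have hK0 : 0 < K := hA0.trans_le hAK
  have hKz : σ ≤ K := by
    refine le_trans ?_ hAK
    rw [hA, le_div_iff₀ hρ]
    calc σ * (1 - ρ) ≤ (1 + σ) * 1 := by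
          gcongr <;> linarith
      _ = (1 + σ) * 1 * 1 * (0 + 1) := by ring
      _ ≤ _ := by gcongr <;> first | linarith | positivity
  have hKw : σ * (‖S.C‖ * κ / (1 - ρ)) ≤ K := by
    refine le_trans ?_ hAK
    rw [hA, ← mul_div_assoc]
    refine div_le_div_of_nonneg_right ?_ hρ.le
    calc σ * (‖S.C‖ * κ) = σ * 1 * ‖S.C‖ * (0 + κ) := by ring
      _ ≤ _ := by gcongr <;> first | linarith | positivity
  have hKu : Real.sqrt p * (‖S.C‖ * κ * ‖S.B‖ * ρ ^ L / (1 - ρ)) ≤ K := by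
    rw [hK, hA]
    refine mul_le_mul_of_nonneg_left (div_le_div_of_nonneg_right ?_ hρ.le) (Real.sqrt_nonneg _)
    calc ‖S.C‖ * κ * ‖S.B‖ * ρ ^ L = 1 * ‖S.B‖ * ‖S.C‖ * (κ * 1 * ρ ^ L + 0) := by ring
      _ ≤ (1 + σ) * (1 + ‖S.B‖) * (1 + ‖S.C‖) * (κ * κ * ρ ^ L + κ) := by
          gcongr <;> linarith
      _ = _ := by ring
  -- Four exceptional events, one for the Gram matrix and three for the cross moments, receive
  -- probability `δ/4` each.
  set ℓ : ℝ := Real.log (4 / δ) with hℓ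
  have hℓ0 : 0 ≤ ℓ := Real.log_nonneg (by rw [le_div_iff₀ hδ]; linarith)
  set τ : ℝ := ℓ + m + D with hτ
  have hτ0 : 0 < τ := by positivity
  have hexpℓ : Real.exp (-ℓ) = δ / 4 := by
    rw [hℓ, ← Real.log_inv, inv_div, Real.exp_log (by positivity)]
  set N : ℝ := (T : ℝ) - L + 1 with hN
  have hz' := measure_crossMoment_sq_gt_le hTL.le hUm hlaw hK0 hℓ0 hτ.ge
    (measurable_penalized_measurement hu hz L T K)
    (lintegral_exp_penalized_measurement hu hz hσ.le hKz hzi hzs huz L T)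
  have hw' := measure_crossMoment_sq_gt_le hTL.le hUm hlaw hK0 hℓ0 hτ.ge
    (measurable_penalized_process S hu hw L T K)
    (lintegral_exp_penalized_process hS hu hlaw hw hσ.le hKw hwi hws huw L T)
  have hUc := measurable_penalized_input S L T K
  have hu' := measure_crossMoment_sq_gt_le hTL.le hUm hlaw hK0 hℓ0 hτ.ge
    (fun a b => (hUc a b).comp hUm) fun a b => by
      have h := lintegral_exp_penalized_input hS T hKu a b
      rwa [← hlaw, lintegral_map (hUc a b).exp.ennreal_ofReal hUm] at h
  rw [hexpℓ] at hz' hw' hu'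
  set Λ : ℝ := ((T : ℝ) - L) / (108 * (L + 1) * Real.log D) with hΛ
  have hlogD : 1 ≤ Real.log D := by
    have h1 : Real.log 4 ≤ Real.log D := Real.log_le_log (by norm_num) hD4
    have h2 : Real.log 4 = 2 * Real.log 2 := by
      rw [show (4 : ℝ) = 2 ^ 2 by norm_num, Real.log_pow]; norm_num
    linarith [Real.log_two_gt_d9]
  have hden : 1 ≤ 108 * ((L : ℝ) + 1) * Real.log D := by
    calc (1 : ℝ) ≤ 108 * (0 + 1) * 1 := by norm_num
      _ ≤ _ := by gcongr; linarith
  have hΛ0 : 0 < Λ := div_pos (by linarith) (by linarith)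
  have hΛN : Λ ≤ N := (div_le_self (by linarith) hden).trans (by linarith)
  have hg' : μ {ω | ¬ ∀ b : FeatIdx p L → ℝ,
      Λ * (b ⬝ᵥ b) ≤ b ⬝ᵥ (gram L T (U ω) *ᵥ b)} ≤ ENNReal.ofReal (δ / 4) := by
    refine le_trans ?_ (measure_gram_lt_le_of_long hL hδ hδ1 hT')
    rw [← hlaw]
    exact Measure.le_map_apply hUm.aemeasurable _
  let bad₁ := {ω | ¬ ∀ b : FeatIdx p L → ℝ,
      Λ * (b ⬝ᵥ b) ≤ b ⬝ᵥ (gram L T (U ω) *ᵥ b)}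
  let eW : Ω → ℕ → Fin m → ℝ := fun ω t => ∑ s ∈ Finset.range (t - 0),
    (S.C * S.transition (U ω) (s + 1) (t - 1 - s)) *ᵥ (w s ω).ofLp
  let eU : Ω → ℕ → Fin m → ℝ := fun ω t => ∑ s ∈ Finset.range (t - L),
    (S.C * S.transition (U ω) (s + 1) (t - 1 - s) * S.B) *ᵥ (U ω s).ofLp
  let bad₂ := {ω | ¬ ∀ b, (crossMoment L T (U ω) (fun t => (z t ω).ofLp) *ᵥ b) ⬝ᵥ
        (crossMoment L T (U ω) (fun t => (z t ω).ofLp) *ᵥ b) ≤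
        (13 * K) ^ 2 * τ * (b ⬝ᵥ (gram L T (U ω) *ᵥ b) + N * (b ⬝ᵥ b))}
  let bad₃ := {ω | ¬ ∀ b, (crossMoment L T (U ω) (eW ω) *ᵥ b) ⬝ᵥ
        (crossMoment L T (U ω) (eW ω) *ᵥ b) ≤
        (13 * K) ^ 2 * τ * (b ⬝ᵥ (gram L T (U ω) *ᵥ b) + N * (b ⬝ᵥ b))}
  let bad₄ := {ω | ¬ ∀ b, (crossMoment L T (U ω) (eU ω) *ᵥ b) ⬝ᵥ
        (crossMoment L T (U ω) (eU ω) *ᵥ b) ≤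
        (13 * K) ^ 2 * τ * (b ⬝ᵥ (gram L T (U ω) *ᵥ b) + N * (b ⬝ᵥ b))}
  let good := {ω |
          ‖lse L T (fun t => u t ω)
              (S.output (fun t => u t ω) (fun t => w t ω) (fun t => z t ω)) - S.markov L‖ ≤
            100000 * A *
              Real.sqrt (L * (p : ℝ) ^ 2 * D *
                (Real.log (Real.exp 1 * L / δ) + m + n * L + D) /
                  ((T : ℝ) - L))}
  -- A cover of the whole space needs only subadditivity, so measurability of these events plays no
  -- part.
  have hcover : (Set.univ : Set Ω) ⊆ good ∪ (bad₁ ∪ (bad₂ ∪ (bad₃ ∪ bad₄))) := by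
    intro ω _
    by_contra hcon
    simp only [Set.mem_union, not_or] at hcon
    obtain ⟨h0, h1, h2, h3, h4⟩ := hcon
    have h1 := not_not.1 h1
    have h2 := not_not.1 h2
    have h3 := not_not.1 h3
    have h4 := not_not.1 h4
    refine h0 ?_
    have hlse := norm_lse_sub_le (T := T) (u := U ω)
      (y := S.output (fun t => u t ω) (fun t => w t ω) (fun t => z t ω)) (G := S.markov L)
      (fun t ht => S.output_eq (U ω) (fun t => w t ω) (fun t => z t ω) ht)
      hΛ0 hΛN (R := (13 * K) ^ 2 * τ) (by positivity) h1 (by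
        rintro e (rfl | rfl | rfl)
        · exact h2
        · exact h3
        · exact h4)
    refine le_trans hlse ?_
    have hlogL : 0 ≤ Real.log L := Real.log_nonneg hL'
    have hlogδ : 0 ≤ Real.log (1 / δ) := Real.log_nonneg (by rw [le_div_iff₀ hδ]; linarith)
    have hlogeL : Real.log (Real.exp 1 * L / δ) = 1 + Real.log L + Real.log (1 / δ) := by
      rw [← mul_one_div, Real.log_mul (by positivity) (by positivity),
        Real.log_mul (by positivity) (by positivity), Real.log_exp]
    have hℓle : ℓ ≤ 2 + Real.log (1 / δ) := by
      rw [hℓ, ← mul_one_div, Real.log_mul (by positivity) (by positivity),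
        show (4 : ℝ) = 2 ^ 2 by norm_num, Real.log_pow]
      have := Real.log_two_lt_d9
      push_cast
      linarith
    have hnL : 0 ≤ (n : ℝ) * L := by positivity
    have hm0 : (0 : ℝ) ≤ m := Nat.cast_nonneg m
    exact rate_le hp hL hA0.le (by rw [hlogeL]; linarith)
      (by rw [hlogeL, hτ]; linarith) hN1
  have hμ : 1 ≤ μ good + ENNReal.ofReal δ := by
    calc (1 : ℝ≥0∞) = μ Set.univ := measure_univ.symm
      _ ≤ μ (good ∪ (bad₁ ∪ (bad₂ ∪ (bad₃ ∪ bad₄)))) := measure_mono hcover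
      _ ≤ μ good + (μ bad₁ + (μ bad₂ + (μ bad₃ + μ bad₄))) := by
          refine (measure_union_le _ _).trans (add_le_add_right ?_ _)
          refine (measure_union_le _ _).trans (add_le_add_right ?_ _)
          refine (measure_union_le _ _).trans (add_le_add_right ?_ _)
          exact measure_union_le _ _
      _ ≤ μ good + (ENNReal.ofReal (δ / 4) + (ENNReal.ofReal (δ / 4) +
            (ENNReal.ofReal (δ / 4) + ENNReal.ofReal (δ / 4)))) := by
          gcongr
      _ = μ good + ENNReal.ofReal δ := by
          rw [← ENNReal.ofReal_add (by positivity) (by positivity),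
            ← ENNReal.ofReal_add (by positivity) (by positivity),
            ← ENNReal.ofReal_add (by positivity) (by positivity)]
          congr 2
          ring
  rw [ENNReal.ofReal_sub _ hδ.le, ENNReal.ofReal_one]
  exact tsub_le_iff_right.2 hμ

end BLDS

theorem theorem1 :
    ∃ (c : ℝ) (P : MvPolynomial (Fin 3) ℝ), 0 < c ∧
      (∀ σ b g : ℝ, 0 < σ → 0 ≤ b → 0 ≤ g → 0 < MvPolynomial.eval ![σ, b, g] P) ∧
      ∀ (n p m L T : ℕ) (_ : 1 ≤ p) (_ : 1 ≤ L) (S : BLDS n p m) (κ ρ σ δ : ℝ)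
        (_ : S.UniformlyStable (Metric.sphere 0 (Real.sqrt p)) κ ρ)
        (_ : 0 < σ) (_ : 0 < δ) (_ : δ < 1)
        (Ω : Type*) (_ : MeasurableSpace Ω) (μ : Measure Ω) (_ : IsProbabilityMeasure μ)
        (u : ℕ → Ω → EuclideanSpace ℝ (Fin p))
        (w : ℕ → Ω → EuclideanSpace ℝ (Fin n))
        (z : ℕ → Ω → EuclideanSpace ℝ (Fin m))
        (_ : ∀ t, Measurable (u t)) (_ : ∀ t, Measurable (w t)) (_ : ∀ t, Measurable (z t))
        -- the inputs are i.i.d. uniform on the sphere of radius `√p`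
        (_ : iIndepFun u μ) (_ : ∀ t, μ.map (u t) = BLDS.unifSphere p)
        -- each noise process is a sequence of independent centered subgaussian vectors
        (_ : iIndepFun w μ) (_ : ∀ t, BLDS.IsCenteredSubgaussian μ n σ (w t))
        (_ : iIndepFun z μ) (_ : ∀ t, BLDS.IsCenteredSubgaussian μ m σ (z t))
        -- the input process is independent of the noise
        (_ : IndepFun (fun ω t => u t ω) (fun ω t => (w t ω, z t ω)) μ)
        -- the trajectory is long enough
        (_ : c * (L * (L + 1) * (3 * p / (p + 2) : ℝ) ^ (L + 1) *
            (Real.log ((L + 1) / δ) +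
              (p + 1 : ℝ) ^ (L + 1) * Real.log ((p + 1 : ℝ) ^ (L + 1) / δ))) ≤ (T : ℝ) - L),
        ENNReal.ofReal (1 - δ) ≤ μ {ω |
          ‖BLDS.lse L T (fun t => u t ω)
              (S.output (fun t => u t ω) (fun t => w t ω) (fun t => z t ω)) - S.markov L‖ ≤
            MvPolynomial.eval ![σ, ‖S.B‖, ‖S.C‖] P * (κ ^ 2 * ρ ^ L + κ) / (1 - ρ) *
              Real.sqrt (L * (p : ℝ) ^ 2 * (p + 1 : ℝ) ^ (L + 1) *
                (Real.log (Real.exp 1 * L / δ) + m + n * L + (p + 1 : ℝ) ^ (L + 1)) /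
                  ((T : ℝ) - L))} := by
  -- `9` is the constant required for the Gram bound, and the polynomial is `100000 (1 + σ)(1 +
  -- ‖B‖)(1 + ‖C‖)`.
  refine ⟨9, MvPolynomial.C 100000 * (1 + MvPolynomial.X 0) * (1 + MvPolynomial.X 1) *
    (1 + MvPolynomial.X 2), by norm_num, fun σ b g hσ hb hg => by simp; positivity, ?_⟩
  intro n p m L T hp hL S κ ρ σ δ hS hσ hδ hδ1 Ω _ μ _ u w z hu hw hz hui hulaw hwi hws hzi hzs
    hind hT
  refine (BLDS.measure_norm_lse_sub_le hp hL hS hσ hδ hδ1 hu hw hz hui hulaw hwi hws hzi hzs hind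
    hT).trans (measure_mono fun ω hω => ?_)
  refine Set.mem_ofPred.2 (le_trans hω (le_of_eq ?_))
  congr 1
  simp
  ring
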